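/- Let $r=\infty$ or $r=\omega$, where $C^\omega$ means real analytic. Let $U\subset\mathbb R^2$ be open, $f:U\to\mathbb R^3$ a $C^r$-map, and $p\in U$ a cuspidal edge, a swallowtail or a cuspidal cross cap of $f$. This means that the germ of $f$ at $p$ is $C^r$ right-left equivalent to the germ at the origin of, respectively, $f_C(u,v)=(v^2,v^3,u)$, $f_S(u,v)=(3v^4+uv^2,\,4v^3+2uv,\,u)$ or $f_{CW}(u,v)=(v^2,uv^3,u)$. Then $f$ has a unit normal $C^r$-vector field $\nu$ near $p$. For any such $\nu$ define the following. - The *tangent line* $l_1$ is the line through $f(p)$ in the direction of the image of $df_p$. - The *limiting tangent plane* $\Pi_0$ is the plane through $f(p)$ perpendicular to $\nu(p)$. - The *normal plane* $\Pi_1$ is the plane through $f(p)$ perpendicular to $l_1$. - The *co-normal plane* $\Pi_2$ is the plane through $f(p)$ spanned by $\nu(p)$ and the direction of $l_1$. - The *co-normal line* $l_2=\Pi_0\cap\Pi_1$ is the line in $\Pi_0$ through $f(p)$ perpendicular to $l_1$. Let $T$ be an isometry of $\mathbb R^3$ with $T(f(p))=f(p)$. Suppose that $T\circ f(V)\subset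 f(U)$ in the sense of germs at $p$: for every open neighborhood $U'\subset U$ of $p$ there is an open neighborhood $V\subset U$ of $p$ with $T\circ f(V)\subset f(U')$. Then $T$ is an involution. If $T$ is not the identity map, then $T$ is (i) the reflection in $\Pi_0$, or (ii) the reflection in $\Pi_1$, or (iii) the reflection in $\Pi_2$, or (iv) the $180^\circ$-rotation about $l_2$. Moreover, for every open neighborhood $V\subset U$ of $p$ there exist a connected open neighborhood $W\subset V$ of $p$ and a $C^r$-involution $\psi:W\to W$ with $f\circ\psi=T\circ f$ on $W$, such that (c2) below holds. Furthermore, if $T$ is not the identity map, the following assertions hold. (c1) If $p$ is a cuspidal edge or a cuspidal cross cap, then (iii) does not occur. If in addition the limiting normal curvature of $f$ at $p$ does not vanish, then only (ii) occurs. Here the limiting normal curvature is $$\kappa_\nu(p)=\frac{(f\circ\gamma)''(0)\cdot\nu(p)}{(f\circ\gamma)'(0)\cdot(f\circ\gamma)'(0)},$$ where $\gamma$ is a regular $C^r$-curve with $\gamma(0)=p$ that parametrizes the singular set of $f$ near $p$. (c2) Let $p$ be a swallowtail or a cuspidal cross cap, and let $S=\{q\in W:\ f(q')=f(q)\text{ for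 some }q'\in W,\ q'\neq q\}$ be the set of self-intersections of $f|_W$. Then $f\circ\psi(q)=f(q)$ for every $q\in S$. If, moreover, $T$ is not the rotation (iv), then $\psi(q)=q$ with $q\in S$ implies $q=p$. In particular, each point of $f(S)$ is fixed by $T$. (c3) If $p$ is a swallowtail, then only (iii) occurs. -/

import Mathlib

open Set Filter Topology
open scoped ContDiff

/-- The source plane, with coordinates `(u, v) = (x 0, x 1)`. -/
abbrev Plane : Type := EuclideanSpace ℝ (Fin 2)

/-- Euclidean three-space. -/
abbrev Space : Type := EuclideanSpace ℝ (Fin 3)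

/-- The standard cuspidal edge `(u, v) ↦ (v², v³, u)`. -/
noncomputable def stdCuspidalEdge (x : Plane) : Space :=
  !₂[x 1 ^ 2, x 1 ^ 3, x 0]

/-- The standard swallowtail `(u, v) ↦ (3v⁴ + uv², 4v³ + 2uv, u)`. -/
noncomputable def stdSwallowtail (x : Plane) : Space :=
  !₂[3 * x 1 ^ 4 + x 0 * x 1 ^ 2, 4 * x 1 ^ 3 + 2 * x 0 * x 1, x 0]

/-- The standard cuspidal cross cap `(u, v) ↦ (v², uv³, u)`. -/
noncomputable def stdCuspidalCrossCap (x : Plane) : Space :=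
  !₂[x 1 ^ 2, x 0 * x 1 ^ 3, x 0]

/-- The germ of `f` at `p` is `C^r` right-left equivalent to the germ of `g` at `q`:
there are local `C^r`-diffeomorphisms `φ` of the plane with `φ p = q` and `Φ` of the space with
`Φ (f p) = g q` such that `Φ ∘ f = g ∘ φ` near `p`. -/
def RightLeftEquivalentAt (r : WithTop ℕ∞) (f : Plane → Space) (p : Plane)
    (g : Plane → Space) (q : Plane) : Prop :=
  ∃ (φ : OpenPartialHomeomorph Plane Plane) (Φ : OpenPartialHomeomorph Space Space),
    p ∈ φ.source ∧ φ p = q ∧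
    ContDiffOn ℝ r φ φ.source ∧ ContDiffOn ℝ r φ.symm φ.target ∧
    f p ∈ Φ.source ∧ Φ (f p) = g q ∧
    ContDiffOn ℝ r Φ Φ.source ∧ ContDiffOn ℝ r Φ.symm Φ.target ∧
    ∀ᶠ x in 𝓝 p, Φ (f x) = g (φ x)

/-- `p` is a cuspidal edge (singular point) of `f`. -/
def IsCuspidalEdge (r : WithTop ℕ∞) (f : Plane → Space) (p : Plane) : Prop :=
  RightLeftEquivalentAt r f p stdCuspidalEdge 0

/-- `p` is a swallowtail of `f`. -/
def IsSwallowtail (r : WithTop ℕ∞) (f : Plane → Space) (p : Plane) : Prop :=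
  RightLeftEquivalentAt r f p stdSwallowtail 0

/-- `p` is a cuspidal cross cap of `f`. -/
def IsCuspidalCrossCap (r : WithTop ℕ∞) (f : Plane → Space) (p : Plane) : Prop :=
  RightLeftEquivalentAt r f p stdCuspidalCrossCap 0

/-- `ν` is a unit normal `C^r`-vector field of `f` on a neighborhood of `p`. -/
def IsUnitNormalNear (r : WithTop ℕ∞) (f : Plane → Space) (p : Plane) (ν : Plane → Space) :
    Prop :=
  ∃ N : Set Plane, IsOpen N ∧ p ∈ N ∧ ContDiffOn ℝ r ν N ∧
    ∀ q ∈ N, ‖ν q‖ = 1 ∧ ∀ w : Plane, inner ℝ (fderiv ℝ f q w) (ν q) = 0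

/-- The direction of the tangent line of `f` at a co-rank one singular point `p`: the image of the
differential, which is spanned by `f_u(p)` in any coordinates `(u, v)` with `f_v(p) = 0`. -/
noncomputable def tangentDirection (f : Plane → Space) (p : Plane) : Submodule ℝ Space :=
  LinearMap.range (fderiv ℝ f p : Plane →ₗ[ℝ] Space)

/-- The limiting tangent plane `Π₀`: through `f p`, perpendicular to the unit normal `n`. -/
noncomputable def limitingTangentPlane (f : Plane → Space) (p : Plane) (n : Space) :
    AffineSubspace ℝ Space :=
  AffineSubspace.mk' (f p) (ℝ ∙ n)ᗮ

/-- The normal plane `Π₁`: through `f p`, perpendicular to the tangent line. -/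
noncomputable def normalPlane (f : Plane → Space) (p : Plane) : AffineSubspace ℝ Space :=
  AffineSubspace.mk' (f p) (tangentDirection f p)ᗮ

/-- The co-normal plane `Π₂`: through `f p`, spanned by the unit normal `n` and the tangent
line. -/
noncomputable def conormalPlane (f : Plane → Space) (p : Plane) (n : Space) :
    AffineSubspace ℝ Space :=
  AffineSubspace.mk' (f p) ((ℝ ∙ n) ⊔ tangentDirection f p)

/-- The co-normal line `l₂`: the line in the limiting tangent plane through `f p` that is
perpendicular to the tangent line. -/
noncomputable def conormalLine (f : Plane → Space) (p : Plane) (n : Space) :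
    AffineSubspace ℝ Space :=
  AffineSubspace.mk' (f p) ((ℝ ∙ n)ᗮ ⊓ (tangentDirection f p)ᗮ)

/-- `T` is the orthogonal reflection in the affine subspace `s`: the mirror reflection if `s` is
a plane, the rotation by `180°` about `s` if `s` is a line. -/
def IsReflectionIn (T : Space ≃ᵢ Space) (s : AffineSubspace ℝ Space) : Prop :=
  ∃ _ : Nonempty s, ∀ x, T x = EuclideanGeometry.reflection s x

/-- The set of singular points of `f` in `U`. -/
def singularSet (f : Plane → Space) (U : Set Plane) : Set Plane :=
  {q | q ∈ U ∧ ¬ Function.Injective (fderiv ℝ f q)}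

/-- `γ` is a singular curve of `f : U → ℝ³` at `p`: a regular `C^r`-curve with `γ 0 = p` that
parametrizes the singular set near `p`. -/
def IsSingularCurve (r : WithTop ℕ∞) (f : Plane → Space) (U : Set Plane) (p : Plane)
    (γ : ℝ → Plane) : Prop :=
  γ 0 = p ∧ ∃ ε > 0, ContDiffOn ℝ r γ (Ioo (-ε) ε) ∧
    (∀ t ∈ Ioo (-ε) ε, deriv γ t ≠ 0 ∧ γ t ∈ singularSet f U) ∧
    γ '' Ioo (-ε) ε ∈ 𝓝[singularSet f U] p

/-- The limiting normal curvature at `γ 0`, computed with the singular curve `γ` and the unit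
normal `n` there: `((f ∘ γ)''(0) · n) / ((f ∘ γ)'(0) · (f ∘ γ)'(0))`. -/
noncomputable def limitingNormalCurvature (f : Plane → Space) (γ : ℝ → Plane) (n : Space) : ℝ :=
  inner ℝ (deriv (deriv (f ∘ γ)) 0) n / inner ℝ (deriv (f ∘ γ) 0) (deriv (f ∘ γ) 0)

/-- The set of self-intersections of the restriction of `f` to `W`. -/
def selfIntersectionSet (f : Plane → Space) (W : Set Plane) : Set Plane :=
  {q | q ∈ W ∧ ∃ q' ∈ W, q' ≠ q ∧ f q' = f q}

/-! In the coordinates of the normal form the germ is one of the three standard maps `g`, and the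
isometry becomes a germ `τ = Φ ∘ T ∘ Φ'` of diffeomorphism carrying the image germ of `g` into
itself (`LocalSymmetry`). The plan is to lift `τ` to a `C^r`-germ `ψ` with `g ∘ ψ = τ ∘ g`, to read
the diagonal entries of `dτ(0)` off `ψ`, and to use that `dτ(0)` is conjugate to an orthogonal map.

Lifting. Each `g` has a nowhere vanishing normal `N = GU × E`, even at singular points, and its
image lies in the zero set of a polynomial `G` whose gradient along `g` is `mu · N`
(`FrontalModel`). An immersed surface in the image of `g` cannot stay in the curves where the
gradient vanishes. Hence for densely many `q` the tangent plane of `τ ∘ g` at `q` is that of `g` at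
some preimage `q'` of `τ (g q)` (`frequently_exists_lift`). For the cuspidal edge and the
swallowtail the parameter `v'` of `q'` is a slope of the normal, so it is a `C^r` function of `q`,
and continuity extends the lift to all `q` (`lift_of_formula`). For the cuspidal cross cap only
`v'^2` and `v'^3` are visible. Their quotient is `C^r` by Hadamard division (`exists_eq_mul`), once
the singular axis is known to be preserved (`cuspidalCrossCap_axis`).

Eigenvalues. `dτ(0)` is triangular, with diagonal `α, β, δ`, in a frame adapted to the tangent line
and the limiting tangent plane. Let `ρ` be the derivative of `ψ` along the null direction. Comparing
orders of vanishing in the lifting and tangency equations gives `β ≥ 0` for the edge, `β = ρ²` and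
`δ = αρ³` for the cross cap, and `β = ρ³`, `δ = ρβ = ρ²α` for the swallowtail. A triangular isometry
is diagonal with entries `±1` in the orthogonalized frame (`exists_signFrame`), which consists of
the tangent direction, the co-normal direction and the unit normal. So `T` is an involution. For the
edge and the cross cap `β = 1`, which leaves the identity, two reflections and the rotation. For the
swallowtail `α = δ = 1`, which leaves the identity and the reflection in the co-normal plane.

Lift and self-intersections. Since `T` is an involution and `g` is generically injective, `ψ` is an
involution. It preserves the double curve `u = -c v²`, on which it acts as `v ↦ v` or `v ↦ -v`
according to the sign of `ρ` (`lift_double_curve`); both fix the image.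

Curvature. The height `k` over the limiting tangent plane along the image of the singular curve is
critical at `0`. Up to a constant, the isometry multiplies it by `δ`, while `ψ` reparametrizes it by
an involution of derivative `±1`. So `k'' = δ k''`, and `δ = 1` when the limiting normal curvature
is nonzero. -/

/-! ### Hadamard division in the smooth and the analytic class. -/

/-- The parametric integral of a `C^n` function is `C^n`. -/
theorem contDiff_intervalIntegral_param {E : Type} [NormedAddCommGroup E] [NormedSpace ℝ E]
    [FiniteDimensional ℝ E] (n : ℕ) : ∀ {F : Type} [NormedAddCommGroup F] [NormedSpace ℝ F]
    [CompleteSpace F] {k : E → ℝ → F}, ContDiff ℝ n (fun z : E × ℝ => k z.1 z.2) →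
    ContDiff ℝ n (fun x => ∫ t in (0 : ℝ)..1, k x t) := by
  induction n with
  | zero =>
    intro F _ _ _ k hk
    have hc : Continuous (fun z : E × ℝ => k z.1 z.2) := hk.continuous
    rw [Nat.cast_zero, contDiff_zero]
    exact intervalIntegral.continuous_parametric_intervalIntegral_of_continuous' hc 0 1
  | succ n ih =>
    intro F _ _ _ k hk
    -- The derivative is again a parametric integral, now with values in a space of linear maps;
    -- this is why the induction quantifies over `F`.
    set k' : E → ℝ → (E →L[ℝ] F) := fun x t =>
      (fderiv ℝ (fun z : E × ℝ => k z.1 z.2) (x, t)).comp (ContinuousLinearMap.inl ℝ E ℝ) with hk'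
    have hk'c : ContDiff ℝ n (fun z : E × ℝ => k' z.1 z.2) := by
      have h1 : ContDiff ℝ n (fderiv ℝ (fun z : E × ℝ => k z.1 z.2)) :=
        hk.fderiv_right (by norm_cast)
      exact h1.clm_comp contDiff_const
    have hdiff : ∀ x t, HasFDerivAt (fun x => k x t) (k' x t) x := by
      intro x t
      have h1 : HasFDerivAt (fun z : E × ℝ => k z.1 z.2)
          (fderiv ℝ (fun z : E × ℝ => k z.1 z.2) (x, t)) (x, t) :=
        ((hk.differentiable (by norm_cast)) (x, t)).hasFDerivAt
      have h2 : HasFDerivAt (fun x : E => (x, t)) (ContinuousLinearMap.inl ℝ E ℝ) x :=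
        hasFDerivAt_prodMk_left x t
      exact h1.comp x h2
    have hkt : ∀ x, Continuous (k x) := fun x =>
      hk.continuous.comp (Continuous.prodMk_right x)
    have hkt' : ∀ x, Continuous (k' x) := fun x =>
      hk'c.continuous.comp (Continuous.prodMk_right x)
    have hder : ∀ x, HasFDerivAt (fun x => ∫ t in (0 : ℝ)..1, k x t)
        (∫ t in (0 : ℝ)..1, k' x t) x := by
      intro x
      obtain ⟨C, hC⟩ := ((isCompact_closedBall x 1).prod (isCompact_Icc (a := (0 : ℝ)) (b := 1))).exists_bound_of_continuousOn
        (f := fun z : E × ℝ => k' z.1 z.2) hk'c.continuous.continuousOn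
      refine (intervalIntegral.hasFDerivAt_integral_of_dominated_of_fderiv_le (bound := fun _ => C)
        (Metric.ball_mem_nhds x one_pos) (Eventually.of_forall fun y => (hkt y).aestronglyMeasurable)
        ((hkt x).intervalIntegrable 0 1) (hkt' x).aestronglyMeasurable ?_
        intervalIntegrable_const ?_)
      · refine Eventually.of_forall fun t ht y hy => hC (y, t) ⟨Metric.ball_subset_closedBall hy, ?_⟩
        rw [uIoc_of_le zero_le_one] at ht
        exact ⟨ht.1.le, ht.2⟩
      · exact Eventually.of_forall fun t _ y _ => hdiff y t
    rw [show ((n + 1 : ℕ) : WithTop ℕ∞) = (n : WithTop ℕ∞) + 1 by norm_cast,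
      contDiff_succ_iff_fderiv]
    refine ⟨fun x => (hder x).differentiableAt, by simp, ?_⟩
    rw [show fderiv ℝ (fun x => ∫ t in (0 : ℝ)..1, k x t) = fun x => ∫ t in (0 : ℝ)..1, k' x t from
      funext fun x => (hder x).fderiv]
    exact ih hk'c

/-- Projection of the plane to the first coordinate axis. -/
noncomputable def axisProj : Plane →L[ℝ] Plane :=
  (EuclideanSpace.proj (0 : Fin 2) : Plane →L[ℝ] ℝ).smulRight !₂[(1 : ℝ), 0]

theorem axisProj_add (x : Plane) : axisProj x + x 1 • !₂[(0 : ℝ), 1] = x := by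
  ext i; fin_cases i <;> simp [axisProj]

/-- The Hadamard lemma for smooth functions defined on the whole plane. -/
theorem exists_eq_mul_of_contDiff {h : Plane → ℝ} (hh : ContDiff ℝ ∞ h)
    (h0 : ∀ u, h !₂[u, 0] = 0) : ∃ k : Plane → ℝ, ContDiff ℝ ∞ k ∧ ∀ q, h q = q 1 * k q := by
  set e : Plane := !₂[(0 : ℝ), 1]
  set S : Plane → ℝ → Plane := fun q t => axisProj q + (t * q 1) • e with hS
  have hSc : ContDiff ℝ ∞ (fun z : Plane × ℝ => S z.1 z.2) := by
    have : ContDiff ℝ ∞ (fun z : Plane × ℝ => z.1 1) := by fun_prop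
    simp only [hS]
    fun_prop
  have hd : ContDiff ℝ ∞ (fderiv ℝ h) := hh.fderiv_right (by simp)
  -- The quotient is the mean of the `v`-derivative over the vertical segment from the axis to `q`.
  refine ⟨fun q => ∫ t in (0 : ℝ)..1, fderiv ℝ h (S q t) e, ?_, ?_⟩
  · rw [contDiff_infty]
    intro n
    apply contDiff_intervalIntegral_param
    exact ((hd.comp hSc).clm_apply contDiff_const).of_le (by exact_mod_cast le_top)
  · intro q
    have h1 : ∀ t, HasDerivAt (fun t => h (S q t)) (q 1 * fderiv ℝ h (S q t) e) t := by
      intro t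
      have h2 : HasDerivAt (S q) (q 1 • e) t := by
        have := (((hasDerivAt_id t).mul_const (q 1)).smul_const e).const_add (axisProj q)
        simpa [hS] using this
      have h3 := ((hh.differentiable (by simp)) (S q t)).hasFDerivAt.comp_hasDerivAt t h2
      rw [map_smul, smul_eq_mul] at h3
      exact h3
    have hcont : Continuous fun t => q 1 * fderiv ℝ h (S q t) e := by
      have : Continuous (S q) := hSc.continuous.comp (Continuous.prodMk_right q)
      exact continuous_const.mul ((hd.continuous.comp this).clm_apply continuous_const)
    have h4 := intervalIntegral.integral_eq_sub_of_hasDerivAt (fun t _ => h1 t)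
      (hcont.intervalIntegrable 0 1)
    rw [intervalIntegral.integral_const_mul] at h4
    rw [h4]
    have h5 : S q 1 = q := by simp only [hS, one_mul]; exact axisProj_add q
    have h6 : S q 0 = !₂[q 0, 0] := by
      ext i; fin_cases i <;> simp [hS, axisProj]
    rw [h5, h6, h0, sub_zero]

/-- Multiplying by a bump function reduces the germ to the global statement and keeps the vanishing
on the axis. -/
theorem exists_eq_mul_of_smooth {h : Plane → ℝ} (hh : ∀ᶠ q in 𝓝 (0 : Plane), ContDiffAt ℝ ∞ h q)
    (h0 : ∀ᶠ u in 𝓝 (0 : ℝ), h !₂[u, 0] = 0) :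
    ∃ k : Plane → ℝ, (∀ᶠ q in 𝓝 (0 : Plane), ContDiffAt ℝ ∞ k q) ∧
      ∀ᶠ q in 𝓝 (0 : Plane), h q = q 1 * k q := by
  have h0' : ∀ᶠ q in 𝓝 (0 : Plane), h !₂[q 0, 0] = 0 := by
    have : Tendsto (fun q : Plane => q 0) (𝓝 0) (𝓝 0) :=
      (by fun_prop : Continuous fun q : Plane => q 0).tendsto' 0 0 (by simp)
    exact this.eventually h0
  obtain ⟨ε, hε, hball⟩ := Metric.eventually_nhds_iff_ball.1 (hh.and h0')
  let χ : ContDiffBump (0 : Plane) := ⟨ε / 4, ε / 2, by positivity, by linarith⟩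
  have hsupp : ∀ q ∈ tsupport (fun q => χ q * h q), q ∈ Metric.ball (0 : Plane) ε := by
    intro q hq
    have : q ∈ tsupport χ := tsupport_mul_subset_left hq
    rw [χ.tsupport_eq] at this
    exact Metric.closedBall_subset_ball (by show ε / 2 < ε; linarith) this
  have hsm : ContDiff ℝ ∞ (fun q => χ q * h q) :=
    contDiff_iff_contDiffAt.2 fun q => by
      by_cases hq : q ∈ tsupport (fun q => χ q * h q)
      · exact χ.contDiffAt.mul (hball q (hsupp q hq)).1
      · exact contDiffAt_const.congr_of_eventuallyEq (notMem_tsupport_iff_eventuallyEq.1 hq)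
  obtain ⟨k, hk, hkeq⟩ := exists_eq_mul_of_contDiff hsm (by
    intro u
    by_cases hu : (!₂[u, 0] : Plane) ∈ tsupport (fun q => χ q * h q)
    · have := (hball _ (hsupp _ hu)).2
      simp only [Matrix.cons_val_zero] at this
      simp [this]
    · exact image_eq_zero_of_notMem_tsupport (f := fun q => χ q * h q) hu)
  refine ⟨k, Eventually.of_forall fun q => hk.contDiffAt, ?_⟩
  filter_upwards [χ.eventuallyEq_one] with q hq
  rw [← hkeq q, hq]; simp

/-- The power series of the quotient by the second coordinate of a power series vanishing on the
first coordinate axis. -/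
noncomputable def axisQuotientSeries (p : FormalMultilinearSeries ℝ Plane ℝ) :
    FormalMultilinearSeries ℝ Plane ℝ := fun n =>
  ∑ k : Fin (n + 1), ((p (n + 1)).curryMid k !₂[(0 : ℝ), 1]).compContinuousLinearMap
    (fun i => if k.succAbove i < k then ContinuousLinearMap.id ℝ Plane else axisProj)

theorem norm_axisProj_le : ‖axisProj‖ ≤ 1 := by
  refine ContinuousLinearMap.opNorm_le_bound _ zero_le_one fun x => ?_
  rw [one_mul, EuclideanSpace.norm_eq, EuclideanSpace.norm_eq]
  apply Real.sqrt_le_sqrt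
  simp [axisProj, Fin.sum_univ_two]
  positivity

theorem norm_axisQuotientSeries_le (p : FormalMultilinearSeries ℝ Plane ℝ) (n : ℕ) :
    ‖axisQuotientSeries p n‖ ≤ (n + 1) * ‖p (n + 1)‖ := by
  refine (norm_sum_le _ _).trans ?_
  have : ∀ k ∈ (Finset.univ : Finset (Fin (n + 1))),
      ‖((p (n + 1)).curryMid k !₂[(0 : ℝ), 1]).compContinuousLinearMap
        (fun i => if k.succAbove i < k then ContinuousLinearMap.id ℝ Plane else axisProj)‖
      ≤ ‖p (n + 1)‖ := by
    intro k _
    refine (ContinuousMultilinearMap.norm_compContinuousLinearMap_le _ _).trans ?_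
    have h1 : ‖(p (n + 1)).curryMid k !₂[(0 : ℝ), 1]‖ ≤ ‖p (n + 1)‖ := by
      refine (ContinuousLinearMap.le_opNorm _ _).trans ?_
      rw [ContinuousMultilinearMap.norm_curryMid]
      simp [EuclideanSpace.norm_eq]
    have h2 : ∏ i : Fin n, ‖(if k.succAbove i < k then ContinuousLinearMap.id ℝ Plane
        else axisProj)‖ ≤ 1 := by
      refine Finset.prod_le_one (fun _ _ => norm_nonneg _) fun i _ => ?_
      split_ifs
      · exact ContinuousLinearMap.norm_id_le
      · exact norm_axisProj_le
    calc _ ≤ ‖p (n + 1)‖ * 1 := mul_le_mul h1 h2 (by positivity) (norm_nonneg _)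
      _ = _ := mul_one _
  refine (Finset.sum_le_sum this).trans ?_
  simp

/-- Telescoping: the arguments `x` are replaced by `axisProj x` one at a time. Each replacement
leaves `x - axisProj x = x 1 • (0, 1)` in one slot, so the factor `x 1` comes out. -/
theorem axisQuotientSeries_apply (p : FormalMultilinearSeries ℝ Plane ℝ) (n : ℕ) (x : Plane) :
    x 1 * axisQuotientSeries p n (fun _ => x) =
      p (n + 1) (fun _ => x) - p (n + 1) (fun _ => axisProj x) := by
  have h := (p (n + 1)).toMultilinearMap.map_sub_map_piecewise (fun _ => x)
    (fun _ => axisProj x) Finset.univ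
  simp only [Finset.piecewise_univ, Finset.mem_univ] at h
  refine Eq.trans ?_ h.symm
  rw [axisQuotientSeries, sum_apply, Finset.mul_sum]
  refine Finset.sum_congr rfl fun k _ => ?_
  rw [ContinuousMultilinearMap.compContinuousLinearMap_apply,
    ContinuousMultilinearMap.curryMid_apply]
  have hx : x - axisProj x = x 1 • !₂[(0 : ℝ), 1] := by
    rw [sub_eq_iff_eq_add, add_comm, axisProj_add]
  have h1 : (fun j => if True → j < k then x else if k = j then x - axisProj x else axisProj x) =
      Function.update (fun j => if j < k then x else axisProj x) k (x 1 • !₂[(0 : ℝ), 1]) := by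
    funext j
    by_cases hj : j = k
    · subst hj; simp [hx]
    · simp [Function.update_of_ne hj, Ne.symm hj]
  have h2 : k.insertNth !₂[(0 : ℝ), 1] (fun i : Fin n => (if k.succAbove i < k then
      ContinuousLinearMap.id ℝ Plane else axisProj) x) =
      Function.update (fun j => if j < k then x else axisProj x) k !₂[(0 : ℝ), 1] := by
    rw [Fin.insertNth_eq_iff]
    refine ⟨by simp, ?_⟩
    funext i
    simp only [Fin.removeNth, Function.update_of_ne (Fin.succAbove_ne k i)]
    split_ifs <;> rfl
  rw [h2]
  refine Eq.trans ?_ (congrArg (p (n + 1)) h1).symm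
  rw [ContinuousMultilinearMap.map_update_smul, smul_eq_mul]

theorem axisQuotientSeries_radius_pos (p : FormalMultilinearSeries ℝ Plane ℝ)
    (hp : 0 < p.radius) : 0 < (axisQuotientSeries p).radius := by
  obtain ⟨C, r, hC, hr, hb⟩ := p.le_mul_pow_of_radius_pos hp
  have h2r : 0 < 2 * r := by positivity
  refine lt_of_lt_of_le ?_ (FormalMultilinearSeries.le_radius_of_bound _ (C * r)
    (r := ⟨(2 * r)⁻¹, by positivity⟩) fun n => ?_)
  · exact ENNReal.coe_pos.2 (inv_pos.2 h2r)
  -- The number `n + 1` of telescoping terms is absorbed by halving the radius.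
  · have hn : ((n : ℝ) + 1) ≤ 2 ^ n := by exact_mod_cast Nat.lt_two_pow_self
    calc ‖axisQuotientSeries p n‖ * (2 * r)⁻¹ ^ n
        ≤ (2 ^ n * (C * r ^ (n + 1))) * (2 * r)⁻¹ ^ n := by
          gcongr
          exact (norm_axisQuotientSeries_le p n).trans
            (mul_le_mul hn (hb _) (norm_nonneg _) (by positivity))
      _ = C * r := by
          rw [inv_pow, mul_pow, pow_succ]; field_simp

/-- The series at `axisProj x` sums to `0`, so subtracting it from the series at `x` changes
nothing. The constant terms then cancel, and each remaining term is divisible by `x 1`. -/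
theorem exists_eq_mul_of_analytic {h : Plane → ℝ} (hh : AnalyticAt ℝ h 0)
    (h0 : ∀ᶠ u in 𝓝 (0 : ℝ), h !₂[u, 0] = 0) :
    ∃ k : Plane → ℝ, AnalyticAt ℝ k 0 ∧ ∀ᶠ q in 𝓝 (0 : Plane), h q = q 1 * k q := by
  obtain ⟨p, R, hp⟩ := hh
  have hrad := axisQuotientSeries_radius_pos p (hp.r_pos.trans_le hp.r_le)
  have hk := (axisQuotientSeries p).hasFPowerSeriesOnBall hrad
  refine ⟨_, hk.analyticAt, ?_⟩
  have hax : Tendsto axisProj (𝓝 0) (𝓝 0) := axisProj.continuous.tendsto' 0 0 (by simp)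
  have h0' : ∀ᶠ q in 𝓝 (0 : Plane), h (axisProj q) = 0 := by
    have : Tendsto (fun q : Plane => q 0) (𝓝 0) (𝓝 0) :=
      (by fun_prop : Continuous fun q : Plane => q 0).tendsto' 0 0 (by simp)
    filter_upwards [this.eventually h0] with q hq
    rw [← hq]; congr 1
    ext i; fin_cases i <;> simp [axisProj]
  filter_upwards [h0', hp.eventually_hasSum, hax.eventually hp.eventually_hasSum,
    hk.eventually_hasSum] with x h1 h2 h3 h4
  simp only [zero_add] at h2 h3 h4
  rw [h1] at h3
  have h5 := h2.sub h3
  rw [sub_zero] at h5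
  have h6 := (hasSum_nat_add_iff' 1).2 h5
  have h7 : p 0 (fun _ => x) = p 0 (fun _ => axisProj x) := by
    congr 1; ext i; exact i.elim0
  simp only [Finset.range_one, Finset.sum_singleton, h7, sub_self, sub_zero] at h6
  refine h6.unique ?_
  simp_rw [← axisQuotientSeries_apply]
  exact h4.mul_left _

/-- **Hadamard's lemma** for germs of `C^r`-functions, where `r = ∞` or `r = ω`. -/
theorem exists_eq_mul {r : WithTop ℕ∞} (hr : r = ∞ ∨ r = ω) {h : Plane → ℝ}
    (hh : ∀ᶠ q in 𝓝 (0 : Plane), ContDiffAt ℝ r h q)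
    (h0 : ∀ᶠ u in 𝓝 (0 : ℝ), h !₂[u, 0] = 0) :
    ∃ k : Plane → ℝ, (∀ᶠ q in 𝓝 (0 : Plane), ContDiffAt ℝ r k q) ∧
      ∀ᶠ q in 𝓝 (0 : Plane), h q = q 1 * k q := by
  rcases hr with rfl | rfl
  · exact exists_eq_mul_of_smooth hh h0
  · obtain ⟨k, hk, hk'⟩ := exists_eq_mul_of_analytic hh.self_of_nhds.analyticAt h0
    exact ⟨k, hk.eventually_analyticAt.mono fun q hq => hq.contDiffAt, hk'⟩

/-! ### Cross products and dependence of differentials. -/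

theorem Space.inner_eq (a b : Space) : inner ℝ a b = a 0 * b 0 + a 1 * b 1 + a 2 * b 2 := by
  simp [PiLp.inner_apply, Fin.sum_univ_three]; ring

theorem Space.ext_iff' {a b : Space} : a = b ↔ a 0 = b 0 ∧ a 1 = b 1 ∧ a 2 = b 2 := by
  constructor
  · rintro rfl; exact ⟨rfl, rfl, rfl⟩
  · rintro ⟨h0, h1, h2⟩; ext i; fin_cases i <;> assumption

/-- The cross product. -/
noncomputable def cross (a b : Space) : Space :=
  !₂[a 1 * b 2 - a 2 * b 1, a 2 * b 0 - a 0 * b 2, a 0 * b 1 - a 1 * b 0]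

@[simp] theorem cross_zero' (a b : Space) : cross a b 0 = a 1 * b 2 - a 2 * b 1 := rfl
@[simp] theorem cross_one' (a b : Space) : cross a b 1 = a 2 * b 0 - a 0 * b 2 := rfl
@[simp] theorem cross_two' (a b : Space) : cross a b 2 = a 0 * b 1 - a 1 * b 0 := rfl

/-- Linear maps do not respect the cross product, but they do respect linear dependence; this form
makes nonvanishing transportable. -/
theorem cross_eq_zero_iff_exists (a b : Space) :
    cross a b = 0 ↔ ∃ s t : ℝ, (s ≠ 0 ∨ t ≠ 0) ∧ s • a + t • b = 0 := by
  simp only [Space.ext_iff', cross_zero', cross_one', cross_two', PiLp.zero_apply, PiLp.add_apply,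
    PiLp.smul_apply, smul_eq_mul]
  constructor
  · rintro ⟨h0, h1, h2⟩
    by_cases ha : a = 0
    · exact ⟨1, 0, Or.inl one_ne_zero, by simp [ha]⟩
    · have : a 0 ≠ 0 ∨ a 1 ≠ 0 ∨ a 2 ≠ 0 := by
        by_contra! hh
        exact ha (Space.ext_iff'.2 (by simpa using hh))
      rcases this with h | h | h
      · exact ⟨b 0, -a 0, Or.inr (by simpa), by linarith, by linarith, by linarith⟩
      · exact ⟨b 1, -a 1, Or.inr (by simpa), by linarith, by linarith, by linarith⟩
      · exact ⟨b 2, -a 2, Or.inr (by simpa), by linarith, by linarith, by linarith⟩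
  · rintro ⟨s, t, hst, h0, h1, h2⟩
    rcases hst with h | h
    · refine ⟨mul_left_cancel₀ h ?_, mul_left_cancel₀ h ?_, mul_left_cancel₀ h ?_⟩
      · linear_combination b 2 * h1 - b 1 * h2
      · linear_combination b 0 * h2 - b 2 * h0
      · linear_combination b 1 * h0 - b 0 * h1
    · refine ⟨mul_left_cancel₀ h ?_, mul_left_cancel₀ h ?_, mul_left_cancel₀ h ?_⟩
      · linear_combination a 1 * h2 - a 2 * h1
      · linear_combination a 2 * h0 - a 0 * h2
      · linear_combination a 0 * h1 - a 1 * h0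

theorem cross_map_ne_zero {L : Space →L[ℝ] Space} (hL : Function.Injective L) {a b : Space}
    (h : cross a b ≠ 0) : cross (L a) (L b) ≠ 0 := by
  rw [Ne, cross_eq_zero_iff_exists] at h ⊢
  rintro ⟨s, t, hst, h0⟩
  refine h ⟨s, t, hst, hL ?_⟩
  rw [map_zero, ← h0]; simp

/-- A vector orthogonal to `a` and `b` is parallel to `a × b`. -/
theorem cross_cross_eq_zero {n a b : Space} (ha : inner ℝ n a = 0) (hb : inner ℝ n b = 0) :
    cross n (cross a b) = 0 := by
  rw [Space.inner_eq] at ha hb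
  simp only [Space.ext_iff', cross_zero', cross_one', cross_two', PiLp.zero_apply]
  refine ⟨?_, ?_, ?_⟩
  · linear_combination a 0 * hb - b 0 * ha
  · linear_combination a 1 * hb - b 1 * ha
  · linear_combination a 2 * hb - b 2 * ha

theorem inner_cross_left (a b : Space) : inner ℝ (cross a b) a = 0 := by
  simp only [Space.inner_eq, cross_zero', cross_one', cross_two']; ring

theorem inner_cross_right (a b : Space) : inner ℝ (cross a b) b = 0 := by
  simp only [Space.inner_eq, cross_zero', cross_one', cross_two']; ring

/-- Two linear forms vanishing on a common plane are dependent. -/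
theorem mul_eq_mul_of_vanish {L : Plane →L[ℝ] Space} (hL : Function.Injective L)
    {A B : Space →L[ℝ] ℝ} (hA : ∀ w, A (L w) = 0) (hB : ∀ w, B (L w) = 0) (x y : Space) :
    A x * B y = A y * B x := by
  set C : Space →ₗ[ℝ] ℝ × ℝ := (A : Space →ₗ[ℝ] ℝ).prod (B : Space →ₗ[ℝ] ℝ)
  have hker : LinearMap.range (L : Plane →ₗ[ℝ] Space) ≤ LinearMap.ker C := by
    rintro _ ⟨w, rfl⟩
    simp [C, hA, hB]
  have h1 : Module.finrank ℝ (LinearMap.range (L : Plane →ₗ[ℝ] Space)) = 2 := by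
    rw [LinearMap.finrank_range_of_inj hL]; simp
  have h2 := Submodule.finrank_mono hker
  have h3 := C.finrank_range_add_finrank_ker
  simp only [finrank_euclideanSpace, Fintype.card_fin] at h3
  have h4 : Module.finrank ℝ (LinearMap.range C) ≤ 1 := by omega
  obtain ⟨⟨v, hv⟩, hvs⟩ := finrank_le_one_iff.1 h4
  obtain ⟨c, hc⟩ := hvs ⟨C x, x, rfl⟩
  obtain ⟨d, hd⟩ := hvs ⟨C y, y, rfl⟩
  simp only [Subtype.ext_iff, Prod.ext_iff, C] at hc hd
  simp at hc hd
  rw [← hc.1, ← hc.2, ← hd.1, ← hd.2]; ring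

/-- Identities proved only at generic points pass to the singular and double points through this
closedness principle. -/
theorem eq_zero_of_frequently {X : Type*} [TopologicalSpace X] {F : X → ℝ} {x : X}
    (hF : ContinuousAt F x) (h : ∃ᶠ y in 𝓝 x, F y = 0) : F x = 0 := by
  by_contra hne
  exact h ((hF.eventually_ne hne).mono fun y hy => hy)

/-- If two functions vanish on the image of an immersion then their differentials are
dependent. -/
theorem fderiv_mul_eq_mul {O : Set Plane} (hO : IsOpen O) {h : Plane → Space} {q : Plane}
    (hq : q ∈ O) (hd : DifferentiableAt ℝ h q) (hi : Function.Injective (fderiv ℝ h q))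
    {A B : Space → ℝ} {A' B' : Space →L[ℝ] ℝ} (hA : HasFDerivAt A A' (h q))
    (hB : HasFDerivAt B B' (h q)) (hA0 : ∀ q ∈ O, A (h q) = 0) (hB0 : ∀ q ∈ O, B (h q) = 0)
    (x y : Space) : A' x * B' y = A' y * B' x := by
  have key : ∀ {A : Space → ℝ} {A' : Space →L[ℝ] ℝ}, HasFDerivAt A A' (h q) →
      (∀ q ∈ O, A (h q) = 0) → ∀ w, A' (fderiv ℝ h q w) = 0 := by
    intro A A' hA hA0 w
    have h1 := hA.comp q hd.hasFDerivAt
    have h2 : HasFDerivAt (A ∘ h) (0 : Plane →L[ℝ] ℝ) q :=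
      (hasFDerivAt_const (0 : ℝ) q).congr_of_eventuallyEq
        ((hO.eventually_mem hq).mono fun y hy => hA0 y hy)
    exact DFunLike.congr_fun (h1.unique h2) w
  exact mul_eq_mul_of_vanish hi (key hA hA0) (key hB hB0) x y

/-! ### Frontal models and the generic correspondence of tangent planes. -/

/-- A map `g` of the plane whose image lies in the zero set of `G`, with tangent plane
spanned by `GU` and `E` also at the singular points, which are the zeros of `lam`. -/
structure FrontalModel (g GU E : Plane → Space) (lam : Plane → ℝ) (G : Space → ℝ)
    (mu : Plane → ℝ) : Prop where
  contDiff : ContDiff ℝ ω g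
  contDiff_GU : ContDiff ℝ ω GU
  contDiff_E : ContDiff ℝ ω E
  continuous_lam : Continuous lam
  differentiable_G : Differentiable ℝ G
  map_zero : g 0 = 0
  lam_zero : lam 0 = 0
  fderiv_apply : ∀ q w, fderiv ℝ g q w = w 0 • GU q + (w 1 * lam q) • E q
  cross_ne_zero : ∀ q, cross (GU q) (E q) ≠ 0
  implicit : ∀ q, G (g q) = 0
  fderiv_implicit : ∀ q w, fderiv ℝ G (g q) w = mu q * inner ℝ (cross (GU q) (E q)) w
  frequently_lam_ne : ∀ q, ∃ᶠ q' in 𝓝 q, lam q' ≠ 0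
  -- A surface is too large to lie in the curves where the gradient of `G` vanishes. All preimages
  -- of the point are covered, because the lift to be used is not known in advance.
  exists_mu_ne_zero : ∀ (h : Plane → Space) (O : Set Plane), IsOpen O → O.Nonempty →
    (∀ q ∈ O, DifferentiableAt ℝ h q ∧ Function.Injective (fderiv ℝ h q)) →
    (∀ q ∈ O, h q ∈ range g) → ∃ q ∈ O, ∀ q', g q' = h q → mu q' ≠ 0
  -- Off the double curve a point is determined by its image. This turns `g (ψ (ψ q)) = g q` into `ψ
  -- (ψ q) = q`.
  frequently_injective : ∀ q, ∃ᶠ q₁ in 𝓝 q, ∀ q', g q' = g q₁ → q' = q₁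

/-- A germ of `C^r`-diffeomorphism of the space mapping the image germ of `g` into itself. -/
structure LocalSymmetry (r : WithTop ℕ∞) (g : Plane → Space) (τ : Space → Space) : Prop where
  contDiffAt : ∀ᶠ y in 𝓝 (0 : Space), ContDiffAt ℝ r τ y
  map_zero : τ 0 = 0
  injective : ∀ᶠ y in 𝓝 (0 : Space), Function.Injective (fderiv ℝ τ y)
  -- Since `N` is arbitrary, preimages can be chosen close to the origin, which later forces `ψ 0 =
  -- 0`.
  lift : ∀ N ∈ 𝓝 (0 : Plane), ∀ᶠ q in 𝓝 (0 : Plane), τ (g q) ∈ g '' N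

theorem ne_zero_of_eq_infty_or_omega {r : WithTop ℕ∞} (hr : r = ∞ ∨ r = ω) : r ≠ 0 := by
  rcases hr with rfl | rfl <;> simp

theorem add_one_le_of_eq_infty_or_omega {r : WithTop ℕ∞} (hr : r = ∞ ∨ r = ω) : r + 1 ≤ r := by
  rcases hr with rfl | rfl <;> simp

namespace FrontalModel

variable {g GU E : Plane → Space} {lam : Plane → ℝ} {G : Space → ℝ} {mu : Plane → ℝ}
  {r : WithTop ℕ∞} {τ : Space → Space}

theorem tendsto_zero (hg : FrontalModel g GU E lam G mu) : Tendsto g (𝓝 0) (𝓝 0) :=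
  hg.contDiff.continuous.tendsto' 0 0 hg.map_zero

theorem differentiable (hg : FrontalModel g GU E lam G mu) : Differentiable ℝ g :=
  hg.contDiff.differentiable (by simp)

theorem injective_fderiv (hg : FrontalModel g GU E lam G mu) {q : Plane} (hq : lam q ≠ 0) :
    Function.Injective (fderiv ℝ g q) := by
  rw [injective_iff_map_eq_zero]
  intro w hw
  rw [hg.fderiv_apply] at hw
  by_contra hne
  refine hg.cross_ne_zero q ((cross_eq_zero_iff_exists _ _).2 ⟨w 0, w 1 * lam q, ?_, hw⟩)
  by_contra! hh
  apply hne
  ext i; fin_cases i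
  · exact hh.1
  · exact (mul_eq_zero.1 hh.2).resolve_right hq

/-- Densely many points have a lift at which the tangent planes correspond. -/
theorem frequently_exists_lift (hr : r = ∞ ∨ r = ω) (hg : FrontalModel g GU E lam G mu)
    (hτ : LocalSymmetry r g τ) {N : Set Plane} (hN : N ∈ 𝓝 0) :
    ∀ᶠ q in 𝓝 (0 : Plane), ∃ᶠ q₁ in 𝓝 q, ∃ q' ∈ N, g q' = τ (g q₁) ∧
      inner ℝ (cross (GU q') (E q')) (fderiv ℝ τ (g q₁) (GU q₁)) = 0 ∧
      inner ℝ (cross (GU q') (E q')) (fderiv ℝ τ (g q₁) (E q₁)) = 0 := by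
  have hev := ((hg.tendsto_zero.eventually hτ.contDiffAt).and
    (hg.tendsto_zero.eventually hτ.injective)).and (hτ.lift N hN)
  obtain ⟨V, hV, hVo, h0V⟩ := eventually_nhds_iff.1 hev
  filter_upwards [hVo.mem_nhds h0V] with q hqV
  rw [frequently_nhds_iff]
  intro O hqO hO
  obtain ⟨q₀, ⟨hq₀, hq₀'⟩⟩ := (frequently_nhds_iff.1 (hg.frequently_lam_ne q)) (U := O ∩ V)
    ⟨hqO, hqV⟩ (hO.inter hVo)
  -- On the regular points `τ ∘ g` is an immersion, so `exists_mu_ne_zero` applies to it.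
  set O' := O ∩ V ∩ {q | lam q ≠ 0} with hO'def
  have hO' : IsOpen O' := (hO.inter hVo).inter (isOpen_ne_fun hg.continuous_lam continuous_const)
  have hfd : ∀ q ∈ O', HasFDerivAt (fun q => τ (g q))
      ((fderiv ℝ τ (g q)).comp (fderiv ℝ g q)) q := fun q hq =>
    ((hV q hq.1.2).1.1.differentiableAt (ne_zero_of_eq_infty_or_omega hr)).hasFDerivAt.comp q
      (hg.differentiable q).hasFDerivAt
  obtain ⟨q₁, hq₁, hmu⟩ := hg.exists_mu_ne_zero (fun q => τ (g q)) O' hO' ⟨q₀, hq₀, hq₀'⟩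
    (fun q hq => ⟨(hfd q hq).differentiableAt, by
      rw [(hfd q hq).fderiv]
      exact (hV q hq.1.2).1.2.comp (hg.injective_fderiv hq.2)⟩)
    (fun q hq => image_subset_range _ _ (hV q hq.1.2).2)
  obtain ⟨q', hq'N, hq'⟩ := (hV q₁ hq₁.1.2).2
  refine ⟨q₁, hq₁.1.1, q', hq'N, hq', ?_⟩
  -- Differentiate `G ∘ τ ∘ g = 0`. The gradient of `G` at `g q'` is `mu q'` times the normal, and
  -- `mu q'` cancels. For the direction `E` the factor `lam q₁` is cancelled afterwards.
  have hG : ∀ w, inner ℝ (cross (GU q') (E q')) (fderiv ℝ τ (g q₁) (fderiv ℝ g q₁ w)) = 0 := by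
    intro w
    have h1 := (hg.differentiable_G (τ (g q₁))).hasFDerivAt.comp q₁ (hfd q₁ hq₁)
    have h2 : HasFDerivAt (G ∘ fun q => τ (g q)) (0 : Plane →L[ℝ] ℝ) q₁ := by
      refine (hasFDerivAt_const (0 : ℝ) q₁).congr_of_eventuallyEq ?_
      filter_upwards [hO'.mem_nhds hq₁] with y hy
      obtain ⟨z, -, hz⟩ := (hV y hy.1.2).2
      show G (τ (g y)) = 0
      rw [← hz, hg.implicit]
    have h3 := DFunLike.congr_fun (h1.unique h2) w
    simp only [ContinuousLinearMap.comp_apply, zero_apply] at h3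
    rw [← hq', hg.fderiv_implicit] at h3
    exact (mul_eq_zero.1 h3).resolve_left (hmu q' hq')
  constructor
  · have := hG !₂[1, 0]
    rw [hg.fderiv_apply] at this
    simpa using this
  · have := hG !₂[0, 1]
    rw [hg.fderiv_apply] at this
    simp only [Matrix.cons_val_zero, Matrix.cons_val_one, zero_smul, zero_add, one_mul,
      map_smul, inner_smul_right] at this
    exact (mul_eq_zero.1 this).resolve_left hq₁.2

theorem contDiffAt_fderiv_apply (hr : r = ∞ ∨ r = ω) (hg : FrontalModel g GU E lam G mu)
    (hτ : LocalSymmetry r g τ) {X : Plane → Space} (hX : ContDiff ℝ ω X) :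
    ∀ᶠ q in 𝓝 (0 : Plane), ContDiffAt ℝ r (fun q => fderiv ℝ τ (g q) (X q)) q := by
  filter_upwards [hg.tendsto_zero.eventually hτ.contDiffAt] with q hq
  have h1 : ContDiffAt ℝ r (fderiv ℝ τ) (g q) :=
    hq.fderiv_right (add_one_le_of_eq_infty_or_omega hr)
  exact (h1.comp q (hg.contDiff.contDiffAt.of_le le_top)).clm_apply
    (hX.contDiffAt.of_le le_top)

theorem contDiffAt_comp (hg : FrontalModel g GU E lam G mu)
    (hτ : LocalSymmetry r g τ) :
    ∀ᶠ q in 𝓝 (0 : Plane), ContDiffAt ℝ r (fun q => τ (g q)) q := by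
  filter_upwards [hg.tendsto_zero.eventually hτ.contDiffAt] with q hq
  exact hq.comp q (hg.contDiff.contDiffAt.of_le le_top)

theorem continuous_cross (hg : FrontalModel g GU E lam G mu) :
    Continuous fun q => cross (GU q) (E q) := by
  have h1 := hg.contDiff_GU.continuous
  have h2 := hg.contDiff_E.continuous
  unfold cross
  fun_prop

/-- The limiting tangent plane is preserved. -/
theorem inner_cross_fderiv_eq_zero (hr : r = ∞ ∨ r = ω) (hg : FrontalModel g GU E lam G mu)
    (hτ : LocalSymmetry r g τ) :
    inner ℝ (cross (GU 0) (E 0)) (fderiv ℝ τ 0 (GU 0)) = 0 ∧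
    inner ℝ (cross (GU 0) (E 0)) (fderiv ℝ τ 0 (E 0)) = 0 := by
  have key : ∀ X : Plane → Space, ContDiff ℝ ω X →
      (∀ N ∈ 𝓝 (0 : Plane), ∃ᶠ q₁ in 𝓝 (0 : Plane), ∃ q' ∈ N,
        inner ℝ (cross (GU q') (E q')) (fderiv ℝ τ (g q₁) (X q₁)) = 0) →
      inner ℝ (cross (GU 0) (E 0)) (fderiv ℝ τ 0 (X 0)) = 0 := by
    intro X hX h
    -- The lift `q'` need not depend continuously on `q₁`. Joint continuity suffices, because both
    -- tend to the origin as `N` shrinks.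
    have hc : ContinuousAt (fun z : Plane × Plane =>
        (inner ℝ (cross (GU z.1) (E z.1)) (fderiv ℝ τ (g z.2) (X z.2)) : ℝ)) (0, 0) := by
      have h1 : ContinuousAt (fun z : Plane × Plane => cross (GU z.1) (E z.1)) (0, 0) :=
        (hg.continuous_cross.comp continuous_fst).continuousAt
      have h2 : ContinuousAt (fun z : Plane × Plane => fderiv ℝ τ (g z.2) (X z.2)) (0, 0) :=
        ContinuousAt.comp (f := Prod.snd) (g := fun q => fderiv ℝ τ (g q) (X q))
          (contDiffAt_fderiv_apply hr hg hτ hX).self_of_nhds.continuousAt continuous_snd.continuousAt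
      exact h1.inner h2
    have h3 := eq_zero_of_frequently hc ?_
    · simpa [hg.map_zero] using h3
    · rw [frequently_iff]
      intro U hU
      rw [nhds_prod_eq, mem_prod_iff] at hU
      obtain ⟨A, hA, B, hB, hAB⟩ := hU
      obtain ⟨q₁, ⟨q', hq', h0⟩, hq₁⟩ := ((h A hA).and_eventually hB).exists
      exact ⟨(q', q₁), hAB ⟨hq', hq₁⟩, h0⟩
  constructor
  · exact key GU hg.contDiff_GU fun N hN =>
      (hg.frequently_exists_lift hr hτ hN).self_of_nhds.mono
        fun q₁ ⟨q', h1, _, h3, _⟩ => ⟨q', h1, h3⟩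
  · exact key E hg.contDiff_E fun N hN =>
      (hg.frequently_exists_lift hr hτ hN).self_of_nhds.mono
        fun q₁ ⟨q', h1, _, _, h3⟩ => ⟨q', h1, h3⟩

/-- The lift of an involution is an involution. -/
theorem eventually_involutive (hg : FrontalModel g GU E lam G mu) {ψ : Plane → Plane}
    (hψ : ∀ᶠ q in 𝓝 (0 : Plane), ContinuousAt ψ q) (hψ0 : ψ 0 = 0)
    (hlift : ∀ᶠ q in 𝓝 (0 : Plane), g (ψ q) = τ (g q))
    (hinv : ∀ᶠ y in 𝓝 (0 : Space), τ (τ y) = y) :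
    ∀ᶠ q in 𝓝 (0 : Plane), ψ (ψ q) = q := by
  have ht : Tendsto ψ (𝓝 0) (𝓝 0) := by
    have := hψ.self_of_nhds.tendsto; rwa [hψ0] at this
  have h1 : ∀ᶠ q in 𝓝 (0 : Plane), g (ψ (ψ q)) = g q := by
    filter_upwards [hlift, ht.eventually hlift, hg.tendsto_zero.eventually hinv] with q h1 h2 h3
    rw [h2, h1, h3]
  filter_upwards [h1.eventually_nhds, hψ, ht.eventually hψ] with q hq hc hc'
  have hcc : ContinuousAt (fun q => ‖ψ (ψ q) - q‖) q :=
    ((ContinuousAt.comp (f := ψ) hc' hc).sub continuousAt_id).norm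
  have := eq_zero_of_frequently hcc
    (((hg.frequently_injective q).and_eventually hq).mono fun q₁ h => by
      rw [h.1 _ h.2, sub_self, norm_zero])
  rwa [norm_eq_zero, sub_eq_zero] at this

end FrontalModel

/-! ### The three normal forms as frontal models. -/

theorem hasFDerivAt_coord {n : ℕ} (i : Fin n) (q : EuclideanSpace ℝ (Fin n)) :
    HasFDerivAt (fun q : EuclideanSpace ℝ (Fin n) => q i)
      (EuclideanSpace.proj i : EuclideanSpace ℝ (Fin n) →L[ℝ] ℝ) q :=
  (EuclideanSpace.proj i : EuclideanSpace ℝ (Fin n) →L[ℝ] ℝ).hasFDerivAt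

theorem hasFDerivAt_space_iff {f : Plane → Space} {f' : Plane →L[ℝ] Space} {q : Plane} :
    HasFDerivAt f f' q ↔
      ∀ i, HasFDerivAt (fun x => f x i) ((EuclideanSpace.proj i : Space →L[ℝ] ℝ).comp f') q := by
  simp only [← hasFDerivWithinAt_univ]
  exact hasFDerivWithinAt_euclidean

/-- The candidate differential of a frontal map. -/
noncomputable def frontalDeriv (a : Space) (l : ℝ) (b : Space) : Plane →L[ℝ] Space :=
  (EuclideanSpace.proj (0 : Fin 2) : Plane →L[ℝ] ℝ).smulRight a +
    (l • (EuclideanSpace.proj (1 : Fin 2) : Plane →L[ℝ] ℝ)).smulRight b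

theorem frontalDeriv_apply (a : Space) (l : ℝ) (b : Space) (w : Plane) :
    frontalDeriv a l b w = w 0 • a + (w 1 * l) • b := by
  simp [frontalDeriv, mul_comm]

/-- Density in the plane of the complement of a curve `u = c v²`. -/
theorem frequently_parabola_ne (c : ℝ) (q : Plane) : ∃ᶠ q' in 𝓝 q, q' 0 + c * q' 1 ^ 2 ≠ 0 := by
  intro h
  simp only [not_not] at h
  have h1 : Tendsto (fun t : ℝ => q + t • !₂[(1 : ℝ), 0]) (𝓝 0) (𝓝 q) :=
    (by fun_prop : Continuous fun t : ℝ => q + t • !₂[(1 : ℝ), 0]).tendsto' 0 q (by simp)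
  have h2 := h1.eventually h
  have h3 : ∃ᶠ t : ℝ in 𝓝 0, t ≠ 0 := by
    rw [frequently_iff_neBot]; exact (inferInstance : (𝓝[≠] (0 : ℝ)).NeBot)
  obtain ⟨t, ht, h4⟩ := (h3.and_eventually h2).exists
  have h5 := h.self_of_nhds
  simp at h4
  apply ht
  linarith

theorem frequently_snd_ne (q : Plane) : ∃ᶠ q' in 𝓝 q, q' 1 ≠ 0 := by
  intro h
  simp only [not_not] at h
  have h1 : Tendsto (fun t : ℝ => q + t • !₂[(0 : ℝ), 1]) (𝓝 0) (𝓝 q) :=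
    (by fun_prop : Continuous fun t : ℝ => q + t • !₂[(0 : ℝ), 1]).tendsto' 0 q (by simp)
  have h2 := h1.eventually h
  have h3 : ∃ᶠ t : ℝ in 𝓝 0, t ≠ 0 := by
    rw [frequently_iff_neBot]; exact (inferInstance : (𝓝[≠] (0 : ℝ)).NeBot)
  obtain ⟨t, ht, h4⟩ := (h3.and_eventually h2).exists
  have h5 := h.self_of_nhds
  simp at h4
  apply ht
  linarith

/-- An immersion does not map into the intersection of two surfaces with independent normals. -/
theorem not_forall_two_eqs {h : Plane → Space} {O : Set Plane} (hO : IsOpen O) {q : Plane}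
    (hq : q ∈ O) (hh : ∀ q ∈ O, DifferentiableAt ℝ h q ∧ Function.Injective (fderiv ℝ h q))
    {A B : Space → ℝ} {A' B' : Space →L[ℝ] ℝ} (hA : HasFDerivAt A A' (h q))
    (hB : HasFDerivAt B B' (h q)) (hA0 : ∀ q ∈ O, A (h q) = 0) (hB0 : ∀ q ∈ O, B (h q) = 0)
    (x y : Space) (hxy : A' x * B' y ≠ A' y * B' x) : False :=
  hxy (fderiv_mul_eq_mul hO hq (hh q hq).1 (hh q hq).2 hA hB hA0 hB0 x y)

/-- Two coordinate functions have independent differentials, so an immersed surface does not fit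
into a coordinate axis. -/
theorem not_forall_coords_eq_zero {h : Plane → Space} {O : Set Plane} (hO : IsOpen O)
    (hne : O.Nonempty)
    (hh : ∀ q ∈ O, DifferentiableAt ℝ h q ∧ Function.Injective (fderiv ℝ h q)) {i j : Fin 3}
    (hij : i ≠ j) : ¬ ∀ q ∈ O, h q i = 0 ∧ h q j = 0 := by
  intro h0
  obtain ⟨q, hq⟩ := hne
  refine not_forall_two_eqs hO hq hh (hasFDerivAt_coord i _) (hasFDerivAt_coord j _)
    (fun q hq => (h0 q hq).1) (fun q hq => (h0 q hq).2) (EuclideanSpace.single i 1)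
    (EuclideanSpace.single j 1) ?_
  simp [hij, hij.symm]

theorem continuousOn_of_immersion {h : Plane → Space} {O : Set Plane}
    (hh : ∀ q ∈ O, DifferentiableAt ℝ h q ∧ Function.Injective (fderiv ℝ h q)) :
    ContinuousOn h O := fun q hq => (hh q hq).1.continuousAt.continuousWithinAt

/-- The coefficient is written `-0` to match the common form `u = -c v²` of the double curves, here
with `c = 0`. -/
theorem stdCuspidalCrossCap_double {q q' : Plane} (hne : q' ≠ q)
    (h : stdCuspidalCrossCap q' = stdCuspidalCrossCap q) : q 0 = -0 * q 1 ^ 2 := by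
  have h1 := (Space.ext_iff'.1 h)
  simp only [stdCuspidalCrossCap] at h1
  simp at h1
  by_contra hq
  simp at hq
  apply hne
  ext i; fin_cases i
  · exact h1.2.2
  · have h2 := h1.2.1
    rw [h1.2.2] at h2
    exact (Odd.strictMono_pow (by decide : Odd 3)).injective (mul_left_cancel₀ hq h2)

theorem stdSwallowtail_double {q q' : Plane} (hne : q' ≠ q)
    (h : stdSwallowtail q' = stdSwallowtail q) : q 0 = -2 * q 1 ^ 2 := by
  have h1 := Space.ext_iff'.1 h
  simp only [stdSwallowtail] at h1
  simp at h1
  obtain ⟨h2, h3, h4⟩ := h1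
  rw [h4] at h2 h3
  have h5 : q' 1 ≠ q 1 := fun h5 => hne (by ext i; fin_cases i <;> assumption)
  have hd : q' 1 - q 1 ≠ 0 := sub_ne_zero.2 h5
  have h6 : 2 * (q' 1 ^ 2 + q' 1 * q 1 + q 1 ^ 2) + q 0 = 0 := by
    apply mul_left_cancel₀ hd
    linear_combination h3 / 2
  -- Substituting `h6` into the difference of the first coordinates leaves `(v' - v)³ (v' + v) = 0`.
  have h7 : q' 1 + q 1 = 0 := by
    apply mul_left_cancel₀ (pow_ne_zero 3 hd)
    linear_combination h2 - (q' 1 - q 1) * (q' 1 + q 1) * h6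
  rw [eq_neg_of_add_eq_zero_left h7] at h6
  linear_combination h6

/-- The normal is `(-3v, 2, 0)`. The gradient of `G` along the surface vanishes only on the singular
curve `v = 0`, whose image is the third axis. -/
theorem frontalModel_cuspidalEdge : FrontalModel stdCuspidalEdge (fun _ => !₂[0, 0, 1])
    (fun q => !₂[2, 3 * q 1, 0]) (fun q => q 1) (fun y => y 1 ^ 2 - y 0 ^ 3)
    (fun q => q 1 ^ 3) where
  contDiff := by
    unfold stdCuspidalEdge
    rw [contDiff_euclidean]
    intro i; fin_cases i <;> simp <;> fun_prop
  contDiff_GU := contDiff_const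
  contDiff_E := by
    rw [contDiff_euclidean]
    intro i; fin_cases i <;> simp <;> fun_prop
  continuous_lam := by fun_prop
  differentiable_G := by fun_prop
  map_zero := by ext i; fin_cases i <;> simp [stdCuspidalEdge]
  lam_zero := by simp
  fderiv_apply q w := by
    have : HasFDerivAt stdCuspidalEdge (frontalDeriv !₂[0, 0, 1] (q 1) !₂[2, 3 * q 1, 0]) q := by
      rw [hasFDerivAt_space_iff]
      intro i
      have h0 := hasFDerivAt_coord 0 q
      have h1 := hasFDerivAt_coord 1 q
      fin_cases i
      · refine (h1.pow 2).congr_fderiv ?_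
        ext w; simp [frontalDeriv_apply]; ring
      · refine (h1.pow 3).congr_fderiv ?_
        ext w; simp [frontalDeriv_apply]; ring
      · refine h0.congr_fderiv ?_
        ext w; simp [frontalDeriv_apply]
    rw [this.fderiv, frontalDeriv_apply]
  cross_ne_zero q h := by
    have := (Space.ext_iff'.1 h).2.1
    simp at this
  implicit q := by simp [stdCuspidalEdge]; ring
  fderiv_implicit q w := by
    have h0 := hasFDerivAt_coord 0 (stdCuspidalEdge q)
    have h1 := hasFDerivAt_coord 1 (stdCuspidalEdge q)
    refine (DFunLike.congr_fun ((h1.pow 2).sub (h0.pow 3)).fderiv w).trans ?_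
    rw [Space.inner_eq]
    simp [stdCuspidalEdge]; ring
  frequently_lam_ne := frequently_snd_ne
  exists_mu_ne_zero h O hO hne hh hr := by
    by_contra! hcon
    refine not_forall_coords_eq_zero hO hne hh (show (0 : Fin 3) ≠ 1 by decide) fun q hq => ?_
    obtain ⟨q', h1, h2⟩ := hcon q hq
    have h3 : q' 1 = 0 := pow_eq_zero_iff (by norm_num) |>.1 h2
    rw [← h1]
    simp [stdCuspidalEdge, h3]
  frequently_injective q := Frequently.mono (Eventually.frequently (Eventually.of_forall
      fun _ => trivial)) fun q _ q' h => by
    have h1 := (Space.ext_iff'.1 h)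
    simp only [stdCuspidalEdge] at h1
    simp at h1
    ext i; fin_cases i
    · exact h1.2.2
    · exact (Odd.strictMono_pow (by decide : Odd 3)).injective h1.2.1

/-- The normal is `(-3uv, 2, -2v³)`. The gradient degenerates on the singular line `v = 0` and on
the double line `u = 0`, which map into the third and the first axis. -/
theorem frontalModel_cuspidalCrossCap : FrontalModel stdCuspidalCrossCap
    (fun q => !₂[0, q 1 ^ 3, 1])
    (fun q => !₂[2, 3 * q 0 * q 1, 0]) (fun q => q 1) (fun y => y 1 ^ 2 - y 2 ^ 2 * y 0 ^ 3)
    (fun q => q 0 * q 1 ^ 3) where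
  contDiff := by
    unfold stdCuspidalCrossCap
    rw [contDiff_euclidean]
    intro i; fin_cases i <;> simp <;> fun_prop
  contDiff_GU := by
    rw [contDiff_euclidean]
    intro i; fin_cases i <;> simp <;> fun_prop
  contDiff_E := by
    rw [contDiff_euclidean]
    intro i; fin_cases i <;> simp <;> fun_prop
  continuous_lam := by fun_prop
  differentiable_G := by fun_prop
  map_zero := by ext i; fin_cases i <;> simp [stdCuspidalCrossCap]
  lam_zero := by simp
  fderiv_apply q w := by
    have : HasFDerivAt stdCuspidalCrossCap
        (frontalDeriv !₂[0, q 1 ^ 3, 1] (q 1) !₂[2, 3 * q 0 * q 1, 0]) q := by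
      rw [hasFDerivAt_space_iff]
      intro i
      have h0 := hasFDerivAt_coord 0 q
      have h1 := hasFDerivAt_coord 1 q
      fin_cases i
      · refine (h1.pow 2).congr_fderiv ?_
        ext w; simp [frontalDeriv_apply]; ring
      · refine (h0.mul (h1.pow 3)).congr_fderiv ?_
        ext w; simp [frontalDeriv_apply]; ring
      · refine h0.congr_fderiv ?_
        ext w; simp [frontalDeriv_apply]
    rw [this.fderiv, frontalDeriv_apply]
  cross_ne_zero q h := by
    have := (Space.ext_iff'.1 h).2.1
    simp at this
  implicit q := by simp [stdCuspidalCrossCap]; ring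
  fderiv_implicit q w := by
    have h0 := hasFDerivAt_coord 0 (stdCuspidalCrossCap q)
    have h1 := hasFDerivAt_coord 1 (stdCuspidalCrossCap q)
    have h2 := hasFDerivAt_coord 2 (stdCuspidalCrossCap q)
    refine (DFunLike.congr_fun ((h1.pow 2).sub ((h2.pow 2).mul (h0.pow 3))).fderiv w).trans ?_
    rw [Space.inner_eq]
    simp [stdCuspidalCrossCap]; ring
  frequently_lam_ne := frequently_snd_ne
  exists_mu_ne_zero h O hO hne hh hr := by
    by_contra! hcon
    have hb : ∀ q ∈ O, h q 1 = 0 ∧ (h q 0 = 0 ∨ h q 2 = 0) := by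
      intro q hq
      obtain ⟨q', h1, h2⟩ := hcon q hq
      rw [← h1]
      rcases mul_eq_zero.1 h2 with h3 | h3
      · simp [stdCuspidalCrossCap, h3]
      · have h3 : q' 1 = 0 := pow_eq_zero_iff (by norm_num) |>.1 h3
        simp [stdCuspidalCrossCap, h3]
    have hc : ContinuousOn (fun q => h q 0) O :=
      (EuclideanSpace.proj (0 : Fin 3) : Space →L[ℝ] ℝ).continuous.comp_continuousOn
        (continuousOn_of_immersion hh)
    -- Pointwise the image lies in a union of two lines. By continuity, a nonempty open set maps
    -- into a single one of them.
    set O₁ := O ∩ (fun q => h q 0) ⁻¹' {0}ᶜ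
    have hO₁ : IsOpen O₁ := hc.isOpen_inter_preimage hO isOpen_compl_singleton
    rcases O₁.eq_empty_or_nonempty with he | hne₁
    · refine not_forall_coords_eq_zero hO hne hh (show (0 : Fin 3) ≠ 1 by decide) fun q hq =>
        ⟨?_, (hb q hq).1⟩
      by_contra h0
      exact (he ▸ (⟨hq, h0⟩ : q ∈ O₁) : q ∈ (∅ : Set Plane))
    · exact not_forall_coords_eq_zero hO₁ hne₁ (fun q hq => hh q hq.1)
        (show (1 : Fin 3) ≠ 2 by decide) fun q hq =>
        ⟨(hb q hq.1).1, (hb q hq.1).2.resolve_left hq.2⟩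
  frequently_injective q := by
    refine (frequently_parabola_ne 0 q).mono fun q hq q' h => ?_
    by_contra hne
    exact hq (by simpa using stdCuspidalCrossCap_double hne h)

/-- `G` is the discriminant of the quartic `s⁴ + y₂ s² - y₁ s + y₀`, and `stdSwallowtail (u, v)`
gives the quartics with the double root `v`. The factors of `mu` detect a triple root (`u + 6v² =
0`, the singular curve) and a second double root (`u + 2v² = 0`, the double curve). -/
theorem frontalModel_swallowtail : FrontalModel stdSwallowtail
    (fun q => !₂[q 1 ^ 2, 2 * q 1, 1])
    (fun q => !₂[q 1, 1, 0]) (fun q => 12 * q 1 ^ 2 + 2 * q 0)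
    (fun y => 16 * y 2 ^ 4 * y 0 - 4 * y 2 ^ 3 * y 1 ^ 2 - 128 * y 2 ^ 2 * y 0 ^ 2
      + 144 * y 2 * y 1 ^ 2 * y 0 - 27 * y 1 ^ 4 + 256 * y 0 ^ 3)
    (fun q => -16 * (q 0 + 6 * q 1 ^ 2) ^ 3 * (q 0 + 2 * q 1 ^ 2)) where
  contDiff := by
    unfold stdSwallowtail
    rw [contDiff_euclidean]
    intro i; fin_cases i <;> simp <;> fun_prop
  contDiff_GU := by
    rw [contDiff_euclidean]
    intro i; fin_cases i <;> simp <;> fun_prop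
  contDiff_E := by
    rw [contDiff_euclidean]
    intro i; fin_cases i <;> simp <;> fun_prop
  continuous_lam := by fun_prop
  differentiable_G := by fun_prop
  map_zero := by ext i; fin_cases i <;> simp [stdSwallowtail]
  lam_zero := by simp
  fderiv_apply q w := by
    have : HasFDerivAt stdSwallowtail (frontalDeriv !₂[q 1 ^ 2, 2 * q 1, 1]
        (12 * q 1 ^ 2 + 2 * q 0) !₂[q 1, 1, 0]) q := by
      rw [hasFDerivAt_space_iff]
      intro i
      have h0 := hasFDerivAt_coord 0 q
      have h1 := hasFDerivAt_coord 1 q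
      fin_cases i
      · refine (((h1.pow 4).const_mul 3).add (h0.mul (h1.pow 2))).congr_fderiv ?_
        ext w; simp [frontalDeriv_apply]; ring
      · refine (((h1.pow 3).const_mul 4).add ((h0.const_mul 2).mul h1)).congr_fderiv ?_
        ext w; simp [frontalDeriv_apply]; ring
      · refine h0.congr_fderiv ?_
        ext w; simp [frontalDeriv_apply]
    rw [this.fderiv, frontalDeriv_apply]
  cross_ne_zero q h := by
    have := (Space.ext_iff'.1 h).1
    simp at this
  implicit q := by simp [stdSwallowtail]; ring
  fderiv_implicit q w := by
    have h0 := hasFDerivAt_coord 0 (stdSwallowtail q)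
    have h1 := hasFDerivAt_coord 1 (stdSwallowtail q)
    have h2 := hasFDerivAt_coord 2 (stdSwallowtail q)
    have h3 := ((((((((h2.pow 4).const_mul 16).mul h0).sub
      (((h2.pow 3).const_mul 4).mul (h1.pow 2))).sub (((h2.pow 2).const_mul 128).mul
      (h0.pow 2))).add (((h2.const_mul 144).mul (h1.pow 2)).mul h0)).sub
      ((h1.pow 4).const_mul 27)).add ((h0.pow 3).const_mul 256))
    refine (DFunLike.congr_fun h3.fderiv w).trans ?_
    rw [Space.inner_eq]
    simp [stdSwallowtail]; ring
  frequently_lam_ne q := by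
    refine (frequently_parabola_ne 6 q).mono fun q hq h => hq (by linarith)
  exists_mu_ne_zero h O hO hne hh hr := by
    by_contra! hcon
    have hb : ∀ q ∈ O, (12 * h q 0 + h q 2 ^ 2 = 0 ∧ 27 * h q 1 ^ 2 + 8 * h q 2 ^ 3 = 0) ∨
        (h q 1 = 0 ∧ 4 * h q 0 - h q 2 ^ 2 = 0) := by
      intro q hq
      obtain ⟨q', h1, h2⟩ := hcon q hq
      rw [← h1]
      rcases mul_eq_zero.1 h2 with h3 | h3
      · have h4 : q' 0 + 6 * q' 1 ^ 2 = 0 :=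
          pow_eq_zero_iff (by norm_num) |>.1 ((mul_eq_zero.1 h3).resolve_left (by norm_num))
        have h5 : q' 0 = -6 * q' 1 ^ 2 := by linarith
        left
        simp [stdSwallowtail, h5]
        constructor <;> ring
      · have h5 : q' 0 = -2 * q' 1 ^ 2 := by linarith
        right
        simp [stdSwallowtail, h5]
        constructor <;> ring
    have hc : ∀ i, ContinuousOn (fun q => h q i) O := fun i =>
      (EuclideanSpace.proj i : Space →L[ℝ] ℝ).continuous.comp_continuousOn
        (continuousOn_of_immersion hh)
    set O₁ := O ∩ (fun q => (h q 1, 4 * h q 0 - h q 2 ^ 2)) ⁻¹' {0}ᶜ with hO₁def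
    have hO₁ : IsOpen O₁ := by
      refine ContinuousOn.isOpen_inter_preimage ?_ hO isOpen_compl_singleton
      exact (hc 1).prodMk (((hc 0).const_mul 4).sub ((hc 2).pow 2))
    rcases O₁.eq_empty_or_nonempty with he | hne₁
    · have hb' : ∀ q ∈ O, h q 1 = 0 ∧ 4 * h q 0 - h q 2 ^ 2 = 0 := by
        intro q hq
        by_contra h0
        have : q ∈ O₁ := ⟨hq, fun h1 => h0 (by simpa [Prod.ext_iff] using h1)⟩
        rw [he] at this
        exact this
      obtain ⟨q, hq⟩ := hne
      have h0 := hasFDerivAt_coord 0 (h q)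
      have h2 := hasFDerivAt_coord 2 (h q)
      refine not_forall_two_eqs hO hq hh (hasFDerivAt_coord 1 _) ((h0.const_mul 4).sub (h2.pow 2))
        (fun q hq => (hb' q hq).1) (fun q hq => (hb' q hq).2) !₂[0, 1, 0] !₂[1, 0, 0] ?_
      simp
    · have hb' : ∀ q ∈ O₁, 12 * h q 0 + h q 2 ^ 2 = 0 ∧ 27 * h q 1 ^ 2 + 8 * h q 2 ^ 3 = 0 := by
        intro q hq
        refine (hb q hq.1).resolve_right fun h1 => hq.2 ?_
        simpa [Prod.ext_iff] using h1
      have hh₁ : ∀ q ∈ O₁, DifferentiableAt ℝ h q ∧ Function.Injective (fderiv ℝ h q) :=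
        fun q hq => hh q hq.1
      -- The two equations of the singular curve must have dependent differentials at each point of
      -- the image; the minors give `y₁ = y₂ = 0`, again a coordinate axis.
      refine not_forall_coords_eq_zero hO₁ hne₁ hh₁ (show (1 : Fin 3) ≠ 2 by decide)
        fun q hq => ?_
      have h0 := hasFDerivAt_coord 0 (h q)
      have h1 := hasFDerivAt_coord 1 (h q)
      have h2 := hasFDerivAt_coord 2 (h q)
      have h3 := fderiv_mul_eq_mul hO₁ hq (hh₁ q hq).1 (hh₁ q hq).2
        ((h0.const_mul 12).add (h2.pow 2)) (((h1.pow 2).const_mul 27).add ((h2.pow 3).const_mul 8))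
        (fun q hq => (hb' q hq).1) (fun q hq => (hb' q hq).2) !₂[1, 0, 0]
      have h4 := h3 !₂[0, 1, 0]
      have h5 := h3 !₂[0, 0, 1]
      simp at h4 h5
      exact ⟨h4, h5⟩
  frequently_injective q := by
    refine (frequently_parabola_ne 2 q).mono fun q hq q' h => ?_
    by_contra hne
    apply hq
    linear_combination stdSwallowtail_double hne h

/-! ### Lifts computed from the normal: cuspidal edge and swallowtail. -/

theorem contDiffAt_coord {E : Type*} [NormedAddCommGroup E] [NormedSpace ℝ E] {r : WithTop ℕ∞}
    {n : ℕ} {F : E → EuclideanSpace ℝ (Fin n)} {q : E} (hF : ContDiffAt ℝ r F q) (i : Fin n) :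
    ContDiffAt ℝ r (fun q => F q i) q :=
  contDiffAt_euclidean.1 hF i

theorem contDiffAt_cross {r : WithTop ℕ∞} {X Y : Plane → Space} {q : Plane}
    (hX : ContDiffAt ℝ r X q) (hY : ContDiffAt ℝ r Y q) :
    ContDiffAt ℝ r (fun q => cross (X q) (Y q)) q := by
  have hX' := contDiffAt_coord hX
  have hY' := contDiffAt_coord hY
  rw [contDiffAt_euclidean]
  intro i
  fin_cases i
  · exact ((hX' 1).mul (hY' 2)).sub ((hX' 2).mul (hY' 1))
  · exact ((hX' 2).mul (hY' 0)).sub ((hX' 0).mul (hY' 2))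
  · exact ((hX' 0).mul (hY' 1)).sub ((hX' 1).mul (hY' 0))

theorem contDiffAt_plane {r : WithTop ℕ∞} {a b : Plane → ℝ} {q : Plane}
    (ha : ContDiffAt ℝ r a q) (hb : ContDiffAt ℝ r b q) :
    ContDiffAt ℝ r (fun q => (!₂[a q, b q] : Plane)) q := by
  rw [contDiffAt_euclidean]
  intro i; fin_cases i
  · exact ha
  · exact hb

namespace FrontalModel

variable {g GU E : Plane → Space} {lam : Plane → ℝ} {G : Space → ℝ} {mu : Plane → ℝ}
  {r : WithTop ℕ∞} {τ : Space → Space}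

/-- The normal of the image of the frontal under a diffeomorphism. -/
noncomputable def imageNormal (g GU E : Plane → Space) (τ : Space → Space) (q : Plane) : Space :=
  cross (fderiv ℝ τ (g q) (GU q)) (fderiv ℝ τ (g q) (E q))

theorem contDiffAt_imageNormal (hr : r = ∞ ∨ r = ω) (hg : FrontalModel g GU E lam G mu)
    (hτ : LocalSymmetry r g τ) :
    ∀ᶠ q in 𝓝 (0 : Plane), ContDiffAt ℝ r (imageNormal g GU E τ) q := by
  filter_upwards [hg.contDiffAt_fderiv_apply hr hτ hg.contDiff_GU,
    hg.contDiffAt_fderiv_apply hr hτ hg.contDiff_E] with q h1 h2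
  exact contDiffAt_cross h1 h2

theorem imageNormal_ne_zero (hg : FrontalModel g GU E lam G mu) (hτ : LocalSymmetry r g τ) :
    imageNormal g GU E τ 0 ≠ 0 := by
  unfold imageNormal
  rw [hg.map_zero]
  exact cross_map_ne_zero hτ.injective.self_of_nhds (hg.cross_ne_zero 0)

/-- Preservation of the limiting tangent plane. Together with `imageNormal_ne_zero` it keeps the
denominators of the lift formulas nonzero near the origin. -/
theorem cross_imageNormal_zero (hr : r = ∞ ∨ r = ω) (hg : FrontalModel g GU E lam G mu)
    (hτ : LocalSymmetry r g τ) :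
    cross (cross (GU 0) (E 0)) (imageNormal g GU E τ 0) = 0 := by
  obtain ⟨h1, h2⟩ := hg.inner_cross_fderiv_eq_zero hr hτ
  refine cross_cross_eq_zero ?_ ?_ <;> rwa [hg.map_zero]

/-- A smooth formula for the lift that is valid wherever the tangent planes correspond
defines a lift. -/
theorem lift_of_formula (hr : r = ∞ ∨ r = ω) (hg : FrontalModel g GU E lam G mu)
    (hτ : LocalSymmetry r g τ) {ψ : Plane → Plane}
    (hψ : ∀ᶠ q in 𝓝 (0 : Plane), ContDiffAt ℝ r ψ q)
    (hform : ∀ᶠ q in 𝓝 (0 : Plane), ∀ q', g q' = τ (g q) →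
      cross (cross (GU q') (E q')) (imageNormal g GU E τ q) = 0 → q' = ψ q) :
    ψ 0 = 0 ∧ (∀ᶠ q in 𝓝 (0 : Plane), g (ψ q) = τ (g q)) ∧
    (∀ᶠ q in 𝓝 (0 : Plane),
      inner ℝ (cross (GU (ψ q)) (E (ψ q))) (fderiv ℝ τ (g q) (GU q)) = 0 ∧
      inner ℝ (cross (GU (ψ q)) (E (ψ q))) (fderiv ℝ τ (g q) (E q)) = 0) := by
  -- Generic lifts can be taken in any neighborhood of `0`, yet the formula puts them near `ψ 0`.
  have h0 : ψ 0 = 0 := by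
    by_contra hne
    obtain ⟨A, B, hA, hB, hAB⟩ := t2_separation_nhds hne
    have h1 := (hg.frequently_exists_lift hr hτ hB).self_of_nhds
    have h2 : ∀ᶠ q in 𝓝 (0 : Plane), ψ q ∈ A := hψ.self_of_nhds.continuousAt hA
    obtain ⟨q, ⟨q', hq', h3, h4, h5⟩, h6, h7⟩ := (h1.and_eventually (h2.and hform)).exists
    rw [h7 q' h3 (cross_cross_eq_zero h4 h5)] at hq'
    exact hAB.le_bot ⟨h6, hq'⟩
  have hev : ∀ᶠ q in 𝓝 (0 : Plane), ∃ᶠ q₁ in 𝓝 q, g (ψ q₁) = τ (g q₁) ∧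
      inner ℝ (cross (GU (ψ q₁)) (E (ψ q₁))) (fderiv ℝ τ (g q₁) (GU q₁)) = 0 ∧
      inner ℝ (cross (GU (ψ q₁)) (E (ψ q₁))) (fderiv ℝ τ (g q₁) (E q₁)) = 0 := by
    filter_upwards [hg.frequently_exists_lift hr hτ univ_mem, hform.eventually_nhds] with q h1 h2
    refine (h1.and_eventually h2).mono ?_
    rintro q₁ ⟨⟨q', -, h3, h4, h5⟩, h6⟩
    rw [← h6 q' h3 (cross_cross_eq_zero h4 h5)]
    exact ⟨h3, h4, h5⟩
  have hN : ∀ᶠ q in 𝓝 (0 : Plane), ContinuousAt (fun q => cross (GU (ψ q)) (E (ψ q))) q := by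
    filter_upwards [hψ] with q hq
    exact hg.continuous_cross.continuousAt.comp (f := ψ) hq.continuousAt
  refine ⟨h0, ?_, ?_⟩
  · filter_upwards [hev, hψ, hg.contDiffAt_comp hτ] with q h1 h2 h3
    have hc : ContinuousAt (fun q => ‖g (ψ q) - τ (g q)‖) q :=
      ((hg.contDiff.continuous.continuousAt.comp (f := ψ) h2.continuousAt).sub
        h3.continuousAt).norm
    have := eq_zero_of_frequently hc (h1.mono fun q₁ h => by rw [h.1, sub_self, norm_zero])
    rwa [norm_eq_zero, sub_eq_zero] at this
  · filter_upwards [hev, hN, hg.contDiffAt_fderiv_apply hr hτ hg.contDiff_GU,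
      hg.contDiffAt_fderiv_apply hr hτ hg.contDiff_E] with q h1 h2 h3 h4
    exact ⟨eq_zero_of_frequently (F := fun q => inner ℝ (cross (GU (ψ q)) (E (ψ q))) (fderiv ℝ τ (g q) (GU q)))
        (h2.inner h3.continuousAt) (h1.mono fun q₁ h => h.2.1),
      eq_zero_of_frequently (F := fun q => inner ℝ (cross (GU (ψ q)) (E (ψ q))) (fderiv ℝ τ (g q) (E q)))
        (h2.inner h4.continuousAt) (h1.mono fun q₁ h => h.2.2)⟩

end FrontalModel

open FrontalModel

/-- The third coordinate of the image point is `u'`, and the normal `(-3v', 2, 0)` has slope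
proportional to `v'`. -/
theorem exists_lift_cuspidalEdge {r : WithTop ℕ∞} (hr : r = ∞ ∨ r = ω) {τ : Space → Space}
    (hτ : LocalSymmetry r stdCuspidalEdge τ) :
    ∃ ψ : Plane → Plane, (∀ᶠ q in 𝓝 (0 : Plane), ContDiffAt ℝ r ψ q) ∧ ψ 0 = 0 ∧
      ∀ᶠ q in 𝓝 (0 : Plane), stdCuspidalEdge (ψ q) = τ (stdCuspidalEdge q) := by
  have hg := frontalModel_cuspidalEdge
  have hm := hg.contDiffAt_imageNormal hr hτ
  set m := imageNormal stdCuspidalEdge (fun _ => !₂[0, 0, 1]) (fun q => !₂[2, 3 * q 1, 0]) τ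
    with hmdef
  have hm1 : m 0 1 ≠ 0 := by
    intro h
    have h1 := Space.ext_iff'.1 (hg.cross_imageNormal_zero hr hτ)
    simp [← hmdef] at h1
    exact hg.imageNormal_ne_zero hτ (Space.ext_iff'.2 ⟨by simpa using h1.2, h, by simpa using h1.1⟩)
  have hm1' : ∀ᶠ q in 𝓝 (0 : Plane), m q 1 ≠ 0 :=
    (contDiffAt_coord hm.self_of_nhds 1).continuousAt.eventually_ne hm1
  have hψ : ∀ᶠ q in 𝓝 (0 : Plane), ContDiffAt ℝ r (fun q : Plane =>
      (!₂[τ (stdCuspidalEdge q) 2, -(2 / 3) * m q 0 / m q 1] : Plane)) q := by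
    filter_upwards [hm, hm1', hg.contDiffAt_comp hτ] with q h1 h2 h3
    exact contDiffAt_plane (contDiffAt_coord h3 2)
      ((contDiffAt_const.mul (contDiffAt_coord h1 0)).div (contDiffAt_coord h1 1) h2)
  have h := hg.lift_of_formula hr hτ hψ (by
    filter_upwards [hm1'] with q hq q' h1 h2
    ext i; fin_cases i
    · exact congrArg (fun y : Space => y 2) h1
    · have := (Space.ext_iff'.1 h2).2.2
      simp [← hmdef] at this ⊢
      rw [eq_div_iff hq]
      linarith)
  exact ⟨_, hψ, h.1, h.2.1⟩

/-- The normal is `(-1, v', -v'²)`, so `v'` is again a slope. The tangency equations are kept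
because two of the eigenvalue relations come from them. -/
theorem exists_lift_swallowtail {r : WithTop ℕ∞} (hr : r = ∞ ∨ r = ω) {τ : Space → Space}
    (hτ : LocalSymmetry r stdSwallowtail τ) :
    ∃ ψ : Plane → Plane, (∀ᶠ q in 𝓝 (0 : Plane), ContDiffAt ℝ r ψ q) ∧ ψ 0 = 0 ∧
      (∀ᶠ q in 𝓝 (0 : Plane), stdSwallowtail (ψ q) = τ (stdSwallowtail q)) ∧
      ∀ᶠ q in 𝓝 (0 : Plane),
        inner ℝ (!₂[-1, ψ q 1, -ψ q 1 ^ 2] : Space)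
          (fderiv ℝ τ (stdSwallowtail q) !₂[q 1 ^ 2, 2 * q 1, 1]) = 0 ∧
        inner ℝ (!₂[-1, ψ q 1, -ψ q 1 ^ 2] : Space)
          (fderiv ℝ τ (stdSwallowtail q) !₂[q 1, 1, 0]) = 0 := by
  have hg := frontalModel_swallowtail
  have hm := hg.contDiffAt_imageNormal hr hτ
  set m := imageNormal stdSwallowtail (fun q => !₂[q 1 ^ 2, 2 * q 1, 1])
    (fun q => !₂[q 1, 1, 0]) τ with hmdef
  have hm0 : m 0 0 ≠ 0 := by
    intro h
    have h1 := Space.ext_iff'.1 (hg.cross_imageNormal_zero hr hτ)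
    simp [← hmdef] at h1
    exact hg.imageNormal_ne_zero hτ (Space.ext_iff'.2 ⟨h, by simpa using h1.2, by simpa using h1.1⟩)
  have hm0' : ∀ᶠ q in 𝓝 (0 : Plane), m q 0 ≠ 0 :=
    (contDiffAt_coord hm.self_of_nhds 0).continuousAt.eventually_ne hm0
  have hψ : ∀ᶠ q in 𝓝 (0 : Plane), ContDiffAt ℝ r (fun q : Plane =>
      (!₂[τ (stdSwallowtail q) 2, -m q 1 / m q 0] : Plane)) q := by
    filter_upwards [hm, hm0', hg.contDiffAt_comp hτ] with q h1 h2 h3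
    exact contDiffAt_plane (contDiffAt_coord h3 2)
      ((contDiffAt_coord h1 1).neg.div (contDiffAt_coord h1 0) h2)
  have h := hg.lift_of_formula hr hτ hψ (by
    filter_upwards [hm0'] with q hq q' h1 h2
    ext i; fin_cases i
    · exact congrArg (fun y : Space => y 2) h1
    · have := (Space.ext_iff'.1 h2).2.2
      simp [← hmdef] at this ⊢
      rw [eq_div_iff hq]
      linarith)
  refine ⟨_, hψ, h.1, h.2.1, ?_⟩
  filter_upwards [h.2.2] with q hq
  have hN : ∀ v : ℝ, cross !₂[v ^ 2, 2 * v, 1] !₂[v, 1, 0] = !₂[-1, v, -v ^ 2] := by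
    intro v
    ext i; fin_cases i <;> simp
    ring
  simp only [hN] at hq
  exact hq

/-! ### The lift for the cuspidal cross cap. -/

theorem hasDerivAt_coord {n : ℕ} {F : ℝ → EuclideanSpace ℝ (Fin n)}
    {F' : EuclideanSpace ℝ (Fin n)} {t : ℝ} (h : HasDerivAt F F' t) (i : Fin n) :
    HasDerivAt (fun t => F t i) (F' i) t :=
  (hasFDerivAt_coord i (F t)).comp_hasDerivAt t h

theorem hasDerivAt_of_coord {n : ℕ} {F : ℝ → EuclideanSpace ℝ (Fin n)}
    {F' : EuclideanSpace ℝ (Fin n)} {t : ℝ} (h : ∀ i, HasDerivAt (fun t => F t i) (F' i) t) :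
    HasDerivAt F F' t := by
  rw [hasDerivAt_iff_hasFDerivAt, ← hasFDerivWithinAt_univ, hasFDerivWithinAt_euclidean]
  intro i
  rw [hasFDerivWithinAt_univ]
  exact (h i).hasFDerivAt.congr_fderiv (by ext; simp)

theorem hasDerivAt_vertical (u t : ℝ) :
    HasDerivAt (fun t : ℝ => (!₂[u, t] : Plane)) !₂[0, 1] t := by
  refine hasDerivAt_of_coord fun i => ?_
  fin_cases i
  · exact hasDerivAt_const t u
  · exact hasDerivAt_id t

theorem continuous_vertical (u : ℝ) : Continuous fun t : ℝ => (!₂[u, t] : Plane) :=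
  continuous_iff_continuousAt.2 fun t => (hasDerivAt_vertical u t).continuousAt

theorem continuous_horizontal : Continuous fun u : ℝ => (!₂[u, 0] : Plane) := by
  fun_prop

theorem tendsto_horizontal : Tendsto (fun u : ℝ => (!₂[u, 0] : Plane)) (𝓝 0) (𝓝 0) :=
  continuous_horizontal.tendsto' 0 0 (by ext i; fin_cases i <;> simp)

theorem eventually_axis {P : Plane → Prop} (h : ∀ᶠ q in 𝓝 (0 : Plane), P q) :
    ∀ᶠ u in 𝓝 (0 : ℝ), P !₂[u, 0] := tendsto_horizontal.eventually h

theorem eventually_vertical {P : Plane → Prop} {u : ℝ} (h : ∀ᶠ q in 𝓝 (!₂[u, 0] : Plane), P q) :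
    ∀ᶠ t in 𝓝 (0 : ℝ), P !₂[u, t] :=
  ((continuous_vertical u).tendsto 0).eventually h

theorem space_eq_basis (w : Space) :
    w = w 0 • !₂[1, 0, 0] + w 1 • !₂[0, 1, 0] + w 2 • !₂[0, 0, 1] := by
  ext i; fin_cases i <;> simp

/-- A linear automorphism of the space is not annihilated by a nonzero covector. -/
theorem exists_basis_pairing_ne_zero {L : Space →L[ℝ] Space} (hL : Function.Injective L)
    {a b : ℝ} (hx : a * L !₂[1, 0, 0] 0 + L !₂[1, 0, 0] 1 + b * L !₂[1, 0, 0] 2 = 0)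
    (hy : a * L !₂[0, 1, 0] 0 + L !₂[0, 1, 0] 1 + b * L !₂[0, 1, 0] 2 = 0)
    (hz : a * L !₂[0, 0, 1] 0 + L !₂[0, 0, 1] 1 + b * L !₂[0, 0, 1] 2 = 0) : False := by
  have hs : Function.Surjective L :=
    LinearMap.surjective_of_injective (f := (L : Space →ₗ[ℝ] Space)) hL
  obtain ⟨w, hw⟩ := hs !₂[0, 1, 0]
  rw [space_eq_basis w] at hw
  simp only [map_add, map_smul] at hw
  obtain ⟨h0, h1, h2⟩ := Space.ext_iff'.1 hw
  simp at h0 h1 h2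
  have : (1 : ℝ) = 0 := by
    rw [← h1]
    linear_combination w 0 * hx + w 1 * hy + w 2 * hz - a * h0 - b * h2
  exact one_ne_zero this

/-- Vanishing of the cusp coordinate of the lift along the singular set of the cuspidal cross cap:
`n`, `k`, `h` stand for `-3/2 x y`, `y³`, `y²`, where `(x, y)` is the lift. -/
theorem cuspidalCrossCap_axis {r : WithTop ℕ∞} (hr : r = ∞ ∨ r = ω) {τ : Space → Space}
    {h k n : Plane → ℝ} {u : ℝ} (hu : u ≠ 0)
    (hτ : ContDiffAt ℝ r τ !₂[0, 0, u])
    (hinj : Function.Injective (fderiv ℝ τ !₂[0, 0, u]))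
    (hk : DifferentiableAt ℝ k !₂[u, 0]) (hn : DifferentiableAt ℝ n !₂[u, 0])
    (hh : ∀ q, h q = τ (stdCuspidalCrossCap q) 0)
    (h1 : ∀ᶠ q in 𝓝 (!₂[u, 0] : Plane), k q ^ 2 = h q ^ 3)
    (h2 : ∀ᶠ q in 𝓝 (!₂[u, 0] : Plane),
      n q * h q = -(3 / 2) * (τ (stdCuspidalCrossCap q) 2 * k q))
    (hX : ∀ᶠ q in 𝓝 (!₂[u, 0] : Plane), ∀ X, X = fderiv ℝ τ (stdCuspidalCrossCap q)
      !₂[0, q 1 ^ 3, 1] → n q * X 0 + X 1 - k q * X 2 = 0)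
    (hY : ∀ᶠ q in 𝓝 (!₂[u, 0] : Plane), ∀ Y, Y = fderiv ℝ τ (stdCuspidalCrossCap q)
      !₂[2, 3 * q 0 * q 1, 0] → n q * Y 0 + Y 1 - k q * Y 2 = 0) :
    h !₂[u, 0] = 0 := by
  by_contra hne
  have hg := frontalModel_cuspidalCrossCap
  set c : ℝ → Plane := fun t => !₂[u, t] with hc
  have hc0 : c 0 = !₂[u, 0] := rfl
  have hgc0 : stdCuspidalCrossCap (c 0) = !₂[0, 0, u] := by
    ext i; fin_cases i <;> simp [stdCuspidalCrossCap, hc]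
  -- The vertical direction is the kernel of `dg` on the axis, so every differentiable function of
  -- `g` is stationary along `c` at `0`.
  have hgc : HasDerivAt (fun t => stdCuspidalCrossCap (c t)) 0 0 := by
    have := (hg.differentiable (c 0)).hasFDerivAt.comp_hasDerivAt 0 (hasDerivAt_vertical u 0)
    rw [hg.fderiv_apply] at this
    exact this.congr_deriv (by simp [hc])
  have hcomp : ∀ {F : Type} [NormedAddCommGroup F] [NormedSpace ℝ F] {S : Space → F},
      DifferentiableAt ℝ S !₂[0, 0, u] →
      HasDerivAt (fun t => S (stdCuspidalCrossCap (c t))) 0 0 := by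
    intro F _ _ S hS
    rw [← hgc0] at hS
    have := hS.hasFDerivAt.comp_hasDerivAt 0 hgc
    rwa [_root_.map_zero] at this
  have hτd : DifferentiableAt ℝ τ !₂[0, 0, u] :=
    hτ.differentiableAt (ne_zero_of_eq_infty_or_omega hr)
  have hτ' : DifferentiableAt ℝ (fderiv ℝ τ) !₂[0, 0, u] :=
    (hτ.fderiv_right (add_one_le_of_eq_infty_or_omega hr)).differentiableAt
      (ne_zero_of_eq_infty_or_omega hr)
  have hH : HasDerivAt (fun t => h (c t)) 0 0 := by
    simp only [hh]
    exact hasDerivAt_coord (hcomp hτd) 0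
  have hU : HasDerivAt (fun t => τ (stdCuspidalCrossCap (c t)) 2) 0 0 := by
    exact hasDerivAt_coord (hcomp hτd) 2
  obtain ⟨k', hk'⟩ : ∃ k', HasDerivAt (fun t => k (c t)) k' 0 :=
    ⟨_, (hk.hasFDerivAt (x := c 0)).comp_hasDerivAt 0 (hasDerivAt_vertical u 0)⟩
  obtain ⟨n', hn'⟩ : ∃ n', HasDerivAt (fun t => n (c t)) n' 0 :=
    ⟨_, (hn.hasFDerivAt (x := c 0)).comp_hasDerivAt 0 (hasDerivAt_vertical u 0)⟩
  have hkne : k (c 0) ≠ 0 := by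
    intro h0
    have := h1.self_of_nhds
    rw [← hc0, h0] at this
    exact hne (pow_eq_zero_iff (n := 3) (by norm_num) |>.1 (by rw [← hc0, ← this]; norm_num))
  -- As `h` is stationary and `k ≠ 0`, the relation `k² = h³` makes `k` stationary too; then `n h =
  -- -(3/2) U k` with `h ≠ 0` does the same for `n`.
  have hk0 : k' = 0 := by
    have e1 := (hk'.pow 2).unique ((hH.pow 3).congr_of_eventuallyEq (eventually_vertical h1))
    simp at e1
    exact e1.resolve_left hkne
  have hn0 : n' = 0 := by
    have e1 := (hn'.mul hH).unique
      (((hU.mul hk').const_mul (-(3 / 2))).congr_of_eventuallyEq (eventually_vertical h2))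
    simp [hk0] at e1
    exact e1.resolve_right hne
  subst hk0 hn0
  set A : Space → ℝ → Space := fun w t => fderiv ℝ τ (stdCuspidalCrossCap (c t)) w with hA
  have hAd : ∀ w, HasDerivAt (A w) 0 0 := by
    intro w
    exact ((hcomp hτ').clm_apply (hasDerivAt_const (0 : ℝ) w)).congr_deriv (by simp)
  have hYd : HasDerivAt (fun t => (2 : ℝ) • A !₂[1, 0, 0] t + (3 * u * t) • A !₂[0, 1, 0] t)
      ((3 * u) • A !₂[0, 1, 0] 0) 0 := by
    have := ((hAd !₂[1, 0, 0]).const_smul (2 : ℝ)).add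
      (((hasDerivAt_id (0 : ℝ)).const_mul (3 * u)).smul (hAd !₂[0, 1, 0]))
    exact this.congr_deriv (by simp)
  set Y : ℝ → Space := fun t => (2 : ℝ) • A !₂[1, 0, 0] t + (3 * u * t) • A !₂[0, 1, 0] t
    with hYdef
  have hYeq : ∀ t, Y t = fderiv ℝ τ (stdCuspidalCrossCap (c t)) !₂[2, 3 * c t 0 * c t 1, 0] := by
    intro t
    simp only [hYdef, hA, ← map_smul, ← map_add]
    congr 1
    ext i; fin_cases i <;> simp [hc]
  have hYi := fun i => hasDerivAt_coord hYd i
  have e1 : HasDerivAt (fun t => n (c t) * Y t 0 + Y t 1 - k (c t) * Y t 2) 0 0 :=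
    (hasDerivAt_const (0 : ℝ) (0 : ℝ)).congr_of_eventuallyEq
      ((eventually_vertical hY).mono fun t ht => ht _ (hYeq t))
  -- Only the explicit factor `t` in `E` contributes to the derivative. Since `u ≠ 0`, the covector
  -- `(n, 1, -k)` kills the image under `dτ` of the second basis vector; its values at `t = 0` kill
  -- the other two.
  have e2 := (((hn'.mul (hYi 0)).add (hYi 1)).sub (hk'.mul (hYi 2))).unique e1
  have hA0 : ∀ w, A w 0 = fderiv ℝ τ !₂[0, 0, u] w := fun w => by rw [hA, ← hgc0]
  have hYself := hY.self_of_nhds _ (hYeq 0)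
  have hXself := hX.self_of_nhds _ rfl
  have hY0 : Y 0 = (2 : ℝ) • A !₂[1, 0, 0] 0 := by simp [hYdef]
  rw [hY0] at hYself
  simp only [hA0, PiLp.smul_apply, smul_eq_mul] at e2 hYself
  have hXv : (!₂[(0 : ℝ), (!₂[u, 0] : Plane) 1 ^ 3, 1] : Space) = !₂[0, 0, 1] := by
    ext i; fin_cases i <;> simp
  rw [hXv, ← hc0, hgc0] at hXself
  refine exists_basis_pairing_ne_zero hinj (a := n (c 0)) (b := -k (c 0)) ?_ ?_ ?_
  · linear_combination hYself / 2
  · apply mul_left_cancel₀ (mul_ne_zero three_ne_zero hu)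
    linear_combination e2
  · linear_combination hXself

/-- An identity between continuous functions may be checked off the first coordinate axis. -/
theorem eq_zero_of_mul_snd_pow {F : Plane → ℝ} (hF : ∀ᶠ q in 𝓝 (0 : Plane), ContinuousAt F q)
    (n : ℕ) (h : ∀ᶠ q in 𝓝 (0 : Plane), q 1 ^ n * F q = 0) : ∀ᶠ q in 𝓝 (0 : Plane), F q = 0 := by
  filter_upwards [hF, h.eventually_nhds] with q h1 h2
  exact eq_zero_of_frequently h1 (((frequently_snd_ne q).and_eventually h2).mono
    fun q' h => (mul_eq_zero.1 h.2).resolve_left (pow_ne_zero n h.1))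

/-- Entries of `dτ(0)` in directions not tangent to a regular curve of the surface are obtained by
rescaling cuspidal curves such as `t ↦ g (0, t)` by `t²` or `t³`. -/
theorem hasFDerivAt_lim_smul {F : Type*} [NormedAddCommGroup F] [NormedSpace ℝ F] {E : Type*}
    [NormedAddCommGroup E] [NormedSpace ℝ E] {f : E → F} {f' : E →L[ℝ] F}
    (hf : HasFDerivAt f f' 0) {α : Type*} {l : Filter α} {c : α → ℝ} {d : α → E} {v : E}
    (dlim : Tendsto d l (𝓝 0)) (cdlim : Tendsto (fun n => c n • d n) l (𝓝 v)) :
    Tendsto (fun n => c n • (f (d n) - f 0)) l (𝓝 (f' v)) := by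
  have := (hasFDerivWithinAt_univ.2 hf).lim dlim (Eventually.of_forall fun _ => mem_univ _) cdlim
  simpa using this

/-- The image point gives `h = v'²` and the normal gives `k = v'³`, but `v'` itself only as a
quotient with vanishing denominator. Dividing `h` and `k` by `v²` removes the zero. -/
theorem exists_lift_cuspidalCrossCap {r : WithTop ℕ∞} (hr : r = ∞ ∨ r = ω) {τ : Space → Space}
    (hτ : LocalSymmetry r stdCuspidalCrossCap τ) :
    ∃ ψ : Plane → Plane, (∀ᶠ q in 𝓝 (0 : Plane), ContDiffAt ℝ r ψ q) ∧ ψ 0 = 0 ∧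
      (∀ᶠ q in 𝓝 (0 : Plane), stdCuspidalCrossCap (ψ q) = τ (stdCuspidalCrossCap q)) ∧
      ∀ᶠ u in 𝓝 (0 : ℝ), ψ !₂[u, 0] 1 = 0 := by
  have hg := frontalModel_cuspidalCrossCap
  have hr0 := ne_zero_of_eq_infty_or_omega hr
  have hm := hg.contDiffAt_imageNormal hr hτ
  set m := imageNormal stdCuspidalCrossCap (fun q => !₂[0, q 1 ^ 3, 1])
    (fun q => !₂[2, 3 * q 0 * q 1, 0]) τ with hmdef
  have hm1 : m 0 1 ≠ 0 := by
    intro h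
    have h1 := Space.ext_iff'.1 (hg.cross_imageNormal_zero hr hτ)
    simp [← hmdef] at h1
    exact hg.imageNormal_ne_zero hτ (Space.ext_iff'.2 ⟨by simpa using h1.2, h, by simpa using h1.1⟩)
  have hm1' : ∀ᶠ q in 𝓝 (0 : Plane), m q 1 ≠ 0 :=
    (contDiffAt_coord hm.self_of_nhds 1).continuousAt.eventually_ne hm1
  have hcomp := hg.contDiffAt_comp hτ
  set h : Plane → ℝ := fun q => τ (stdCuspidalCrossCap q) 0 with hh
  set U : Plane → ℝ := fun q => τ (stdCuspidalCrossCap q) 2 with hU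
  set y : Plane → ℝ := fun q => τ (stdCuspidalCrossCap q) 1 with hy
  set k : Plane → ℝ := fun q => -m q 2 / m q 1 with hk
  set n : Plane → ℝ := fun q => m q 0 / m q 1 with hn
  have hhs : ∀ᶠ q in 𝓝 (0 : Plane), ContDiffAt ℝ r h q :=
    hcomp.mono fun q hq => contDiffAt_coord hq 0
  have hUs : ∀ᶠ q in 𝓝 (0 : Plane), ContDiffAt ℝ r U q :=
    hcomp.mono fun q hq => contDiffAt_coord hq 2
  have hys : ∀ᶠ q in 𝓝 (0 : Plane), ContDiffAt ℝ r y q :=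
    hcomp.mono fun q hq => contDiffAt_coord hq 1
  have hks : ∀ᶠ q in 𝓝 (0 : Plane), ContDiffAt ℝ r k q := by
    filter_upwards [hm, hm1'] with q h1 h2
    exact (contDiffAt_coord h1 2).neg.div (contDiffAt_coord h1 1) h2
  have hns : ∀ᶠ q in 𝓝 (0 : Plane), ContDiffAt ℝ r n q := by
    filter_upwards [hm, hm1'] with q h1 h2
    exact (contDiffAt_coord h1 0).div (contDiffAt_coord h1 1) h2
  -- identities satisfied where the tangent planes correspond
  have hfreq : ∀ᶠ q in 𝓝 (0 : Plane), ∃ᶠ q₁ in 𝓝 q, k q₁ ^ 2 - h q₁ ^ 3 = 0 ∧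
      y q₁ - U q₁ * k q₁ = 0 ∧ n q₁ * h q₁ + (3 / 2) * (U q₁ * k q₁) = 0 := by
    filter_upwards [hg.frequently_exists_lift hr hτ univ_mem, hm1'.eventually_nhds] with q h1 h2
    refine (h1.and_eventually h2).mono ?_
    rintro q₁ ⟨⟨q', -, h3, h4, h5⟩, h6⟩
    have h7 := Space.ext_iff'.1 (cross_cross_eq_zero h4 h5)
    rw [show cross (fderiv ℝ τ (stdCuspidalCrossCap q₁) !₂[0, q₁ 1 ^ 3, 1])
      (fderiv ℝ τ (stdCuspidalCrossCap q₁) !₂[2, 3 * q₁ 0 * q₁ 1, 0]) = m q₁ from rfl] at h7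
    have h0 : h q₁ = q' 1 ^ 2 := (congrArg (fun y : Space => y 0) h3).symm
    have hy1 : y q₁ = q' 0 * q' 1 ^ 3 := (congrArg (fun y : Space => y 1) h3).symm
    have hU2 : U q₁ = q' 0 := (congrArg (fun y : Space => y 2) h3).symm
    simp at h7
    have hk3 : k q₁ = q' 1 ^ 3 := by
      simp only [hk]; rw [div_eq_iff h6]
      linear_combination -(1 / 2) * h7.1
    have hn3 : n q₁ = -(3 / 2) * (q' 0 * q' 1) := by
      simp only [hn]; rw [div_eq_iff h6]
      linear_combination -(1 / 2) * h7.2.2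
    rw [hk3, h0, hy1, hU2, hn3]
    refine ⟨?_, ?_, ?_⟩ <;> ring
  have hid : ∀ᶠ q in 𝓝 (0 : Plane), k q ^ 2 = h q ^ 3 ∧ y q = U q * k q ∧
      n q * h q = -(3 / 2) * (U q * k q) := by
    filter_upwards [hfreq, hhs, hUs, hys, hks, hns] with q h0 h1 h2 h3 h4 h5
    have c1 := h1.continuousAt
    have c2 := h2.continuousAt
    have c3 := h3.continuousAt
    have c4 := h4.continuousAt
    have c5 := h5.continuousAt
    have e1 : k q ^ 2 - h q ^ 3 = 0 := eq_zero_of_frequently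
      (F := fun q => k q ^ 2 - h q ^ 3) ((c4.pow 2).sub (c1.pow 3)) (h0.mono fun _ h => h.1)
    have e2 : y q - U q * k q = 0 := eq_zero_of_frequently
      (F := fun q => y q - U q * k q) (c3.sub (c2.mul c4)) (h0.mono fun _ h => h.2.1)
    have e3 : n q * h q + (3 / 2) * (U q * k q) = 0 := eq_zero_of_frequently
      (F := fun q => n q * h q + (3 / 2) * (U q * k q)) ((c5.mul c1).add ((c2.mul c4).const_mul (3 / 2)))
      (h0.mono fun _ h => h.2.2)
    refine ⟨?_, ?_, ?_⟩
    · linear_combination e1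
    · linear_combination e2
    · linear_combination e3
  have hX : ∀ᶠ q in 𝓝 (0 : Plane), ∀ X, X = fderiv ℝ τ (stdCuspidalCrossCap q)
      !₂[0, q 1 ^ 3, 1] → n q * X 0 + X 1 - k q * X 2 = 0 := by
    filter_upwards [hm1'] with q hq X hX
    have := inner_cross_left X (fderiv ℝ τ (stdCuspidalCrossCap q) !₂[2, 3 * q 0 * q 1, 0])
    rw [show cross X _ = m q by rw [hX]; rfl, Space.inner_eq] at this
    simp only [hn, hk]
    field_simp
    linear_combination this
  have hY : ∀ᶠ q in 𝓝 (0 : Plane), ∀ Y, Y = fderiv ℝ τ (stdCuspidalCrossCap q)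
      !₂[2, 3 * q 0 * q 1, 0] → n q * Y 0 + Y 1 - k q * Y 2 = 0 := by
    filter_upwards [hm1'] with q hq Y hY
    have := inner_cross_right (fderiv ℝ τ (stdCuspidalCrossCap q) !₂[0, q 1 ^ 3, 1]) Y
    rw [show cross _ Y = m q by rw [hY]; rfl, Space.inner_eq] at this
    simp only [hn, hk]
    field_simp
    linear_combination this
  have hgax : ∀ u : ℝ, stdCuspidalCrossCap !₂[u, 0] = !₂[0, 0, u] := by
    intro u
    ext i; fin_cases i <;> simp [stdCuspidalCrossCap]
  have hhax : ∀ᶠ u in 𝓝 (0 : ℝ), h !₂[u, 0] = 0 := by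
    filter_upwards [eventually_axis hid.eventually_nhds, eventually_axis hX.eventually_nhds,
      eventually_axis hY.eventually_nhds, eventually_axis hks, eventually_axis hns,
      eventually_axis (hg.tendsto_zero.eventually hτ.contDiffAt),
      eventually_axis (hg.tendsto_zero.eventually hτ.injective)] with u e1 e2 e3 e4 e5 e6 e7
    rw [hgax] at e6 e7
    by_cases hu : u = 0
    · subst hu
      simp only [hh, hgax]
      rw [show (!₂[0, 0, 0] : Space) = 0 by ext i; fin_cases i <;> simp, hτ.map_zero]
      rfl
    · exact cuspidalCrossCap_axis hr hu e6 e7 (e4.differentiableAt hr0) (e5.differentiableAt hr0)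
        (fun _ => rfl) (e1.mono fun _ h => h.1) (e1.mono fun _ h => h.2.2) e2 e3
  have hkax : ∀ᶠ u in 𝓝 (0 : ℝ), k !₂[u, 0] = 0 := by
    filter_upwards [hhax, eventually_axis hid] with u h1 h2
    have := h2.1
    rw [h1] at this
    exact pow_eq_zero_iff (n := 2) (by norm_num) |>.1 (by rw [this]; norm_num)
  -- division by the square of the second coordinate
  obtain ⟨h₁, hh₁s, hh₁⟩ := exists_eq_mul hr hhs hhax
  -- `h` is a function of `g`, whose `v`-derivative vanishes on the axis, so `h` is divisible by `v`
  -- twice.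
  have hh₁ax : ∀ᶠ u in 𝓝 (0 : ℝ), h₁ !₂[u, 0] = 0 := by
    filter_upwards [eventually_axis hh₁.eventually_nhds, eventually_axis hh₁s,
      eventually_axis (hg.tendsto_zero.eventually hτ.contDiffAt)] with u e1 e2 e3
    have d1 : HasDerivAt (fun t : ℝ => h !₂[u, t]) 0 0 := by
      have d2 := (hg.differentiable !₂[u, 0]).hasFDerivAt.comp_hasDerivAt 0 (hasDerivAt_vertical u 0)
      have d3 := (e3.differentiableAt hr0).hasFDerivAt.comp_hasDerivAt 0 d2
      refine (hasDerivAt_coord d3 0).congr_deriv ?_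
      rw [hg.fderiv_apply]
      simp
    have d2 := ((e2.differentiableAt hr0).hasFDerivAt.comp_hasDerivAt 0 (hasDerivAt_vertical u 0))
    have d3 := ((hasDerivAt_id (0 : ℝ)).mul d2).congr_of_eventuallyEq (eventually_vertical e1)
    have := d1.unique d3
    simpa using this.symm
  obtain ⟨H, hHs, hH⟩ := exists_eq_mul hr hh₁s hh₁ax
  obtain ⟨k₁, hk₁s, hk₁⟩ := exists_eq_mul hr hks hkax
  have hhH : ∀ᶠ q in 𝓝 (0 : Plane), h q = q 1 ^ 2 * H q := by
    filter_upwards [hh₁, hH] with q e1 e2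
    rw [e1, e2]; ring
  have hk₁id : ∀ᶠ q in 𝓝 (0 : Plane), k₁ q ^ 2 - q 1 ^ 4 * H q ^ 3 = 0 := by
    refine eq_zero_of_mul_snd_pow ?_ 2 ?_
    · filter_upwards [hk₁s, hHs] with q e1 e2
      have c1 := e1.continuousAt
      have c2 := e2.continuousAt
      have c3 : ContinuousAt (fun q : Plane => q 1) q := by fun_prop
      exact (c1.pow 2).sub ((c3.pow 4).mul (c2.pow 3))
    · filter_upwards [hk₁, hhH, hid] with q e1 e2 e3
      have := e3.1
      rw [e1, e2] at this
      linear_combination this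
  have hk₁ax : ∀ᶠ u in 𝓝 (0 : ℝ), k₁ !₂[u, 0] = 0 := by
    filter_upwards [eventually_axis hk₁id] with u e1
    simpa using e1
  obtain ⟨K, hKs, hK⟩ := exists_eq_mul hr hk₁s hk₁ax
  have hkK : ∀ᶠ q in 𝓝 (0 : Plane), k q = q 1 ^ 2 * K q := by
    filter_upwards [hk₁, hK] with q e1 e2
    rw [e1, e2]; ring
  have hKid : ∀ᶠ q in 𝓝 (0 : Plane), K q ^ 2 - q 1 ^ 2 * H q ^ 3 = 0 := by
    refine eq_zero_of_mul_snd_pow ?_ 2 ?_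
    · filter_upwards [hKs, hHs] with q e1 e2
      have c1 := e1.continuousAt
      have c2 := e2.continuousAt
      have c3 : ContinuousAt (fun q : Plane => q 1) q := by fun_prop
      exact (c1.pow 2).sub ((c3.pow 2).mul (c2.pow 3))
    · filter_upwards [hK, hk₁id] with q e1 e2
      rw [e1] at e2
      linear_combination e2
  have hτd : HasFDerivAt τ (fderiv ℝ τ 0) 0 :=
    (hτ.contDiffAt.self_of_nhds.differentiableAt hr0).hasFDerivAt
  -- `H 0` is the first entry of `dτ(0)(1, 0, 0)`. If it vanished, the independent vectors `(0, 0,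
  -- 1)` and `(1, 0, 0)` would both be mapped into the third axis: their second entries vanish by
  -- preservation of the limiting tangent plane.
  have hH0 : H 0 ≠ 0 := by
    intro hH0
    obtain ⟨hz1, hx1⟩ := hg.inner_cross_fderiv_eq_zero hr hτ
    have hzv : (!₂[(0 : ℝ), (0 : Plane) 1 ^ 3, 1] : Space) = !₂[0, 0, 1] := by
      ext i; fin_cases i <;> simp
    have hxv : (!₂[(2 : ℝ), 3 * (0 : Plane) 0 * (0 : Plane) 1, 0] : Space) = (2 : ℝ) • !₂[1, 0, 0] := by
      ext i; fin_cases i <;> simp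
    have hcr : cross (!₂[0, 0, 1] : Space) ((2 : ℝ) • !₂[1, 0, 0]) = !₂[0, 2, 0] := by
      ext i; fin_cases i <;> simp
    rw [hzv, hxv, hcr] at hz1 hx1
    rw [Space.inner_eq] at hz1 hx1
    simp at hz1 hx1
    have hz0 : fderiv ℝ τ 0 !₂[0, 0, 1] 0 = 0 := by
      have d1 : HasDerivAt (fun u : ℝ => (!₂[0, 0, u] : Space)) !₂[0, 0, 1] 0 := by
        refine hasDerivAt_of_coord fun i => ?_
        fin_cases i
        · exact hasDerivAt_const _ _
        · exact hasDerivAt_const _ _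
        · exact hasDerivAt_id _
      have hv0 : (!₂[0, 0, (0 : ℝ)] : Space) = 0 := by ext i; fin_cases i <;> simp
      have d2 := hasDerivAt_coord ((hv0.symm ▸ hτd :
        HasFDerivAt τ (fderiv ℝ τ 0) !₂[0, 0, (0 : ℝ)]).comp_hasDerivAt 0 d1) 0
      refine d2.unique ((hasDerivAt_const (0 : ℝ) (0 : ℝ)).congr_of_eventuallyEq ?_)
      filter_upwards [hhax] with u hu
      simp only [hh, hgax] at hu
      exact hu
    have hx0 : fderiv ℝ τ 0 !₂[1, 0, 0] 0 = 0 := by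
      have t1 : Tendsto (fun t : ℝ => stdCuspidalCrossCap !₂[0, t]) (𝓝[≠] 0) (𝓝 0) := by
        refine Tendsto.mono_left ?_ nhdsWithin_le_nhds
        refine hg.tendsto_zero.comp ((continuous_vertical 0).tendsto' 0 0 ?_)
        ext i; fin_cases i <;> simp
      have t2 : Tendsto (fun t : ℝ => (t ^ 2)⁻¹ • stdCuspidalCrossCap !₂[0, t]) (𝓝[≠] 0)
          (𝓝 !₂[1, 0, 0]) := by
        refine tendsto_const_nhds.congr' ?_
        filter_upwards [self_mem_nhdsWithin] with t ht
        have ht : t ≠ 0 := ht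
        ext i; fin_cases i <;> simp [stdCuspidalCrossCap, ht]
      have t3 := hasFDerivAt_lim_smul hτd t1 t2
      have t4 : Tendsto (fun t : ℝ => H !₂[0, t]) (𝓝[≠] 0) (𝓝 (H 0)) := by
        refine Tendsto.mono_left ?_ nhdsWithin_le_nhds
        refine hHs.self_of_nhds.continuousAt.tendsto.comp ((continuous_vertical 0).tendsto' 0 0 ?_)
        ext i; fin_cases i <;> simp
      have t5 := ((EuclideanSpace.proj (0 : Fin 3) : Space →L[ℝ] ℝ).continuous.tendsto _).comp t3
      have hv : (!₂[0, 0] : Plane) = 0 := by ext i; fin_cases i <;> simp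
      refine (tendsto_nhds_unique t5 (t4.congr' ?_)).trans hH0
      have := eventually_vertical (u := 0) (hv.symm ▸ hhH)
      filter_upwards [this.filter_mono nhdsWithin_le_nhds, self_mem_nhdsWithin] with t e1 ht
      have ht : t ≠ 0 := ht
      simp only [hh] at e1
      simp [hτ.map_zero, e1, ht]
    have := cross_map_ne_zero hτ.injective.self_of_nhds (a := !₂[0, 0, 1]) (b := !₂[1, 0, 0]) (by
      intro h; have := (Space.ext_iff'.1 h).2.1; simp at this)
    apply this
    rw [Space.ext_iff']
    simp [hz0, hx0, hz1, hx1]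
  have hH0' : ∀ᶠ q in 𝓝 (0 : Plane), H q ≠ 0 :=
    hHs.self_of_nhds.continuousAt.eventually_ne hH0
  have hKax : ∀ᶠ u in 𝓝 (0 : ℝ), K !₂[u, 0] = 0 := by
    filter_upwards [eventually_axis hKid] with u e1
    simpa using e1
  -- From `K² = v² H³` the quotient `K / H` has square `h` and cube `k`.
  refine ⟨fun q => !₂[U q, K q / H q], ?_, ?_, ?_, ?_⟩
  · filter_upwards [hUs, hKs, hHs, hH0'] with q e1 e2 e3 e4
    exact contDiffAt_plane e1 (e2.div e3 e4)
  · have h1 := hKax.self_of_nhds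
    have hv : (!₂[0, 0] : Plane) = 0 := by ext i; fin_cases i <;> simp
    rw [hv] at h1
    ext i; fin_cases i
    · simp [hU, hg.map_zero, hτ.map_zero]
    · simp [h1]
  · filter_upwards [hid, hhH, hkK, hKid, hH0'] with q e1 e2 e3 e4 e5
    have e6 : (K q / H q) ^ 2 = h q := by
      rw [e2]; field_simp; linear_combination e4
    have e7 : (K q / H q) ^ 3 = k q := by
      rw [e3]; field_simp; linear_combination K q * e4
    ext i; fin_cases i
    · exact e6
    · show U q * (K q / H q) ^ 3 = y q
      rw [e7, e1.2.1]
    · rfl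
  · filter_upwards [hKax] with u e1
    simp [e1]

/-! ### The differential of a local symmetry at the origin. -/

/-- `M` is lower triangular with diagonal `α, β, δ` in the frame `t, b, c`. -/
structure AdaptedFrame (M : Space →L[ℝ] Space) (t b c : Space) (α β δ : ℝ) : Prop where
  map_t : M t = α • t
  map_b : ∃ x : ℝ, M b = β • b + x • t
  map_c : ∃ x y : ℝ, M c = δ • c + x • b + y • t

/-- Strict differentiability allows the difference of two moving points to be much smaller than the
points themselves. -/
theorem hasStrictFDerivAt_lim_smul {F E : Type*} [NormedAddCommGroup F] [NormedSpace ℝ F]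
    [NormedAddCommGroup E] [NormedSpace ℝ E] {f : E → F} {f' : E →L[ℝ] F} {x : E}
    (hf : HasStrictFDerivAt f f' x) {α : Type*} {l : Filter α} {c : α → ℝ} {a b : α → E} {v : E}
    (ha : Tendsto a l (𝓝 x)) (hb : Tendsto b l (𝓝 x))
    (cdlim : Tendsto (fun n => c n • (a n - b n)) l (𝓝 v)) :
    Tendsto (fun n => c n • (f (a n) - f (b n))) l (𝓝 (f' v)) := by
  have h1 := hf.isLittleO.comp_tendsto (ha.prodMk_nhds hb)
  have h2 := ((Asymptotics.isBigO_refl c l).smul_isLittleO h1).trans_isBigO (cdlim.isBigO_one ℝ)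
  rw [Asymptotics.isLittleO_one_iff] at h2
  have h3 := h2.add ((f'.continuous.tendsto v).comp cdlim)
  rw [zero_add] at h3
  refine h3.congr fun n => ?_
  simp [smul_sub]

theorem plane_zero : (!₂[0, 0] : Plane) = 0 := by ext i; fin_cases i <;> simp

theorem tendsto_vertical : Tendsto (fun t : ℝ => (!₂[0, t] : Plane)) (𝓝[≠] 0) (𝓝 0) :=
  ((continuous_vertical 0).tendsto' 0 0 plane_zero).mono_left nhdsWithin_le_nhds

theorem tendsto_coord {n : ℕ} {ι : Type*} {l : Filter ι} {F : ι → EuclideanSpace ℝ (Fin n)}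
    {x : EuclideanSpace ℝ (Fin n)} (h : Tendsto F l (𝓝 x)) (i : Fin n) :
    Tendsto (fun t => F t i) l (𝓝 (x i)) :=
  ((EuclideanSpace.proj i : EuclideanSpace ℝ (Fin n) →L[ℝ] ℝ).continuous.tendsto x).comp h

namespace FrontalModel

variable {g GU E : Plane → Space} {lam : Plane → ℝ} {G : Space → ℝ} {mu : Plane → ℝ}
  {r : WithTop ℕ∞} {τ : Space → Space}

theorem fderiv_zero_apply (hg : FrontalModel g GU E lam G mu) (w : Plane) :
    fderiv ℝ g 0 w = w 0 • GU 0 := by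
  rw [hg.fderiv_apply, hg.lam_zero]; simp

theorem fderiv_comp_lift (hr : r ≠ 0) (hg : FrontalModel g GU E lam G mu)
    (hτ : LocalSymmetry r g τ) {ψ : Plane → Plane} (hψ : ContDiffAt ℝ r ψ 0) (hψ0 : ψ 0 = 0)
    (hlift : ∀ᶠ q in 𝓝 (0 : Plane), g (ψ q) = τ (g q)) (w : Plane) :
    (fderiv ℝ ψ 0 w) 0 • GU 0 = w 0 • fderiv ℝ τ 0 (GU 0) := by
  have h1 : HasFDerivAt (fun q => g (ψ q)) ((fderiv ℝ g 0).comp (fderiv ℝ ψ 0)) 0 := by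
    have : HasFDerivAt g (fderiv ℝ g 0) (ψ 0) := by
      rw [hψ0]; exact (hg.differentiable 0).hasFDerivAt
    exact this.comp 0 (hψ.differentiableAt hr).hasFDerivAt
  have h2 : HasFDerivAt (fun q => τ (g q)) ((fderiv ℝ τ 0).comp (fderiv ℝ g 0)) 0 := by
    have : HasFDerivAt τ (fderiv ℝ τ 0) (g 0) := by
      rw [hg.map_zero]; exact (hτ.contDiffAt.self_of_nhds.differentiableAt hr).hasFDerivAt
    exact this.comp 0 (hg.differentiable 0).hasFDerivAt
  have h3 := DFunLike.congr_fun (h1.unique (h2.congr_of_eventuallyEq hlift)) w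
  simp only [ContinuousLinearMap.comp_apply, hg.fderiv_zero_apply, map_smul] at h3
  exact h3

theorem GU_ne_zero (hg : FrontalModel g GU E lam G mu) : GU 0 ≠ 0 := by
  intro h
  apply hg.cross_ne_zero 0
  rw [h]
  ext i; fin_cases i <;> simp [cross]

/-- At the origin `dg` has rank one with image spanned by `GU 0`. Differentiating `g ∘ ψ = τ ∘ g`
therefore yields the entry `α`, and `dψ(0)` preserves the null direction. -/
theorem fderiv_tangent (hr : r ≠ 0) (hg : FrontalModel g GU E lam G mu)
    (hτ : LocalSymmetry r g τ) {ψ : Plane → Plane} (hψ : ContDiffAt ℝ r ψ 0) (hψ0 : ψ 0 = 0)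
    (hlift : ∀ᶠ q in 𝓝 (0 : Plane), g (ψ q) = τ (g q)) :
    fderiv ℝ τ 0 (GU 0) = (fderiv ℝ ψ 0 !₂[1, 0] 0) • GU 0 ∧ fderiv ℝ ψ 0 !₂[0, 1] 0 = 0 := by
  have h := hg.fderiv_comp_lift hr hτ hψ hψ0 hlift
  constructor
  · rw [h]; simp
  · have := h !₂[0, 1]
    simp [hg.GU_ne_zero] at this
    exact this

theorem tendsto_image_vertical (hg : FrontalModel g GU E lam G mu) :
    Tendsto (fun t : ℝ => g !₂[0, t]) (𝓝[≠] 0) (𝓝 0) := hg.tendsto_zero.comp tendsto_vertical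

theorem hasFDerivAt_symmetry (hr : r ≠ 0) (hτ : LocalSymmetry r g τ) :
    HasFDerivAt τ (fderiv ℝ τ 0) 0 :=
  (hτ.contDiffAt.self_of_nhds.differentiableAt hr).hasFDerivAt

theorem tendsto_symmetry_vertical (hr : r ≠ 0) (hg : FrontalModel g GU E lam G mu)
    (hτ : LocalSymmetry r g τ) {c : ℝ → ℝ} {v : Space}
    (h : Tendsto (fun t : ℝ => c t • g !₂[0, t]) (𝓝[≠] 0) (𝓝 v)) :
    Tendsto (fun t : ℝ => c t • τ (g !₂[0, t])) (𝓝[≠] 0) (𝓝 (fderiv ℝ τ 0 v)) := by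
  simpa [hτ.map_zero] using
    hasFDerivAt_lim_smul (hasFDerivAt_symmetry hr hτ) hg.tendsto_image_vertical h

end FrontalModel

theorem tendsto_inv_smul_lift {r : WithTop ℕ∞} (hr : r ≠ 0) {ψ : Plane → Plane}
    (hψ : ContDiffAt ℝ r ψ 0) (hψ0 : ψ 0 = 0) {c : ℝ → Plane} {w : Plane}
    (hc : Tendsto c (𝓝[≠] 0) (𝓝 0)) (hw : Tendsto (fun t => t⁻¹ • c t) (𝓝[≠] 0) (𝓝 w)) :
    Tendsto (fun t => t⁻¹ • ψ (c t)) (𝓝[≠] 0) (𝓝 (fderiv ℝ ψ 0 w)) := by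
  simpa [hψ0] using hasFDerivAt_lim_smul (hψ.differentiableAt hr).hasFDerivAt hc hw

theorem tendsto_inv_smul_vertical :
    Tendsto (fun t : ℝ => t⁻¹ • (!₂[0, t] : Plane)) (𝓝[≠] 0) (𝓝 !₂[0, 1]) := by
  refine tendsto_const_nhds.congr' ?_
  filter_upwards [self_mem_nhdsWithin] with t ht
  have ht : t ≠ 0 := ht
  ext i; fin_cases i <;> simp [ht]

/-- `β` is the limit of `v'² / t²` along `t ↦ (0, t)`, hence nonnegative. -/
theorem cuspidalEdge_frame {r : WithTop ℕ∞} (hr : r = ∞ ∨ r = ω) {τ : Space → Space}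
    (hτ : LocalSymmetry r stdCuspidalEdge τ) {ψ : Plane → Plane} (hψ : ContDiffAt ℝ r ψ 0)
    (hψ0 : ψ 0 = 0)
    (hlift : ∀ᶠ q in 𝓝 (0 : Plane), stdCuspidalEdge (ψ q) = τ (stdCuspidalEdge q)) :
    ∃ α β δ, AdaptedFrame (fderiv ℝ τ 0) !₂[0, 0, 1] !₂[1, 0, 0] !₂[0, 1, 0] α β δ ∧ 0 ≤ β := by
  have hr0 := ne_zero_of_eq_infty_or_omega hr
  have hg := frontalModel_cuspidalEdge
  obtain ⟨ht, -⟩ := hg.fderiv_tangent hr0 hτ hψ hψ0 hlift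
  obtain ⟨-, hx1⟩ := hg.inner_cross_fderiv_eq_zero hr hτ
  have hxv : (!₂[(2 : ℝ), 3 * (0 : Plane) 1, 0] : Space) = (2 : ℝ) • !₂[1, 0, 0] := by
    ext i; fin_cases i <;> simp
  have hcr : cross (!₂[0, 0, 1] : Space) ((2 : ℝ) • !₂[1, 0, 0]) = !₂[0, 2, 0] := by
    ext i; fin_cases i <;> simp
  rw [hxv, hcr, Space.inner_eq] at hx1
  simp at hx1
  refine ⟨_, fderiv ℝ τ 0 !₂[1, 0, 0] 0, fderiv ℝ τ 0 !₂[0, 1, 0] 1, ⟨ht,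
    ⟨fderiv ℝ τ 0 !₂[1, 0, 0] 2, ?_⟩,
    ⟨fderiv ℝ τ 0 !₂[0, 1, 0] 0, fderiv ℝ τ 0 !₂[0, 1, 0] 2, ?_⟩⟩, ?_⟩
  · ext i; fin_cases i <;> simp [hx1]
  · ext i; fin_cases i <;> simp
  · have t2 : Tendsto (fun t : ℝ => (t ^ 2)⁻¹ • stdCuspidalEdge !₂[0, t]) (𝓝[≠] 0)
        (𝓝 !₂[1, 0, 0]) := by
      have : Tendsto (fun t : ℝ => (!₂[1, t, 0] : Space)) (𝓝[≠] 0) (𝓝 !₂[1, 0, 0]) :=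
        ((by fun_prop : Continuous fun t : ℝ => (!₂[1, t, 0] : Space)).tendsto' 0 _ rfl).mono_left
          nhdsWithin_le_nhds
      refine this.congr' ?_
      filter_upwards [self_mem_nhdsWithin] with t ht
      have ht : t ≠ 0 := ht
      ext i; fin_cases i <;> simp [stdCuspidalEdge]
      · field_simp
      · field_simp
    refine ge_of_tendsto (tendsto_coord (hg.tendsto_symmetry_vertical hr0 hτ t2) 0) ?_
    filter_upwards [tendsto_vertical.eventually hlift] with t ht
    rw [← ht]
    simp [stdCuspidalEdge]
    positivity

theorem cuspidalCrossCap_frame {r : WithTop ℕ∞} (hr : r = ∞ ∨ r = ω) {τ : Space → Space}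
    (hτ : LocalSymmetry r stdCuspidalCrossCap τ) {ψ : Plane → Plane} (hψ : ContDiffAt ℝ r ψ 0)
    (hψ0 : ψ 0 = 0)
    (hlift : ∀ᶠ q in 𝓝 (0 : Plane), stdCuspidalCrossCap (ψ q) = τ (stdCuspidalCrossCap q))
    (hax : ∀ᶠ u in 𝓝 (0 : ℝ), ψ !₂[u, 0] 1 = 0) :
    ∃ α β δ ρ, AdaptedFrame (fderiv ℝ τ 0) !₂[0, 0, 1] !₂[1, 0, 0] !₂[0, 1, 0] α β δ ∧
      β = ρ ^ 2 ∧ δ = α * ρ ^ 3 ∧ fderiv ℝ ψ 0 !₂[0, 1] = ρ • !₂[0, 1] := by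
  have hr0 := ne_zero_of_eq_infty_or_omega hr
  have hg := frontalModel_cuspidalCrossCap
  obtain ⟨ht, hρ0⟩ := hg.fderiv_tangent hr0 hτ hψ hψ0 hlift
  obtain ⟨-, hx1⟩ := hg.inner_cross_fderiv_eq_zero hr hτ
  have hzv : (!₂[(0 : ℝ), (0 : Plane) 1 ^ 3, 1] : Space) = !₂[0, 0, 1] := by
    ext i; fin_cases i <;> simp
  have hxv : (!₂[(2 : ℝ), 3 * (0 : Plane) 0 * (0 : Plane) 1, 0] : Space) =
      (2 : ℝ) • !₂[1, 0, 0] := by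
    ext i; fin_cases i <;> simp
  have hcr : cross (!₂[0, 0, 1] : Space) ((2 : ℝ) • !₂[1, 0, 0]) = !₂[0, 2, 0] := by
    ext i; fin_cases i <;> simp
  rw [hxv, hzv, hcr, Space.inner_eq] at hx1
  rw [hzv] at ht
  simp at hx1
  set P := fderiv ℝ ψ 0 with hP
  set ρ := P !₂[0, 1] 1 with hρ
  have hP01 : P !₂[1, 0] 1 = 0 := by
    have d1 : HasDerivAt (fun u : ℝ => (!₂[u, 0] : Plane)) !₂[1, 0] 0 := by
      refine hasDerivAt_of_coord fun i => ?_
      fin_cases i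
      · exact hasDerivAt_id _
      · exact hasDerivAt_const _ _
    have d2 : HasFDerivAt ψ P !₂[(0 : ℝ), 0] := by
      rw [plane_zero]; exact (hψ.differentiableAt hr0).hasFDerivAt
    exact (hasDerivAt_coord (d2.comp_hasDerivAt 0 d1) 1).unique
      ((hasDerivAt_const (0 : ℝ) (0 : ℝ)).congr_of_eventuallyEq hax)
  refine ⟨_, fderiv ℝ τ 0 !₂[1, 0, 0] 0, fderiv ℝ τ 0 !₂[0, 1, 0] 1, ρ, ⟨ht,
    ⟨fderiv ℝ τ 0 !₂[1, 0, 0] 2, ?_⟩,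
    ⟨fderiv ℝ τ 0 !₂[0, 1, 0] 0, fderiv ℝ τ 0 !₂[0, 1, 0] 2, ?_⟩⟩, ?_, ?_, ?_⟩
  · ext i; fin_cases i <;> simp [hx1]
  · ext i; fin_cases i <;> simp
  · have t2 : Tendsto (fun t : ℝ => (t ^ 2)⁻¹ • stdCuspidalCrossCap !₂[0, t]) (𝓝[≠] 0)
        (𝓝 !₂[1, 0, 0]) := by
      refine tendsto_const_nhds.congr' ?_
      filter_upwards [self_mem_nhdsWithin] with t ht
      have ht : t ≠ 0 := ht
      ext i; fin_cases i <;> simp [stdCuspidalCrossCap, ht]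
    have t3 := tendsto_coord (hg.tendsto_symmetry_vertical hr0 hτ t2) 0
    have t4 := (tendsto_coord (tendsto_inv_smul_lift hr0 hψ hψ0 tendsto_vertical
      tendsto_inv_smul_vertical) 1).pow 2
    refine tendsto_nhds_unique t3 (t4.congr' ?_)
    filter_upwards [tendsto_vertical.eventually hlift, self_mem_nhdsWithin] with t ht ht0
    have ht0 : t ≠ 0 := ht0
    rw [← ht]
    simp [stdCuspidalCrossCap]
    field_simp
  · have hcont : ∀ σ : ℝ, Tendsto (fun s : ℝ => (!₂[s, σ * s] : Plane)) (𝓝[≠] 0) (𝓝 0) := fun σ =>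
      ((by fun_prop : Continuous fun s : ℝ => (!₂[s, σ * s] : Plane)).tendsto' 0 0
        (by simp [plane_zero])).mono_left nhdsWithin_le_nhds
    have hslope : ∀ σ : ℝ, Tendsto (fun s : ℝ => s⁻¹ • (!₂[s, σ * s] : Plane)) (𝓝[≠] 0)
        (𝓝 (!₂[1, 0] + σ • !₂[0, 1])) := fun σ => by
      refine tendsto_const_nhds.congr' ?_
      filter_upwards [self_mem_nhdsWithin] with t ht
      have ht : t ≠ 0 := ht
      ext i; fin_cases i
      · simp [ht]
      · simp; field_simp
    have hlim : ∀ σ : ℝ, Tendsto (fun s => (s ^ 4)⁻¹ * (ψ !₂[s, σ * s] 0 * ψ !₂[s, σ * s] 1 ^ 3))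
        (𝓝[≠] 0) (𝓝 (P !₂[1, 0] 0 * (σ * ρ) ^ 3)) := by
      intro σ
      have t1 := tendsto_inv_smul_lift hr0 hψ hψ0 (hcont σ) (hslope σ)
      have t2 := (tendsto_coord t1 0).mul ((tendsto_coord t1 1).pow 3)
      simp only [map_add, map_smul, PiLp.add_apply, PiLp.smul_apply, smul_eq_mul, ← hP, hρ0, hP01,
        mul_zero, add_zero, zero_add, ← hρ] at t2
      refine t2.congr' ?_
      filter_upwards [self_mem_nhdsWithin] with t ht
      have ht : t ≠ 0 := ht
      field_simp
    have himg : ∀ σ : ℝ, Tendsto (fun s : ℝ => stdCuspidalCrossCap !₂[s, σ * s]) (𝓝[≠] 0) (𝓝 0) :=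
      fun σ => hg.tendsto_zero.comp (hcont σ)
    -- The images of `(s, s)` and `(s, -s)` differ by exactly `(0, 2s⁴, 0)`, which isolates `δ`. On
    -- the other side, the difference of `u'v'³` is asymptotic to `2αρ³s⁴`.
    have t3 := tendsto_coord (hasStrictFDerivAt_lim_smul (v := (2 : ℝ) • !₂[0, 1, 0])
      (c := fun s => (s ^ 4)⁻¹)
      (hτ.contDiffAt.self_of_nhds.hasStrictFDerivAt hr0) (himg 1) (himg (-1)) (by
        refine tendsto_const_nhds.congr' ?_
        filter_upwards [self_mem_nhdsWithin] with t ht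
        have ht : t ≠ 0 := ht
        ext i; fin_cases i
        · simp [stdCuspidalCrossCap]
        · simp [stdCuspidalCrossCap]; field_simp; norm_num
        · simp [stdCuspidalCrossCap])) 1
    have t4 := (hlim 1).sub (hlim (-1))
    have := tendsto_nhds_unique t3 (t4.congr' (by
      filter_upwards [(hcont 1).eventually hlift, (hcont (-1)).eventually hlift] with t h1 h2
      rw [← h1, ← h2]
      simp [stdCuspidalCrossCap]; ring))
    simp at this
    linarith
  · ext i; fin_cases i
    · simpa using hρ0
    · simp [hρ]

theorem swallowtail_frame {r : WithTop ℕ∞} (hr : r = ∞ ∨ r = ω) {τ : Space → Space}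
    (hτ : LocalSymmetry r stdSwallowtail τ) {ψ : Plane → Plane} (hψ : ContDiffAt ℝ r ψ 0)
    (hψ0 : ψ 0 = 0)
    (hlift : ∀ᶠ q in 𝓝 (0 : Plane), stdSwallowtail (ψ q) = τ (stdSwallowtail q))
    (htan : ∀ᶠ q in 𝓝 (0 : Plane),
        inner ℝ (!₂[-1, ψ q 1, -ψ q 1 ^ 2] : Space)
          (fderiv ℝ τ (stdSwallowtail q) !₂[q 1 ^ 2, 2 * q 1, 1]) = 0 ∧
        inner ℝ (!₂[-1, ψ q 1, -ψ q 1 ^ 2] : Space)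
          (fderiv ℝ τ (stdSwallowtail q) !₂[q 1, 1, 0]) = 0) :
    ∃ α β δ ρ, AdaptedFrame (fderiv ℝ τ 0) !₂[0, 0, 1] !₂[0, 1, 0] !₂[1, 0, 0] α β δ ∧
      β = ρ ^ 3 ∧ δ = ρ * β ∧ ρ ^ 2 * α = δ ∧ fderiv ℝ ψ 0 !₂[0, 1] = ρ • !₂[0, 1] := by
  have hr0 := ne_zero_of_eq_infty_or_omega hr
  have hg := frontalModel_swallowtail
  obtain ⟨ht, hρ0⟩ := hg.fderiv_tangent hr0 hτ hψ hψ0 hlift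
  obtain ⟨-, hx1⟩ := hg.inner_cross_fderiv_eq_zero hr hτ
  have hzv : (!₂[(0 : Plane) 1 ^ 2, 2 * (0 : Plane) 1, 1] : Space) = !₂[0, 0, 1] := by
    ext i; fin_cases i <;> simp
  have hxv : (!₂[(0 : Plane) 1, 1, 0] : Space) = !₂[0, 1, 0] := by
    ext i; fin_cases i <;> simp
  have hcr : cross (!₂[0, 0, 1] : Space) !₂[0, 1, 0] = !₂[-1, 0, 0] := by
    ext i; fin_cases i <;> simp
  rw [hxv, hzv, hcr, Space.inner_eq] at hx1
  rw [hzv] at ht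
  simp at hx1
  set P := fderiv ℝ ψ 0 with hP
  set M := fderiv ℝ τ 0 with hM
  set ρ := P !₂[0, 1] 1 with hρ
  set α := P !₂[1, 0] 0 with hα
  have hzx := Space.ext_iff'.1 ht
  simp at hzx
  have hv1 : Tendsto (fun t : ℝ => t⁻¹ * ψ !₂[0, t] 1) (𝓝[≠] 0) (𝓝 ρ) :=
    tendsto_coord (tendsto_inv_smul_lift hr0 hψ hψ0 tendsto_vertical tendsto_inv_smul_vertical) 1
  have hv0 : Tendsto (fun t : ℝ => ψ !₂[0, t] 1) (𝓝[≠] 0) (𝓝 0) := by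
    have := hψ.continuousAt.tendsto
    rw [hψ0] at this
    exact tendsto_coord (this.comp tendsto_vertical) 1
  -- Compare the second coordinates at order `t³`: the term `2u'v'` drops out because `u' / t³`
  -- converges and `v'` tends to `0`.
  have hβ : M !₂[0, 1, 0] 1 = ρ ^ 3 := by
    have t2 : Tendsto (fun t : ℝ => (t ^ 3)⁻¹ • stdSwallowtail !₂[0, t]) (𝓝[≠] 0)
        (𝓝 ((4 : ℝ) • !₂[0, 1, 0])) := by
      have : Tendsto (fun t : ℝ => (!₂[3 * t, 4, 0] : Space)) (𝓝[≠] 0) (𝓝 ((4 : ℝ) • !₂[0, 1, 0])) :=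
        ((by fun_prop : Continuous fun t : ℝ => (!₂[3 * t, 4, 0] : Space)).tendsto' 0 _
          (by ext i; fin_cases i <;> simp)).mono_left nhdsWithin_le_nhds
      refine this.congr' ?_
      filter_upwards [self_mem_nhdsWithin] with t ht
      have ht : t ≠ 0 := ht
      ext i; fin_cases i <;> simp [stdSwallowtail]
      · field_simp
      · field_simp
    have t3 := hg.tendsto_symmetry_vertical hr0 hτ t2
    have t4 := ((hv1.pow 3).const_mul 4).add (((tendsto_coord t3 2).mul hv0).const_mul 2)
    have := tendsto_nhds_unique (tendsto_coord t3 1) (t4.congr' (by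
      filter_upwards [tendsto_vertical.eventually hlift, self_mem_nhdsWithin] with t ht ht0
      have ht0 : t ≠ 0 := ht0
      rw [← ht]
      simp [stdSwallowtail]; field_simp))
    simp at this
    linarith
  have hτ' : DifferentiableAt ℝ (fderiv ℝ τ) 0 :=
    (hτ.contDiffAt.self_of_nhds.fderiv_right (add_one_le_of_eq_infty_or_omega hr)).differentiableAt
      hr0
  -- This is the `t`-derivative at `0` of the tangency equation for `E`; `dτ ∘ g` is stationary
  -- there.
  have hδ : M !₂[1, 0, 0] 0 = ρ * M !₂[0, 1, 0] 1 := by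
    have hg0 : stdSwallowtail !₂[0, 0] = 0 := by rw [plane_zero]; exact hg.map_zero
    have d1 : HasDerivAt (fun t : ℝ => stdSwallowtail !₂[0, t]) 0 0 := by
      have := (hg.differentiable !₂[0, 0]).hasFDerivAt.comp_hasDerivAt 0 (hasDerivAt_vertical 0 0)
      rw [plane_zero, hg.fderiv_zero_apply] at this
      exact this.congr_deriv (by simp)
    have d2 : HasDerivAt (fun t : ℝ => fderiv ℝ τ (stdSwallowtail !₂[0, t])) 0 0 := by
      have h := hτ'
      rw [← hg0] at h
      have := h.hasFDerivAt.comp_hasDerivAt 0 d1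
      rwa [_root_.map_zero] at this
    have d3 : HasDerivAt (fun t : ℝ => (!₂[t, 1, 0] : Space)) !₂[1, 0, 0] 0 := by
      refine hasDerivAt_of_coord fun i => ?_
      fin_cases i
      · exact hasDerivAt_id _
      · exact hasDerivAt_const _ _
      · exact hasDerivAt_const _ _
    have d4 : HasDerivAt (fun t : ℝ => fderiv ℝ τ (stdSwallowtail !₂[0, t]) !₂[t, 1, 0])
        (M !₂[1, 0, 0]) 0 := by
      refine (d2.clm_apply d3).congr_deriv ?_
      simp [hg0, hM]
    have d5 : HasDerivAt (fun t : ℝ => ψ !₂[0, t] 1) ρ 0 := by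
      have h : HasFDerivAt ψ P !₂[0, 0] := by
        rw [plane_zero]; exact (hψ.differentiableAt hr0).hasFDerivAt
      exact hasDerivAt_coord (h.comp_hasDerivAt 0 (hasDerivAt_vertical 0 0)) 1
    have d6 := fun i => hasDerivAt_coord d4 i
    have d7 := (((d6 0).neg.add (d5.mul (d6 1))).sub ((d5.pow 2).mul (d6 2))).unique
      ((hasDerivAt_const (0 : ℝ) (0 : ℝ)).congr_of_eventuallyEq (by
        have hv := eventually_vertical (u := 0) (plane_zero.symm ▸ htan)
        filter_upwards [hv] with t ht
        have := ht.2
        rw [Space.inner_eq] at this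
        simp at this
        simp
        linarith))
    simp [hg.map_zero, plane_zero, hψ0, ← hM] at d7
    linarith
  refine ⟨α, M !₂[0, 1, 0] 1, M !₂[1, 0, 0] 0, ρ, ⟨ht,
    ⟨M !₂[0, 1, 0] 2, ?_⟩,
    ⟨M !₂[1, 0, 0] 1, M !₂[1, 0, 0] 2, ?_⟩⟩, hβ, hδ, ?_, ?_⟩
  · ext i; fin_cases i <;> simp [hx1]
  · ext i; fin_cases i <;> simp
  · have t1 : Tendsto (fun t : ℝ => (t ^ 2)⁻¹ • stdSwallowtail !₂[0, t]) (𝓝[≠] 0) (𝓝 0) := by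
      have : Tendsto (fun t : ℝ => (!₂[3 * t ^ 2, 4 * t, 0] : Space)) (𝓝[≠] 0) (𝓝 0) :=
        ((by fun_prop : Continuous fun t : ℝ => (!₂[3 * t ^ 2, 4 * t, 0] : Space)).tendsto' 0 _
          (by ext i; fin_cases i <;> simp)).mono_left nhdsWithin_le_nhds
      refine this.congr' ?_
      filter_upwards [self_mem_nhdsWithin] with t ht
      have ht : t ≠ 0 := ht
      ext i; fin_cases i <;> simp [stdSwallowtail]
      · field_simp
      · field_simp
    have t2 := hasFDerivAt_lim_smul hτ'.hasFDerivAt hg.tendsto_image_vertical t1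
    rw [_root_.map_zero] at t2
    set X : ℝ → Space := fun t => fderiv ℝ τ (stdSwallowtail !₂[0, t]) !₂[t ^ 2, 2 * t, 1]
    have t3 : Tendsto (fun t : ℝ => (!₂[t ^ 2, 2 * t, 1] : Space)) (𝓝[≠] 0) (𝓝 !₂[0, 0, 1]) :=
      ((by fun_prop : Continuous fun t : ℝ => (!₂[t ^ 2, 2 * t, 1] : Space)).tendsto' 0 _
        (by simp)).mono_left nhdsWithin_le_nhds
    have t4 : Tendsto (fun t : ℝ => (t ^ 2)⁻¹ • (X t - M !₂[t ^ 2, 2 * t, 1])) (𝓝[≠] 0) (𝓝 0) := by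
      have := (isBoundedBilinearMap_apply.continuous.tendsto _).comp (t2.prodMk_nhds t3)
      rw [zero_apply] at this
      exact this
    have hMt : ∀ t : ℝ, M !₂[t ^ 2, 2 * t, 1] =
        t ^ 2 • M !₂[1, 0, 0] + (2 * t) • M !₂[0, 1, 0] + α • !₂[0, 0, 1] := by
      intro t
      rw [← ht, ← map_smul, ← map_smul, ← map_add, ← map_add]
      congr 1
      ext i; fin_cases i <;> simp
    have hid : Tendsto (fun t : ℝ => t) (𝓝[≠] 0) (𝓝 0) := nhdsWithin_le_nhds
    have hX0 : Tendsto (fun t => (t ^ 2)⁻¹ * X t 0) (𝓝[≠] 0) (𝓝 (M !₂[1, 0, 0] 0)) := by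
      have := (tendsto_coord t4 0).add_const (M !₂[1, 0, 0] 0)
      rw [PiLp.zero_apply, zero_add] at this
      refine this.congr' ?_
      filter_upwards [self_mem_nhdsWithin] with t ht
      have ht : t ≠ 0 := ht
      simp [hMt, hx1]; field_simp; ring
    have hX1 : Tendsto (fun t => t⁻¹ * X t 1) (𝓝[≠] 0) (𝓝 (2 * M !₂[0, 1, 0] 1)) := by
      have := (hid.mul ((tendsto_coord t4 1).add_const (M !₂[1, 0, 0] 1))).add_const
        (2 * M !₂[0, 1, 0] 1)
      rw [zero_mul, zero_add] at this
      refine this.congr' ?_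
      filter_upwards [self_mem_nhdsWithin] with t ht
      have ht : t ≠ 0 := ht
      simp [hMt]; field_simp; ring
    have hX2 : Tendsto (fun t => X t 2) (𝓝[≠] 0) (𝓝 α) := by
      have := (((hid.pow 2).mul ((tendsto_coord t4 2).add_const (M !₂[1, 0, 0] 2))).add
        ((hid.const_mul 2).mul_const (M !₂[0, 1, 0] 2))).add_const α
      simp only [zero_pow two_ne_zero, zero_mul, zero_add, mul_zero] at this
      refine this.congr' ?_
      filter_upwards [self_mem_nhdsWithin] with t ht
      have ht : t ≠ 0 := ht
      simp [hMt]; field_simp; ring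
    -- Dividing the tangency equation for `GU` by `t²` gives `-δ + 2ρβ - ρ²α = 0` in the limit.
    have hsum := (hX0.neg.add (hv1.mul hX1)).sub ((hv1.pow 2).mul hX2)
    have := tendsto_nhds_unique hsum ((tendsto_const_nhds (x := (0 : ℝ))).congr' (by
      filter_upwards [tendsto_vertical.eventually htan, self_mem_nhdsWithin] with t ht ht0
      have ht0 : t ≠ 0 := ht0
      have h1 : inner ℝ (!₂[-1, ψ !₂[0, t] 1, -ψ !₂[0, t] 1 ^ 2] : Space) (X t) = 0 := ht.1
      rw [Space.inner_eq] at h1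
      generalize X t = Y at h1 ⊢
      simp at h1
      field_simp
      linarith))
    rw [hδ] at this ⊢
    linarith
  · ext i; fin_cases i
    · simpa using hρ0
    · simp [hρ]

/-! ### Action of the lift on the double curve and on the singular set. -/

/-- An increasing `C^1`-involution germ of the line fixing the origin is the identity. -/
theorem eventually_eq_self_of_involutive {φ : ℝ → ℝ} {c : ℝ} (hc : 0 < c)
    (hd : HasStrictDerivAt φ c 0) (h0 : φ 0 = 0) (hinv : ∀ᶠ t in 𝓝 0, φ (φ t) = t) :
    ∀ᶠ t in 𝓝 0, φ t = t := by
  -- Applied to the points `φ t` and `t`, strict differentiability bounds `(1 + c) |φ t - t|` by `(c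
  -- / 2) |φ t - t|`.
  have h1 := (hd.isLittleO.def (half_pos hc))
  have ht : Tendsto (fun t => (φ t, t)) (𝓝 0) (𝓝 ((0 : ℝ), (0 : ℝ))) := by
    have := hd.hasDerivAt.continuousAt.tendsto
    rw [h0] at this
    exact this.prodMk_nhds tendsto_id
  filter_upwards [ht.eventually h1, hinv] with t h2 h3
  simp only [h3, smul_eq_mul, Real.norm_eq_abs, ContinuousLinearMap.toSpanSingleton_apply] at h2
  have h4 : t - φ t - (φ t - t) * c = (1 + c) * (t - φ t) := by ring
  rw [h4, abs_mul, abs_of_pos (by linarith), abs_sub_comm t] at h2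
  have h5 : |φ t - t| = 0 := by
    have := abs_nonneg (φ t - t)
    nlinarith
  exact sub_eq_zero.1 (abs_eq_zero.1 h5)

/-- Along the double curve `u = -c v²` the lift of an involution is `v ↦ v` or `v ↦ -v`. -/
theorem lift_double_curve {g : Plane → Space} {τ : Space → Space} {c : ℝ}
    (hdouble : ∀ q q', q' ≠ q → g q' = g q → q 0 = -c * q 1 ^ 2)
    (hsym : ∀ v : ℝ, g !₂[-c * v ^ 2, -v] = g !₂[-c * v ^ 2, v])
    (hsq : ∀ v w : ℝ, g !₂[-c * v ^ 2, v] = g !₂[-c * w ^ 2, w] → v ^ 2 = w ^ 2)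
    {r : WithTop ℕ∞} (hr : r ≠ 0)
    {ψ : Plane → Plane} (hψ : ContDiffAt ℝ r ψ 0) (hψ0 : ψ 0 = 0)
    (hlift : ∀ᶠ q in 𝓝 (0 : Plane), g (ψ q) = τ (g q))
    (hinv : ∀ᶠ q in 𝓝 (0 : Plane), ψ (ψ q) = q) {ρ : ℝ} (hρ : ρ ≠ 0)
    (hd : fderiv ℝ ψ 0 !₂[0, 1] = ρ • !₂[0, 1]) :
    ∀ᶠ v in 𝓝 (0 : ℝ), ψ !₂[-c * v ^ 2, v] =
      !₂[-c * v ^ 2, if 0 < ρ then v else -v] := by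
  set d : ℝ → Plane := fun v => !₂[-c * v ^ 2, v] with hddef
  have hd0 : d 0 = 0 := by simp [hddef, plane_zero]
  have hdd : HasStrictDerivAt d !₂[0, 1] 0 := by
    have : ContDiff ℝ ω d := by
      rw [contDiff_euclidean]
      intro i; fin_cases i <;> simp [hddef] <;> fun_prop
    have h1 : HasDerivAt d !₂[0, 1] 0 := by
      refine hasDerivAt_of_coord fun i => ?_
      fin_cases i
      · refine (((hasDerivAt_id (0 : ℝ)).pow 2).const_mul (-c)).congr_deriv ?_
        simp
      · exact hasDerivAt_id _
    have h2 := this.contDiffAt.hasStrictDerivAt (x := 0) (by simp)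
    rwa [h1.deriv] at h2
  have hdt : Tendsto d (𝓝 0) (𝓝 0) := by
    have := hdd.hasDerivAt.continuousAt.tendsto
    rwa [hd0] at this
  have hdm : Tendsto (fun v => d (-v)) (𝓝 0) (𝓝 0) := by
    refine hdt.comp (continuous_neg.tendsto' 0 0 neg_zero)
  set φ : ℝ → ℝ := fun v => ψ (d v) 1 with hφ
  have hφd : HasStrictDerivAt φ ρ 0 := by
    have h1 : HasStrictFDerivAt ψ (fderiv ℝ ψ 0) (d 0) := by
      rw [hd0]; exact hψ.hasStrictFDerivAt hr
    have h2 := (EuclideanSpace.proj (1 : Fin 2) : Plane →L[ℝ] ℝ).hasStrictFDerivAt.comp_hasStrictDerivAt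
      0 (h1.comp_hasStrictDerivAt 0 hdd)
    rw [hd] at h2
    have h3 : (EuclideanSpace.proj (1 : Fin 2) : Plane →L[ℝ] ℝ) (ρ • !₂[0, 1]) = ρ := by simp
    rw [h3] at h2
    exact h2
  have hφ0 : φ 0 = 0 := by simp [hφ, hd0, hψ0]
  have hψt : Tendsto ψ (𝓝 0) (𝓝 0) := by
    have := hψ.continuousAt.tendsto
    rwa [hψ0] at this
  -- the double curve is preserved
  have hcurve : ∀ᶠ v in 𝓝 (0 : ℝ), ψ (d v) = d (φ v) ∧ φ (-v) ^ 2 = φ v ^ 2 ∧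
      (φ (-v) = φ v → v = 0) := by
    filter_upwards [hdt.eventually hlift, hdm.eventually hlift, hdt.eventually hinv,
      hdm.eventually hinv] with v h1 h2 h3 h4
    have hg : g (ψ (d (-v))) = g (ψ (d v)) := by
      rw [h1, h2]
      congr 1
      simp only [hddef, neg_sq]
      exact hsym v
    by_cases hv : v = 0
    · subst hv
      simp [hφ0, hd0, hψ0]
    -- The involution `ψ` separates the two preimages of a double point. Their lifts have equal
    -- images, so they lie on the double curve again.
    · have hne : ψ (d (-v)) ≠ ψ (d v) := by
        intro h
        have h5 : d (-v) = d v := by rw [← h4, h, h3]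
        have := congrArg (fun q : Plane => q 1) h5
        simp [hddef] at this
        exact hv (by linarith)
      have e1 : ψ (d v) = d (φ v) := by
        have := hdouble _ _ hne hg
        ext i; fin_cases i
        · exact this
        · rfl
      have e2 : ψ (d (-v)) = d (φ (-v)) := by
        have := hdouble _ _ hne.symm hg.symm
        ext i; fin_cases i
        · exact this
        · rfl
      refine ⟨e1, ?_, fun h => ?_⟩
      · rw [e1, e2] at hg
        exact hsq _ _ hg
      · rw [e1, e2, h] at hne
        exact absurd rfl hne
  have hφφ : ∀ᶠ v in 𝓝 (0 : ℝ), φ (φ v) = v := by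
    filter_upwards [hcurve, hdt.eventually hinv] with v h1 h2
    simp only [hφ]
    rw [h1.1] at h2
    show ψ (d (φ v)) 1 = v
    rw [h2]
    simp [hddef]
  have hodd : ∀ᶠ v in 𝓝 (0 : ℝ), φ (-v) = -φ v := by
    filter_upwards [hcurve] with v h1
    rcases sq_eq_sq_iff_eq_or_eq_neg.1 h1.2.1 with h | h
    · have := h1.2.2 h
      subst this
      simp [hφ0]
    · exact h
  by_cases hpos : 0 < ρ
  · filter_upwards [hcurve, eventually_eq_self_of_involutive hpos hφd hφ0 hφφ] with v h1 h2
    rw [if_pos hpos]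
    show ψ (d v) = d v
    rw [h1.1, h2]
  · have hneg : 0 < -ρ := neg_pos.2 (lt_of_le_of_ne (not_lt.1 hpos) hρ)
    have hφt : Tendsto φ (𝓝 0) (𝓝 0) := by
      have := hφd.hasDerivAt.continuousAt.tendsto
      rwa [hφ0] at this
    -- As `φ` is odd, `-φ` is again an involution, now with positive derivative.
    have h3 := eventually_eq_self_of_involutive (φ := fun t => -φ t) hneg hφd.neg (by simp [hφ0]) (by
      filter_upwards [hφφ, hφt.eventually hodd] with v h1 h2
      rw [h2, neg_neg, h1])
    filter_upwards [hcurve, h3] with v h1 h2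
    rw [if_neg hpos]
    show ψ (d v) = _
    have h4 : φ v = -v := by rw [← h2, neg_neg, h2]
    rw [h1.1, h4]
    simp only [hddef, neg_sq]

/-- The lift of an involution preserves the singular set. -/
theorem FrontalModel.lam_lift_eq_zero {g GU E : Plane → Space} {lam : Plane → ℝ} {G : Space → ℝ}
    {mu : Plane → ℝ} {r : WithTop ℕ∞} {τ : Space → Space} (hr : r ≠ 0)
    (hg : FrontalModel g GU E lam G mu) (hτ : LocalSymmetry r g τ) {ψ : Plane → Plane}
    (hψ : ∀ᶠ q in 𝓝 (0 : Plane), ContDiffAt ℝ r ψ q) (hψ0 : ψ 0 = 0)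
    (hlift : ∀ᶠ q in 𝓝 (0 : Plane), g (ψ q) = τ (g q))
    (hinv : ∀ᶠ q in 𝓝 (0 : Plane), ψ (ψ q) = q) :
    ∀ᶠ q in 𝓝 (0 : Plane), lam q = 0 → lam (ψ q) = 0 := by
  have hψt : Tendsto ψ (𝓝 0) (𝓝 0) := by
    have := hψ.self_of_nhds.continuousAt.tendsto
    rwa [hψ0] at this
  filter_upwards [hψ, hψt.eventually hψ, hlift.eventually_nhds, hinv.eventually_nhds,
    hg.tendsto_zero.eventually hτ.contDiffAt] with q h1 h2 h3 h4 h5 hlam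
  by_contra hne
  have d1 := (hg.differentiable (ψ q)).hasFDerivAt.comp q (h1.differentiableAt hr).hasFDerivAt
  have d2 := (h5.differentiableAt hr).hasFDerivAt.comp q (hg.differentiable q).hasFDerivAt
  have d3 := DFunLike.congr_fun (d1.unique (d2.congr_of_eventuallyEq h3)) !₂[0, 1]
  have d4 := (h2.differentiableAt hr).hasFDerivAt.comp q (h1.differentiableAt hr).hasFDerivAt
  have d5 := DFunLike.congr_fun (d4.unique ((hasFDerivAt_id q).congr_of_eventuallyEq h4)) !₂[0, 1]
  simp only [ContinuousLinearMap.comp_apply, hg.fderiv_apply q, hlam] at d3 d5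
  -- If `ψ q` were regular, the null direction at the singular point `q` would be killed by `dψ`,
  -- which is invertible because `ψ` is an involution.
  have d6 : fderiv ℝ ψ q !₂[0, 1] = 0 := by
    apply hg.injective_fderiv hne
    rw [d3]
    simp
  rw [d6, _root_.map_zero] at d5
  have := congrArg (fun q : Plane => q 1) d5
  simp at this

/-- A germ of involution has arbitrarily small connected invariant neighborhoods. -/
theorem exists_invariant_nhds {ψ : Plane → Plane} {p : Plane} {P : Plane → Prop} (hp : ψ p = p)
    (hc : ∀ᶠ q in 𝓝 p, ContinuousAt ψ q) (hinv : ∀ᶠ q in 𝓝 p, ψ (ψ q) = q)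
    (hP : ∀ᶠ q in 𝓝 p, P q) :
    ∃ W, IsOpen W ∧ IsConnected W ∧ p ∈ W ∧ MapsTo ψ W W ∧ ∀ q ∈ W, P q := by
  obtain ⟨R, hR, hRo, hpR⟩ := eventually_nhds_iff.1 ((hc.and hinv).and hP)
  have hcR : ContinuousOn ψ R := fun q hq => (hR q hq).1.1.continuousWithinAt
  have hψR : ∀ᶠ q in 𝓝 p, ψ q ∈ R := by
    have := hc.self_of_nhds.tendsto
    rw [hp] at this
    exact this.eventually (hRo.mem_nhds hpR)
  obtain ⟨ε, hε, hN⟩ := Metric.eventually_nhds_iff_ball.1 ((hRo.eventually_mem hpR).and hψR)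
  set N := Metric.ball p ε
  have hpN : p ∈ N := Metric.mem_ball_self hε
  -- For an involution the image is a preimage, hence open.
  have himg : ψ '' N = R ∩ ψ ⁻¹' N := by
    ext q
    constructor
    · rintro ⟨x, hx, rfl⟩
      exact ⟨(hN x hx).2, by rw [mem_preimage, (hR x (hN x hx).1).1.2]; exact hx⟩
    · rintro ⟨h1, h2⟩
      exact ⟨ψ q, h2, (hR q h1).1.2⟩
  refine ⟨N ∪ ψ '' N, ?_, ?_, Or.inl hpN, ?_, ?_⟩
  · rw [himg]
    exact Metric.isOpen_ball.union (hcR.isOpen_inter_preimage hRo Metric.isOpen_ball)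
  · have h1 : IsPreconnected N := (convex_ball p ε).isPreconnected
    have h2 : IsPreconnected (ψ '' N) := h1.image ψ (hcR.mono fun x hx => (hN x hx).1)
    exact ⟨⟨p, Or.inl hpN⟩, h1.union p hpN ⟨p, hpN, hp⟩ h2⟩
  · rintro q (hq | ⟨x, hx, rfl⟩)
    · exact Or.inr ⟨q, hq, rfl⟩
    · left
      rw [(hR x (hN x hx).1).1.2]
      exact hx
  · rintro q (hq | ⟨x, hx, rfl⟩)
    · exact (hR q (hN q hq).1).2
    · exact (hR _ (hN x hx).2).2

/-! ### Triangular isometries and the corresponding reflections. -/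

/-- `A` is diagonal with eigenvalues `±1` in an orthogonal frame. -/
structure SignFrame (A : Space →ₗᵢ[ℝ] Space) (t b n : Space) (α β δ : ℝ) : Prop where
  t_ne : t ≠ 0
  b_ne : b ≠ 0
  n_ne : n ≠ 0
  inner_tb : inner ℝ t b = 0
  inner_nt : inner ℝ n t = 0
  inner_nb : inner ℝ n b = 0
  map_t : A t = α • t
  map_b : A b = β • b
  map_n : A n = δ • n
  sq_α : α ^ 2 = 1
  sq_β : β ^ 2 = 1
  sq_δ : δ ^ 2 = 1

/-- Otherwise there would be four nonzero pairwise orthogonal vectors in dimension three. -/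
theorem eq_zero_of_inner_eq_zero {a b n w : Space} (ha : a ≠ 0) (hb : b ≠ 0) (hn : n ≠ 0)
    (hab : inner ℝ a b = 0) (hna : inner ℝ n a = 0) (hnb : inner ℝ n b = 0)
    (h1 : inner ℝ w a = 0) (h2 : inner ℝ w b = 0) (h3 : inner ℝ w n = 0) : w = 0 := by
  by_contra hw
  have h := linearIndependent_of_ne_zero_of_inner_eq_zero (𝕜 := ℝ) (v := ![w, a, b, n])
    (by intro i; fin_cases i <;> assumption)
    (by
      intro i j hij
      fin_cases i <;> fin_cases j <;> first | exact absurd rfl hij | skip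
      all_goals first | assumption | (rw [real_inner_comm]; assumption))
  have := h.fintype_card_le_finrank
  simp at this

theorem eq_smul_of_inner_eq_zero {a b n w : Space} (ha : a ≠ 0) (hb : b ≠ 0) (hn : n ≠ 0)
    (hab : inner ℝ a b = 0) (hna : inner ℝ n a = 0) (hnb : inner ℝ n b = 0)
    (h1 : inner ℝ w a = 0) (h2 : inner ℝ w b = 0) :
    w = (inner ℝ w n / inner ℝ n n : ℝ) • n := by
  have hnn : (inner ℝ n n : ℝ) ≠ 0 := inner_self_ne_zero.2 hn
  refine sub_eq_zero.1 (eq_zero_of_inner_eq_zero ha hb hn hab hna hnb ?_ ?_ ?_)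
  · rw [inner_sub_left, inner_smul_left, h1, hna]; simp
  · rw [inner_sub_left, inner_smul_left, h2, hnb]; simp
  · rw [inner_sub_left, inner_smul_left]
    simp only [conj_trivial]
    field_simp
    ring

theorem SignFrame.hom_ext {A : Space →ₗᵢ[ℝ] Space} {t b n : Space} {α β δ : ℝ}
    (h : SignFrame A t b n α β δ) {B C : Space →ₗ[ℝ] Space} (ht : B t = C t) (hb : B b = C b)
    (hn : B n = C n) (w : Space) : B w = C w := by
  have htt : (inner ℝ t t : ℝ) ≠ 0 := inner_self_ne_zero.2 h.t_ne
  have hbb : (inner ℝ b b : ℝ) ≠ 0 := inner_self_ne_zero.2 h.b_ne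
  have hbt : (inner ℝ b t : ℝ) = 0 := by rw [real_inner_comm]; exact h.inner_tb
  have hw := eq_smul_of_inner_eq_zero h.t_ne h.b_ne h.n_ne h.inner_tb h.inner_nt h.inner_nb
    (w := w - (inner ℝ w t / inner ℝ t t : ℝ) • t - (inner ℝ w b / inner ℝ b b : ℝ) • b)
    (by
      simp only [inner_sub_left, inner_smul_left, conj_trivial, hbt]
      field_simp; ring)
    (by
      simp only [inner_sub_left, inner_smul_left, conj_trivial, h.inner_tb]
      field_simp; ring)
  rw [sub_sub, sub_eq_iff_eq_add] at hw
  rw [hw]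
  simp only [map_add, map_smul, ht, hb, hn]

theorem sq_eq_one_of_map_eq_smul {A : Space →ₗᵢ[ℝ] Space} {t : Space} {α : ℝ} (ht : t ≠ 0)
    (h : A t = α • t) : α ^ 2 = 1 := by
  have h1 := A.norm_map t
  rw [h, norm_smul] at h1
  have h2 : ‖α‖ = 1 := by
    have : ‖t‖ ≠ 0 := norm_ne_zero_iff.2 ht
    exact mul_right_cancel₀ this (by rw [h1, one_mul])
  rw [← sq_abs, ← Real.norm_eq_abs, h2, one_pow]

/-- An isometry which is triangular in some frame is diagonal in the orthogonalized frame. -/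
theorem exists_signFrame {A : Space →ₗᵢ[ℝ] Space} {t b c n : Space} {α β δ : ℝ}
    (htb : cross t b ≠ 0) (hspan : ∀ w : Space, inner ℝ w t = 0 → inner ℝ w b = 0 →
      inner ℝ w c = 0 → w = 0) (hn : n ≠ 0) (hnt : inner ℝ n t = 0) (hnb : inner ℝ n b = 0)
    (ht : A t = α • t) (hb : ∃ x : ℝ, A b = β • b + x • t)
    (hc : ∃ x y : ℝ, A c = δ • c + x • b + y • t) :
    ∃ b', SignFrame A t b' n α β δ := by
  have ht0 : t ≠ 0 := by
    rintro rfl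
    apply htb
    ext i; fin_cases i <;> simp [cross]
  have htt : (inner ℝ t t : ℝ) ≠ 0 := inner_self_ne_zero.2 ht0
  obtain ⟨x, hb⟩ := hb
  obtain ⟨y, z, hc⟩ := hc
  set k : ℝ := inner ℝ t b / inner ℝ t t with hk
  set b' := b - k • t with hb'
  have hb'0 : b' ≠ 0 := by
    intro h
    apply htb
    rw [cross_eq_zero_iff_exists]
    exact ⟨-k, 1, Or.inr one_ne_zero, by rw [← h, hb']; module⟩
  have htb' : inner ℝ t b' = 0 := by
    rw [hb', inner_sub_right, inner_smul_right, hk]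
    field_simp; ring
  have hnb' : inner ℝ n b' = 0 := by
    rw [hb', inner_sub_right, inner_smul_right, hnb, hnt]; simp
  have hα := sq_eq_one_of_map_eq_smul ht0 ht
  have hα0 : α ≠ 0 := by rintro rfl; norm_num at hα
  have hAb' : A b' = β • b' := by
    set x' := β * k + x - k * α
    have h1 : A b' = β • b' + x' • t := by
      rw [hb', map_sub, map_smul, hb, ht]; module
    -- Orthogonality of `A t` and `A b'` forces the off-diagonal coefficient `x'` to vanish.
    have h2 : (inner ℝ (A t) (A b') : ℝ) = 0 := by rw [A.inner_map_map, htb']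
    rw [h1, ht, inner_add_right, inner_smul_left, inner_smul_left, inner_smul_right,
      inner_smul_right, htb'] at h2
    have h3 : x' = 0 := by
      simpa [hα0, ht0] using h2
    rw [h1, h3]; simp
  have hβ := sq_eq_one_of_map_eq_smul hb'0 hAb'
  have hβ0 : β ≠ 0 := by rintro rfl; norm_num at hβ
  have hAnt : (inner ℝ (A n) t : ℝ) = 0 := by
    have : (inner ℝ (A n) (A t) : ℝ) = 0 := by rw [A.inner_map_map, hnt]
    rw [ht, inner_smul_right] at this
    exact (mul_eq_zero.1 this).resolve_left hα0
  have hAnb : (inner ℝ (A n) b' : ℝ) = 0 := by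
    have : (inner ℝ (A n) (A b') : ℝ) = 0 := by rw [A.inner_map_map, hnb']
    rw [hAb', inner_smul_right] at this
    exact (mul_eq_zero.1 this).resolve_left hβ0
  have hAn := eq_smul_of_inner_eq_zero ht0 hb'0 hn htb' hnt hnb' hAnt hAnb
  set ε : ℝ := inner ℝ (A n) n / inner ℝ n n
  have hε := sq_eq_one_of_map_eq_smul hn hAn
  have hnc : (inner ℝ n c : ℝ) ≠ 0 := fun h => hn (hspan n hnt hnb h)
  -- Modulo the plane of `t` and `b` the map acts on `c` by `δ` and on `n` by `ε`. Invariance of the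
  -- nonzero number `⟪n, c⟫` gives `εδ = 1`.
  have hδ : δ = ε := by
    have h1 : (inner ℝ (A n) (A c) : ℝ) = inner ℝ n c := A.inner_map_map n c
    rw [hAn, hc, inner_smul_left, inner_add_right, inner_add_right, inner_smul_right,
      inner_smul_right, inner_smul_right, hnt, hnb] at h1
    simp only [conj_trivial, mul_zero, add_zero] at h1
    have h2 : ε * δ = 1 := mul_right_cancel₀ hnc (by linarith)
    linear_combination ε * h2 - δ * hε
  rw [← hδ] at hAn hε
  exact ⟨b', ht0, hb'0, hn, htb', hnt, hnb', ht, hAb', hAn, hα, hβ, hε⟩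

theorem isReflectionIn_mk'_iff {T : Space ≃ᵢ Space} {y : Space} {K : Submodule ℝ Space} :
    IsReflectionIn T (AffineSubspace.mk' y K) ↔ ∀ x, T x = K.reflection (x - y) + y := by
  have hy : y ∈ AffineSubspace.mk' y K := AffineSubspace.self_mem_mk' y K
  have key : ∀ (_ : Nonempty (AffineSubspace.mk' y K)) (x : Space),
      EuclideanGeometry.reflection (AffineSubspace.mk' y K) x = K.reflection (x - y) + y := by
    intro _ x
    rw [EuclideanGeometry.reflection_apply_of_mem _ x hy]
    simp only [vsub_eq_sub, vadd_eq_add]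
    congr 2
    congr 1
    all_goals simp [AffineSubspace.direction_mk']
  constructor
  · rintro ⟨h1, h2⟩ x
    rw [h2 x, key h1]
  · intro h
    exact ⟨⟨⟨y, hy⟩⟩, fun x => by rw [h x, key]⟩

/-- The isometry `T` fixing `y` has the linear part `A`. -/
def HasLinearPart (T : Space ≃ᵢ Space) (y : Space) (A : Space →ₗᵢ[ℝ] Space) : Prop :=
  ∀ x, T x = A (x - y) + y

/-- By the Mazur–Ulam theorem a surjective isometry is affine. -/
theorem exists_hasLinearPart (T : Space ≃ᵢ Space) {y : Space} (h : T y = y) :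
    ∃ A, HasLinearPart T y A := by
  refine ⟨T.toRealAffineIsometryEquiv.linearIsometryEquiv.toLinearIsometry, fun x => ?_⟩
  have h1 := T.toRealAffineIsometryEquiv.map_vadd y (x - y)
  simp only [vadd_eq_add, sub_add_cancel, IsometryEquiv.coeFn_toRealAffineIsometryEquiv, h] at h1
  exact h1

namespace HasLinearPart

variable {T : Space ≃ᵢ Space} {y : Space} {A : Space →ₗᵢ[ℝ] Space} {t b n : Space} {α β δ : ℝ}

theorem isReflectionIn_iff (hA : HasLinearPart T y A) {K : Submodule ℝ Space} :
    IsReflectionIn T (AffineSubspace.mk' y K) ↔ ∀ x, A x = K.reflection x := by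
  rw [isReflectionIn_mk'_iff]
  constructor
  · intro h x
    have := h (x + y)
    rw [hA] at this
    simpa using this
  · intro h x
    rw [hA, h]

theorem isReflectionIn (hA : HasLinearPart T y A) (h : SignFrame A t b n α β δ)
    {K : Submodule ℝ Space} (ht : K.reflection t = α • t) (hb : K.reflection b = β • b)
    (hn : K.reflection n = δ • n) : IsReflectionIn T (AffineSubspace.mk' y K) := by
  rw [hA.isReflectionIn_iff]
  exact h.hom_ext (B := A.toLinearMap) (C := K.reflection.toLinearEquiv.toLinearMap)
    (h.map_t.trans ht.symm) (h.map_b.trans hb.symm) (h.map_n.trans hn.symm)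

theorem involutive (hA : HasLinearPart T y A) (h : SignFrame A t b n α β δ) :
    Function.Involutive T := by
  have key := h.hom_ext (B := A.toLinearMap.comp A.toLinearMap) (C := LinearMap.id)
    (by simp [h.map_t, smul_smul, ← sq, h.sq_α]) (by simp [h.map_b, smul_smul, ← sq, h.sq_β])
    (by simp [h.map_n, smul_smul, ← sq, h.sq_δ])
  intro x
  rw [hA x, hA, add_sub_cancel_right]
  have := key (x - y)
  simp only [LinearMap.comp_apply, LinearIsometry.coe_toLinearMap, LinearMap.id_apply] at this
  rw [this, sub_add_cancel]

theorem eq_refl (hA : HasLinearPart T y A) (h : SignFrame A t b n 1 1 1) :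
    T = IsometryEquiv.refl Space := by
  have key := h.hom_ext (B := A.toLinearMap) (C := LinearMap.id)
    (by simp [h.map_t]) (by simp [h.map_b]) (by simp [h.map_n])
  ext1 x
  have := key (x - y)
  simp only [LinearIsometry.coe_toLinearMap, LinearMap.id_apply] at this
  rw [hA x, this, sub_add_cancel]
  rfl

end HasLinearPart

section reflections

variable {t b n : Space} {A : Space →ₗᵢ[ℝ] Space} {α β δ : ℝ}

theorem reflection_of_mem {K : Submodule ℝ Space} {x : Space} (h : x ∈ K) :
    K.reflection x = (1 : ℝ) • x := by
  rw [one_smul]; exact Submodule.reflection_mem_subspace_eq_self h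

theorem reflection_of_mem_orthogonal {K : Submodule ℝ Space} {x : Space} (h : x ∈ Kᗮ) :
    K.reflection x = (-1 : ℝ) • x := by
  rw [neg_one_smul]; exact Submodule.reflection_mem_subspace_orthogonalComplement_eq_neg h

theorem mem_span_singleton_orthogonal {x y : Space} (h : inner ℝ x y = 0) :
    y ∈ (ℝ ∙ x)ᗮ := Submodule.mem_orthogonal_singleton_iff_inner_right.2 h

end reflections

namespace SignFrame

variable {T : Space ≃ᵢ Space} {A : Space →ₗᵢ[ℝ] Space} {t b n : Space} {α β δ : ℝ}
  {f : Plane → Space} {p : Plane}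

theorem limitingTangentPlane (h : SignFrame A t b n 1 1 (-1)) (hA : HasLinearPart T (f p) A) :
    IsReflectionIn T (limitingTangentPlane f p n) :=
  hA.isReflectionIn h (reflection_of_mem (mem_span_singleton_orthogonal h.inner_nt))
    (reflection_of_mem (mem_span_singleton_orthogonal h.inner_nb))
    (reflection_of_mem_orthogonal
      (Submodule.le_orthogonal_orthogonal _ (Submodule.mem_span_singleton_self n)))

theorem normalPlane (h : SignFrame A t b n (-1) 1 1) (hA : HasLinearPart T (f p) A)
    (hf : tangentDirection f p = ℝ ∙ t) : IsReflectionIn T (normalPlane f p) := by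
  refine hA.isReflectionIn h ?_ ?_ ?_ <;> rw [hf]
  · exact reflection_of_mem_orthogonal
      (Submodule.le_orthogonal_orthogonal _ (Submodule.mem_span_singleton_self t))
  · exact reflection_of_mem (mem_span_singleton_orthogonal h.inner_tb)
  · exact reflection_of_mem
      (mem_span_singleton_orthogonal (by rw [real_inner_comm]; exact h.inner_nt))

theorem reflection_conormal (h : SignFrame A t b n α β δ) :
    ((ℝ ∙ n) ⊔ (ℝ ∙ t)).reflection b = (-1 : ℝ) • b := by
  refine reflection_of_mem_orthogonal ?_
  rw [← Submodule.inf_orthogonal]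
  exact ⟨mem_span_singleton_orthogonal h.inner_nb, mem_span_singleton_orthogonal h.inner_tb⟩

theorem conormalPlane (h : SignFrame A t b n 1 (-1) 1) (hA : HasLinearPart T (f p) A)
    (hf : tangentDirection f p = ℝ ∙ t) : IsReflectionIn T (conormalPlane f p n) := by
  refine hA.isReflectionIn h ?_ ?_ ?_ <;> rw [hf]
  · exact reflection_of_mem
      (Submodule.mem_sup_right (Submodule.mem_span_singleton_self t))
  · exact h.reflection_conormal
  · exact reflection_of_mem
      (Submodule.mem_sup_left (Submodule.mem_span_singleton_self n))

theorem not_conormalPlane (h : SignFrame A t b n α 1 δ) (hA : HasLinearPart T (f p) A)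
    (hf : tangentDirection f p = ℝ ∙ t) : ¬ IsReflectionIn T (_root_.conormalPlane f p n) := by
  intro h1
  have h2 := hA.isReflectionIn_iff.1 h1 b
  rw [hf, h.reflection_conormal, h.map_b, one_smul, neg_one_smul] at h2
  have h3 : (2 : ℝ) • b = 0 := by rw [two_smul]; nth_rewrite 2 [h2]; simp
  exact h.b_ne ((smul_eq_zero.1 h3).resolve_left two_ne_zero)

theorem conormalLine (h : SignFrame A t b n (-1) 1 (-1)) (hA : HasLinearPart T (f p) A)
    (hf : tangentDirection f p = ℝ ∙ t) : IsReflectionIn T (conormalLine f p n) := by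
  refine hA.isReflectionIn h ?_ ?_ ?_ <;> rw [hf]
  · exact reflection_of_mem_orthogonal (Submodule.orthogonal_le inf_le_right
      (Submodule.le_orthogonal_orthogonal _ (Submodule.mem_span_singleton_self t)))
  · exact reflection_of_mem ⟨mem_span_singleton_orthogonal h.inner_nb,
      mem_span_singleton_orthogonal h.inner_tb⟩
  · exact reflection_of_mem_orthogonal (Submodule.orthogonal_le inf_le_left
      (Submodule.le_orthogonal_orthogonal _ (Submodule.mem_span_singleton_self n)))

end SignFrame

/-! ### Symmetry of the double curves. -/

theorem stdCuspidalCrossCap_symm (v : ℝ) :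
    stdCuspidalCrossCap !₂[-0 * v ^ 2, -v] = stdCuspidalCrossCap !₂[-0 * v ^ 2, v] := by
  ext i; fin_cases i <;> simp [stdCuspidalCrossCap]

theorem stdCuspidalCrossCap_sq {v w : ℝ}
    (h : stdCuspidalCrossCap !₂[-0 * v ^ 2, v] = stdCuspidalCrossCap !₂[-0 * w ^ 2, w]) :
    v ^ 2 = w ^ 2 := by
  simpa [stdCuspidalCrossCap] using (Space.ext_iff'.1 h).1

theorem stdSwallowtail_symm (v : ℝ) :
    stdSwallowtail !₂[-2 * v ^ 2, -v] = stdSwallowtail !₂[-2 * v ^ 2, v] := by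
  ext i; fin_cases i <;> simp [stdSwallowtail] <;> ring

theorem stdSwallowtail_sq {v w : ℝ}
    (h : stdSwallowtail !₂[-2 * v ^ 2, v] = stdSwallowtail !₂[-2 * w ^ 2, w]) :
    v ^ 2 = w ^ 2 := by
  have := (Space.ext_iff'.1 h).2.2
  simp only [stdSwallowtail] at this
  simp only [Matrix.cons_val] at this
  linarith

/-! ### Transfer between the given germ and its normal form. -/

/-- The germs of `φ` at `x` and of `φ'` at `y` are mutually inverse `C^r`-diffeomorphisms. -/
structure InverseGerms {E F : Type*} [NormedAddCommGroup E] [NormedSpace ℝ E]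
    [NormedAddCommGroup F] [NormedSpace ℝ F] (r : WithTop ℕ∞) (φ : E → F) (φ' : F → E) (x : E)
    (y : F) : Prop where
  map_eq : φ x = y
  contDiffAt : ∀ᶠ z in 𝓝 x, ContDiffAt ℝ r φ z
  contDiffAt_symm : ∀ᶠ z in 𝓝 y, ContDiffAt ℝ r φ' z
  left_inv : ∀ᶠ z in 𝓝 x, φ' (φ z) = z
  right_inv : ∀ᶠ z in 𝓝 y, φ (φ' z) = z

/-- The differential of a differentiable map with a differentiable left inverse is injective. -/
theorem injective_fderiv_of_leftInverse {E F : Type*} [NormedAddCommGroup E] [NormedSpace ℝ E]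
    [NormedAddCommGroup F] [NormedSpace ℝ F] {φ : E → F} {φ' : F → E} {x : E}
    (h : DifferentiableAt ℝ φ x) (h' : DifferentiableAt ℝ φ' (φ x))
    (hinv : ∀ᶠ z in 𝓝 x, φ' (φ z) = z) : Function.Injective (fderiv ℝ φ x) := by
  have h1 := (h'.hasFDerivAt.comp x h.hasFDerivAt).unique
    ((hasFDerivAt_id x).congr_of_eventuallyEq hinv)
  exact Function.LeftInverse.injective (g := fderiv ℝ φ' (φ x)) fun w => DFunLike.congr_fun h1 w

namespace InverseGerms

variable {E F : Type*} [NormedAddCommGroup E] [NormedSpace ℝ E]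
    [NormedAddCommGroup F] [NormedSpace ℝ F] {r : WithTop ℕ∞} {φ : E → F} {φ' : F → E} {x : E}
    {y : F}

theorem of_openPartialHomeomorph (e : OpenPartialHomeomorph E F) (hx : x ∈ e.source)
    (hy : e x = y) (h : ContDiffOn ℝ r e e.source) (h' : ContDiffOn ℝ r e.symm e.target) :
    InverseGerms r e e.symm x y where
  map_eq := hy
  contDiffAt := by
    filter_upwards [e.open_source.mem_nhds hx] with z hz
    exact h.contDiffAt (e.open_source.mem_nhds hz)
  contDiffAt_symm := by
    filter_upwards [e.open_target.mem_nhds (hy ▸ e.map_source hx)] with z hz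
    exact h'.contDiffAt (e.open_target.mem_nhds hz)
  left_inv := by
    filter_upwards [e.open_source.mem_nhds hx] with z hz
    exact e.left_inv hz
  right_inv := by
    filter_upwards [e.open_target.mem_nhds (hy ▸ e.map_source hx)] with z hz
    exact e.right_inv hz

theorem map_symm (h : InverseGerms r φ φ' x y) : φ' y = x := by
  rw [← h.map_eq]; exact h.left_inv.self_of_nhds

theorem symm (h : InverseGerms r φ φ' x y) : InverseGerms r φ' φ y x :=
  ⟨h.map_symm, h.contDiffAt_symm, h.contDiffAt, h.right_inv, h.left_inv⟩

theorem tendsto (h : InverseGerms r φ φ' x y) : Tendsto φ (𝓝 x) (𝓝 y) := by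
  have := h.contDiffAt.self_of_nhds.continuousAt.tendsto
  rwa [h.map_eq] at this

theorem injective_fderiv (h : InverseGerms r φ φ' x y) (hr : r ≠ 0) :
    ∀ᶠ z in 𝓝 x, Function.Injective (fderiv ℝ φ z) := by
  filter_upwards [h.contDiffAt, h.tendsto.eventually h.contDiffAt_symm, h.left_inv.eventually_nhds]
    with z h1 h2 h3
  exact injective_fderiv_of_leftInverse (h1.differentiableAt hr) (h2.differentiableAt hr) h3

end InverseGerms

/-- In the coordinates `φ` and `Φ` the germ of `f` at `p` is the germ of `g` at the origin. -/
structure NormalForm (r : WithTop ℕ∞) (f : Plane → Space) (p : Plane) (g : Plane → Space)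
    (φ φ' : Plane → Plane) (Φ Φ' : Space → Space) : Prop where
  dom : InverseGerms r φ φ' p 0
  cod : InverseGerms r Φ Φ' (f p) 0
  eq : ∀ᶠ x in 𝓝 p, Φ (f x) = g (φ x)
  contDiffAt : ∀ᶠ x in 𝓝 p, ContDiffAt ℝ r f x

theorem RightLeftEquivalentAt.exists_normalForm {r : WithTop ℕ∞} {f g : Plane → Space} {p : Plane}
    (h : RightLeftEquivalentAt r f p g 0) (hg : g 0 = 0)
    (hf : ∀ᶠ x in 𝓝 p, ContDiffAt ℝ r f x) : ∃ φ φ' Φ Φ', NormalForm r f p g φ φ' Φ Φ' := by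
  obtain ⟨φ, Φ, h1, h2, h3, h4, h5, h6, h7, h8, h9⟩ := h
  exact ⟨φ, φ.symm, Φ, Φ.symm, .of_openPartialHomeomorph φ h1 h2 h3 h4,
    .of_openPartialHomeomorph Φ h5 (h6.trans hg) h7 h8, h9, hf⟩

namespace HasLinearPart

variable {T : Space ≃ᵢ Space} {y : Space} {A : Space →ₗᵢ[ℝ] Space}

theorem contDiff (hA : HasLinearPart T y A) {r : WithTop ℕ∞} : ContDiff ℝ r T := by
  have : (T : Space → Space) = fun x => A (x - y) + y := funext hA
  rw [this]
  exact (A.contDiff.comp (contDiff_id.sub contDiff_const)).add contDiff_const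

theorem hasFDerivAt (hA : HasLinearPart T y A) (x : Space) :
    HasFDerivAt T A.toContinuousLinearMap x := by
  have : (T : Space → Space) = fun x => A (x - y) + y := funext hA
  rw [this]
  have := (A.toContinuousLinearMap.hasFDerivAt (x := x - y)).comp x ((hasFDerivAt_id x).sub_const y)
  exact this.add_const y

end HasLinearPart

namespace NormalForm

variable {r : WithTop ℕ∞} {f : Plane → Space} {p : Plane} {g : Plane → Space}
    {φ φ' : Plane → Plane} {Φ Φ' : Space → Space} {GU E : Plane → Space} {lam : Plane → ℝ}
    {G : Space → ℝ} {mu : Plane → ℝ} {T : Space ≃ᵢ Space} {A : Space →ₗᵢ[ℝ] Space}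
    {ψ : Plane → Plane}

theorem tendsto (h : NormalForm r f p g φ φ' Φ Φ') : Tendsto f (𝓝 p) (𝓝 (f p)) :=
  h.contDiffAt.self_of_nhds.continuousAt.tendsto

theorem eq_symm (h : NormalForm r f p g φ φ' Φ Φ') : ∀ᶠ x in 𝓝 p, f x = Φ' (g (φ x)) := by
  filter_upwards [h.eq, h.tendsto.eventually h.cod.left_inv] with x h1 h2
  rw [← h1, h2]

theorem comp_symm (h : NormalForm r f p g φ φ' Φ Φ') :
    ∀ᶠ q in 𝓝 (0 : Plane), f (φ' q) = Φ' (g q) := by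
  filter_upwards [h.dom.symm.tendsto.eventually h.eq_symm, h.dom.right_inv] with q h1 h2
  rw [h1, h2]

theorem tendsto_conj (h : NormalForm r f p g φ φ' Φ Φ') (hA : HasLinearPart T (f p) A) :
    Tendsto (fun y => T (Φ' y)) (𝓝 0) (𝓝 (f p)) := by
  have h1 : Tendsto T (𝓝 (f p)) (𝓝 (f p)) := by
    have := (hA.contDiff (r := 0)).continuous.tendsto (f p)
    rwa [hA, sub_self, _root_.map_zero, zero_add] at this
  exact h1.comp h.cod.symm.tendsto

theorem contDiffAt_conj (h : NormalForm r f p g φ φ' Φ Φ') (hA : HasLinearPart T (f p) A) :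
    ∀ᶠ y in 𝓝 (0 : Space), ContDiffAt ℝ r (fun y => Φ (T (Φ' y))) y := by
  filter_upwards [h.cod.contDiffAt_symm, (h.tendsto_conj hA).eventually h.cod.contDiffAt]
    with y h1 h2
  exact h2.comp y (hA.contDiff.contDiffAt.comp y h1)

theorem map_zero_conj (h : NormalForm r f p g φ φ' Φ Φ') (hA : HasLinearPart T (f p) A) :
    Φ (T (Φ' 0)) = 0 := by
  rw [h.cod.map_symm, hA, sub_self, _root_.map_zero, zero_add, h.cod.map_eq]

theorem tendsto_conj' (h : NormalForm r f p g φ φ' Φ Φ') (hA : HasLinearPart T (f p) A) :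
    Tendsto (fun y => Φ (T (Φ' y))) (𝓝 0) (𝓝 0) := h.cod.tendsto.comp (h.tendsto_conj hA)

theorem conj_comp (h : NormalForm r f p g φ φ' Φ Φ') (hA : HasLinearPart T (f p) A)
    {S : Space ≃ᵢ Space} (hST : ∀ x, S (T x) = x) :
    ∀ᶠ y in 𝓝 (0 : Space), Φ (S (Φ' (Φ (T (Φ' y))))) = y := by
  filter_upwards [(h.tendsto_conj hA).eventually h.cod.left_inv, h.cod.right_inv] with y h1 h2
  rw [h1, hST, h2]

/-- Injectivity of the differential comes from the conjugate of `T⁻¹`, a local inverse. For the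
lifting property the inclusion of germs is applied to a `U'` that `φ` maps into `N`. -/
theorem localSymmetry (h : NormalForm r f p g φ φ' Φ Φ') (hr : r ≠ 0)
    (hA : HasLinearPart T (f p) A) {U : Set Plane} (hU : U ∈ 𝓝 p)
    (hT : ∀ U' ⊆ U, IsOpen U' → p ∈ U' →
      ∃ V ⊆ U, IsOpen V ∧ p ∈ V ∧ T '' (f '' V) ⊆ f '' U') :
    LocalSymmetry r g (fun y => Φ (T (Φ' y))) where
  contDiffAt := h.contDiffAt_conj hA
  map_zero := h.map_zero_conj hA
  injective := by
    have hfix : T.symm (f p) = f p := by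
      rw [IsometryEquiv.symm_apply_eq, hA, sub_self, _root_.map_zero, zero_add]
    obtain ⟨A', hA'⟩ := exists_hasLinearPart T.symm hfix
    filter_upwards [h.contDiffAt_conj hA, (h.tendsto_conj' hA).eventually (h.contDiffAt_conj hA'),
      (h.conj_comp hA (S := T.symm) T.symm_apply_apply).eventually_nhds] with y h1 h2 h3
    exact injective_fderiv_of_leftInverse (h1.differentiableAt hr) (h2.differentiableAt hr) h3
  lift N hN := by
    have hU₀ : ∀ᶠ x in 𝓝 p, x ∈ U := hU
    obtain ⟨U', hU', hUo, hpU⟩ := eventually_nhds_iff.1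
      ((hU₀.and (h.dom.tendsto.eventually hN)).and h.eq)
    obtain ⟨V, -, hVo, hpV, hV⟩ := hT U' (fun x hx => (hU' x hx).1.1) hUo hpU
    filter_upwards [h.dom.symm.tendsto.eventually (hVo.mem_nhds hpV), h.comp_symm] with q h1 h2
    obtain ⟨u, hu, hfu⟩ := hV ⟨_, ⟨φ' q, h1, rfl⟩, rfl⟩
    refine ⟨φ u, (hU' u hu).1.2, ?_⟩
    show g (φ u) = Φ (T (Φ' (g q)))
    rw [← (hU' u hu).2, hfu, h2]

/-- A lift of the symmetry of the normal form gives a lift of the isometry. -/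
theorem lift (h : NormalForm r f p g φ φ' Φ Φ') (hA : HasLinearPart T (f p) A)
    (hg : FrontalModel g GU E lam G mu)
    (hψ0 : ψ 0 = 0) (hψ : ∀ᶠ q in 𝓝 (0 : Plane), ContDiffAt ℝ r ψ q)
    (hlift : ∀ᶠ q in 𝓝 (0 : Plane), g (ψ q) = Φ (T (Φ' (g q)))) :
    ∀ᶠ x in 𝓝 p, f (φ' (ψ (φ x))) = T (f x) := by
  have hψt : Tendsto ψ (𝓝 0) (𝓝 0) := by
    have := hψ.self_of_nhds.continuousAt.tendsto
    rwa [hψ0] at this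
  filter_upwards [h.eq_symm, h.dom.tendsto.eventually hlift,
    h.dom.tendsto.eventually (hψt.eventually h.comp_symm),
    h.dom.tendsto.eventually (hg.tendsto_zero.eventually
      ((h.tendsto_conj hA).eventually h.cod.left_inv))] with x h1 h2 h3 h4
  rw [h3, h2, h4, h1]

theorem contDiffAt_lift (h : NormalForm r f p g φ φ' Φ Φ')
    (hψ0 : ψ 0 = 0) (hψ : ∀ᶠ q in 𝓝 (0 : Plane), ContDiffAt ℝ r ψ q) :
    ∀ᶠ x in 𝓝 p, ContDiffAt ℝ r (fun x => φ' (ψ (φ x))) x := by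
  have hψt : Tendsto ψ (𝓝 0) (𝓝 0) := by
    have := hψ.self_of_nhds.continuousAt.tendsto
    rwa [hψ0] at this
  filter_upwards [h.dom.contDiffAt, h.dom.tendsto.eventually hψ,
    h.dom.tendsto.eventually (hψt.eventually h.dom.contDiffAt_symm)] with x h1 h2 h3
  exact h3.comp x (h2.comp x h1)

theorem involutive_lift (h : NormalForm r f p g φ φ' Φ Φ')
    (hψ0 : ψ 0 = 0) (hψ : ∀ᶠ q in 𝓝 (0 : Plane), ContDiffAt ℝ r ψ q)
    (hinv : ∀ᶠ q in 𝓝 (0 : Plane), ψ (ψ q) = q) :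
    ∀ᶠ x in 𝓝 p, φ' (ψ (φ (φ' (ψ (φ x))))) = x := by
  have hψt : Tendsto ψ (𝓝 0) (𝓝 0) := by
    have := hψ.self_of_nhds.continuousAt.tendsto
    rwa [hψ0] at this
  filter_upwards [h.dom.left_inv, h.dom.tendsto.eventually hinv,
    h.dom.tendsto.eventually (hψt.eventually h.dom.right_inv)] with x h1 h2 h3
  rw [h3, h2, h1]

theorem fderiv_eq (h : NormalForm r f p g φ φ' Φ Φ') (hr : r ≠ 0)
    (hg : FrontalModel g GU E lam G mu) : ∀ᶠ x in 𝓝 p, ∀ w,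
    fderiv ℝ f x w = fderiv ℝ Φ' (g (φ x)) (fderiv ℝ g (φ x) (fderiv ℝ φ x w)) := by
  filter_upwards [h.eq_symm.eventually_nhds, h.dom.contDiffAt,
    h.dom.tendsto.eventually (hg.tendsto_zero.eventually h.cod.contDiffAt_symm)] with x h1 h2 h3 w
  have d1 := (h3.differentiableAt hr).hasFDerivAt.comp (φ x) (hg.differentiable (φ x)).hasFDerivAt
  have d2 := d1.comp x (h2.differentiableAt hr).hasFDerivAt
  rw [(d2.congr_of_eventuallyEq h1).fderiv]
  rfl

theorem lam_eq_zero (h : NormalForm r f p g φ φ' Φ Φ') (hr : r ≠ 0)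
    (hg : FrontalModel g GU E lam G mu) :
    ∀ᶠ x in 𝓝 p, ¬ Function.Injective (fderiv ℝ f x) → lam (φ x) = 0 := by
  filter_upwards [h.fderiv_eq hr hg, h.dom.injective_fderiv hr,
    h.dom.tendsto.eventually (hg.tendsto_zero.eventually (h.cod.symm.injective_fderiv hr))]
    with x h1 h2 h3 h4
  by_contra hne
  apply h4
  have : ⇑(fderiv ℝ f x) = fderiv ℝ Φ' (g (φ x)) ∘ fderiv ℝ g (φ x) ∘ fderiv ℝ φ x := funext h1
  rw [this]
  exact h3.comp ((hg.injective_fderiv hne).comp h2)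

theorem surjective_fderiv_dom (h : NormalForm r f p g φ φ' Φ Φ') (hr : r ≠ 0) :
    ∀ᶠ x in 𝓝 p, Function.Surjective (fderiv ℝ φ x) := by
  filter_upwards [h.dom.injective_fderiv hr] with x hx
  exact (LinearMap.injective_iff_surjective (f := (fderiv ℝ φ x : Plane →ₗ[ℝ] Plane))).1 hx

theorem surjective_fderiv_cod (h : NormalForm r f p g φ φ' Φ Φ') (hr : r ≠ 0) :
    ∀ᶠ y in 𝓝 (f p), Function.Surjective (fderiv ℝ Φ y) := by
  filter_upwards [h.cod.injective_fderiv hr] with x hx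
  exact (LinearMap.injective_iff_surjective (f := (fderiv ℝ Φ x : Space →ₗ[ℝ] Space))).1 hx

theorem surjective_fderiv_cod_symm (h : NormalForm r f p g φ φ' Φ Φ') (hr : r ≠ 0) :
    Function.Surjective (fderiv ℝ Φ' 0) :=
  (LinearMap.injective_iff_surjective (f := (fderiv ℝ Φ' 0 : Space →ₗ[ℝ] Space))).1
    (h.cod.symm.injective_fderiv hr).self_of_nhds

theorem tangentDirection_eq (h : NormalForm r f p g φ φ' Φ Φ') (hr : r ≠ 0)
    (hg : FrontalModel g GU E lam G mu) :
    tangentDirection f p = ℝ ∙ (fderiv ℝ Φ' 0 (GU 0)) := by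
  have h1 := (h.fderiv_eq hr hg).self_of_nhds
  rw [h.dom.map_eq, hg.map_zero] at h1
  simp only [hg.fderiv_zero_apply, map_smul] at h1
  ext y
  rw [Submodule.mem_span_singleton]
  constructor
  · rintro ⟨w, rfl⟩
    exact ⟨_, (h1 w).symm⟩
  · rintro ⟨a, rfl⟩
    obtain ⟨w, hw⟩ := (h.surjective_fderiv_dom hr).self_of_nhds !₂[a, 0]
    refine ⟨w, (h1 w).trans ?_⟩
    rw [hw]; simp

/-- The differential of the coordinate change intertwines the linear parts. -/
theorem fderiv_conj (h : NormalForm r f p g φ φ' Φ Φ') (hr : r ≠ 0)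
    (hA : HasLinearPart T (f p) A) (w : Space) :
    A (fderiv ℝ Φ' 0 w) = fderiv ℝ Φ' 0 (fderiv ℝ (fun y => Φ (T (Φ' y))) 0 w) := by
  have d0 := (h.cod.contDiffAt_symm.self_of_nhds.differentiableAt hr).hasFDerivAt
  have d1 := (hA.hasFDerivAt (Φ' 0)).comp 0 d0
  have d2 : HasFDerivAt (fun y => Φ' (Φ (T (Φ' y))))
      ((fderiv ℝ Φ' 0).comp (fderiv ℝ (fun y => Φ (T (Φ' y))) 0)) 0 := by
    have h0 : HasFDerivAt Φ' (fderiv ℝ Φ' 0) (Φ (T (Φ' 0))) := by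
      rw [h.map_zero_conj hA]; exact d0
    exact h0.comp 0 ((h.contDiffAt_conj hA).self_of_nhds.differentiableAt hr).hasFDerivAt
  have h3 : ∀ᶠ y in 𝓝 (0 : Space), T (Φ' y) = Φ' (Φ (T (Φ' y))) := by
    filter_upwards [(h.tendsto_conj hA).eventually h.cod.left_inv] with y h1
    rw [h1]
  exact DFunLike.congr_fun (d1.unique (d2.congr_of_eventuallyEq h3)) w

/-- The normal of the model is a covector, so it is pulled back by the transpose of `dΦ` and then
normalized. -/
theorem exists_isUnitNormalNear (h : NormalForm r f p g φ φ' Φ Φ') (hr : r = ∞ ∨ r = ω)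
    (hg : FrontalModel g GU E lam G mu) : ∃ ν, IsUnitNormalNear r f p ν := by
  have hr0 := ne_zero_of_eq_infty_or_omega hr
  set N : Plane → Space := fun x => WithLp.toLp 2 fun i =>
    (inner ℝ (cross (GU (φ x)) (E (φ x))) (fderiv ℝ Φ (f x) (EuclideanSpace.single i 1)) : ℝ)
    with hN
  have hNi : ∀ x v, (inner ℝ v (N x) : ℝ) =
      inner ℝ (cross (GU (φ x)) (E (φ x))) (fderiv ℝ Φ (f x) v) := by
    intro x v
    have hv : v = v 0 • EuclideanSpace.single 0 (1 : ℝ) + v 1 • EuclideanSpace.single 1 (1 : ℝ) +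
        v 2 • EuclideanSpace.single 2 (1 : ℝ) := by
      ext i; fin_cases i <;> simp
    rw [Space.inner_eq]
    nth_rewrite 4 [hv]
    simp only [map_add, map_smul, inner_add_right, inner_smul_right]
    rfl
  have hsm : ∀ᶠ x in 𝓝 p, ContDiffAt ℝ r N x := by
    filter_upwards [h.dom.contDiffAt, h.contDiffAt, h.tendsto.eventually h.cod.contDiffAt]
      with x h1 h2 h3
    rw [contDiffAt_euclidean]
    intro i
    have h4 : ContDiffAt ℝ r (fderiv ℝ Φ) (f x) :=
      h3.fderiv_right (add_one_le_of_eq_infty_or_omega hr)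
    refine ContDiffAt.inner ℝ (contDiffAt_cross ?_ ?_) ?_
    · exact (hg.contDiff_GU.contDiffAt.of_le le_top).comp x h1
    · exact (hg.contDiff_E.contDiffAt.of_le le_top).comp x h1
    · exact (h4.comp x h2).clm_apply contDiffAt_const
  have hne : ∀ᶠ x in 𝓝 p, N x ≠ 0 := by
    filter_upwards [h.tendsto.eventually (h.surjective_fderiv_cod hr0)] with x h1 h2
    obtain ⟨v, hv⟩ := h1 (cross (GU (φ x)) (E (φ x)))
    have h3 := hNi x v
    rw [h2, hv, inner_zero_right] at h3
    exact hg.cross_ne_zero (φ x) (inner_self_eq_zero.1 h3.symm)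
  have horth : ∀ᶠ x in 𝓝 p, ∀ w, (inner ℝ (fderiv ℝ f x w) (N x) : ℝ) = 0 := by
    filter_upwards [h.eq.eventually_nhds, h.dom.contDiffAt, h.contDiffAt,
      h.tendsto.eventually h.cod.contDiffAt] with x h1 h2 h3 h4 w
    have d1 := (h4.differentiableAt hr0).hasFDerivAt.comp x (h3.differentiableAt hr0).hasFDerivAt
    have d2 := (hg.differentiable (φ x)).hasFDerivAt.comp x (h2.differentiableAt hr0).hasFDerivAt
    have h5 := DFunLike.congr_fun (d1.unique (d2.congr_of_eventuallyEq h1)) w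
    simp only [ContinuousLinearMap.comp_apply] at h5
    rw [hNi, h5, hg.fderiv_apply, inner_add_right, inner_smul_right, inner_smul_right,
      inner_cross_left, inner_cross_right]
    simp
  obtain ⟨O, hO, hOo, hpO⟩ := eventually_nhds_iff.1 ((hsm.and hne).and horth)
  refine ⟨fun x => ‖N x‖⁻¹ • N x, O, hOo, hpO, fun x hx => ?_, fun x hx => ⟨?_, fun w => ?_⟩⟩
  · obtain ⟨⟨h1, h2⟩, -⟩ := hO x hx
    exact (((h1.norm ℝ h2).inv (norm_ne_zero_iff.2 h2)).smul h1).contDiffWithinAt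
  · exact norm_smul_inv_norm (𝕜 := ℝ) (hO x hx).1.2
  · rw [inner_smul_right, (hO x hx).2, mul_zero]

/-- At `p` itself the normal condition sees only the direction of `GU`. Orthogonality to `E` is a
limit from regular points, where `lam` can be cancelled. -/
theorem inner_unitNormal (h : NormalForm r f p g φ φ' Φ Φ') (hr : r = ∞ ∨ r = ω)
    (hg : FrontalModel g GU E lam G mu) {ν : Plane → Space} (hν : IsUnitNormalNear r f p ν) :
    ν p ≠ 0 ∧ inner ℝ (ν p) (fderiv ℝ Φ' 0 (GU 0)) = 0 ∧
      inner ℝ (ν p) (fderiv ℝ Φ' 0 (E 0)) = 0 := by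
  have hr0 := ne_zero_of_eq_infty_or_omega hr
  obtain ⟨O, hOo, hpO, hνs, hν⟩ := hν
  have key : ∀ᶠ q in 𝓝 (0 : Plane), ∀ w,
      (inner ℝ (fderiv ℝ Φ' (g q) (fderiv ℝ g q w)) (ν (φ' q)) : ℝ) = 0 := by
    filter_upwards [h.dom.symm.tendsto.eventually (h.fderiv_eq hr0 hg), h.dom.right_inv,
      h.dom.symm.tendsto.eventually (h.surjective_fderiv_dom hr0),
      h.dom.symm.tendsto.eventually (hOo.mem_nhds hpO)] with q h1 h2 h3 h4 w
    obtain ⟨w', rfl⟩ := h3 w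
    rw [← (hν _ h4).2 w', h1, h2]
  have hp' := h.dom.map_symm
  refine ⟨fun h0 => ?_, ?_, ?_⟩
  · have := (hν p hpO).1
    rw [h0, norm_zero] at this
    exact zero_ne_one this
  · have h1 := key.self_of_nhds !₂[1, 0]
    rw [hg.map_zero, hg.fderiv_zero_apply, hp'] at h1
    rw [real_inner_comm]
    simpa using h1
  · have hc : ContinuousAt (fun q => (inner ℝ (fderiv ℝ Φ' (g q) (E q)) (ν (φ' q)) : ℝ)) 0 := by
      have h1 : ContDiffAt ℝ r (fderiv ℝ Φ') (g 0) := by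
        rw [hg.map_zero]
        exact h.cod.contDiffAt_symm.self_of_nhds.fderiv_right (add_one_le_of_eq_infty_or_omega hr)
      have h2 : ContinuousAt (fun q => fderiv ℝ Φ' (g q)) 0 :=
        ContinuousAt.comp (f := g) h1.continuousAt hg.contDiff.continuous.continuousAt
      have h3 : ContinuousAt (fun q => ν (φ' q)) 0 := by
        refine ContinuousAt.comp (f := φ') ?_ h.dom.symm.contDiffAt.self_of_nhds.continuousAt
        rw [hp']
        exact (hνs.contDiffAt (hOo.mem_nhds hpO)).continuousAt
      exact ContinuousAt.inner (𝕜 := ℝ) (h2.clm_apply hg.contDiff_E.continuous.continuousAt) h3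
    have h4 := eq_zero_of_frequently hc
      (((hg.frequently_lam_ne 0).and_eventually key).mono fun q hq => by
        have h5 := hq.2 !₂[0, 1]
        rw [hg.fderiv_apply] at h5
        simp only [Matrix.cons_val_zero, Matrix.cons_val_one, zero_smul, zero_add, one_mul,
          map_smul, inner_smul_left, conj_trivial] at h5
        exact (mul_eq_zero.1 h5).resolve_left hq.1)
    simp only [hg.map_zero, hp'] at h4
    rw [real_inner_comm]
    exact h4

/-- The linear part of the isometry is a sign change in an orthogonal frame given by the tangent
line and the normal. -/
theorem exists_signFrame (h : NormalForm r f p g φ φ' Φ Φ') (hr : r = ∞ ∨ r = ω)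
    (hg : FrontalModel g GU E lam G mu) (hA : HasLinearPart T (f p) A) {ν : Plane → Space}
    (hν : IsUnitNormalNear r f p ν) {t b c : Space} {α β δ : ℝ} (ht : GU 0 = t)
    (hb : ∃ k : ℝ, k ≠ 0 ∧ E 0 = k • b)
    (hspan : ∀ w, ∃ x y z : ℝ, w = x • t + y • b + z • c)
    (hM : AdaptedFrame (fderiv ℝ (fun y => Φ (T (Φ' y))) 0) t b c α β δ) :
    ∃ t' b', SignFrame A t' b' (ν p) α β δ ∧ tangentDirection f p = ℝ ∙ t' := by
  have hr0 := ne_zero_of_eq_infty_or_omega hr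
  obtain ⟨hn, hnt, hnb⟩ := h.inner_unitNormal hr hg hν
  obtain ⟨k, hk, hb⟩ := hb
  have hcr := hg.cross_ne_zero 0
  have hinj := (h.cod.symm.injective_fderiv hr0).self_of_nhds
  set B := fderiv ℝ Φ' 0
  have hconj : ∀ w, A (B w) = B (fderiv ℝ (fun y => Φ (T (Φ' y))) 0 w) := h.fderiv_conj hr0 hA
  rw [hb, map_smul, inner_smul_right] at hnb
  replace hnb := (mul_eq_zero.1 hnb).resolve_left hk
  rw [ht] at hnt
  have htb : cross t b ≠ 0 := by
    intro h0
    apply hcr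
    obtain ⟨x, y, hxy, h1⟩ := (cross_eq_zero_iff_exists _ _).1 h0
    rw [ht, hb, cross_eq_zero_iff_exists]
    refine ⟨x * k, y, hxy.imp (fun hx => mul_ne_zero hx hk) id, ?_⟩
    have : (x * k) • t + y • k • b = k • (x • t + y • b) := by module
    rw [this, h1, smul_zero]
  have hspan' : ∀ w : Space, inner ℝ w (B t) = 0 → inner ℝ w (B b) = 0 →
      inner ℝ w (B c) = 0 → w = 0 := by
    intro w h1 h2 h3
    obtain ⟨v, hv⟩ := h.surjective_fderiv_cod_symm hr0 w
    obtain ⟨x, y, z, hxyz⟩ := hspan v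
    have h4 : (inner ℝ w w : ℝ) = 0 := by
      nth_rewrite 2 [← hv]
      rw [hxyz]
      simp only [map_add, map_smul, inner_add_right, inner_smul_right]
      change x * inner ℝ w (B t) + y * inner ℝ w (B b) + z * inner ℝ w (B c) = 0
      rw [h1, h2, h3]; simp
    exact inner_self_eq_zero.1 h4
  have hAb : ∃ x : ℝ, A (B b) = β • B b + x • B t := by
    obtain ⟨x, hx⟩ := hM.map_b
    exact ⟨x, by rw [hconj, hx, map_add, map_smul, map_smul]⟩
  have hAc : ∃ x y : ℝ, A (B c) = δ • B c + x • B b + y • B t := by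
    obtain ⟨x, y, hx⟩ := hM.map_c
    exact ⟨x, y, by rw [hconj, hx, map_add, map_add, map_smul, map_smul, map_smul]⟩
  obtain ⟨b', hb'⟩ := _root_.exists_signFrame (cross_map_ne_zero hinj htb) hspan' hn hnt hnb
    (by rw [hconj, hM.map_t, map_smul]) hAb hAc
  exact ⟨_, b', hb', by rw [h.tangentDirection_eq hr0 hg, ht]⟩

end NormalForm

/-! ### The limiting normal curvature and the sign on the normal. -/

theorem differentiableAt_deriv {X : Type*} [NormedAddCommGroup X] [NormedSpace ℝ X]
    {r : WithTop ℕ∞} (hr : r = ∞ ∨ r = ω) {F : ℝ → X} {x : ℝ} (hF : ContDiffAt ℝ r F x) :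
    DifferentiableAt ℝ (deriv F) x := by
  have h1 : ContDiffAt ℝ r (fderiv ℝ F) x := hF.fderiv_right (add_one_le_of_eq_infty_or_omega hr)
  have h2 : DifferentiableAt ℝ (fun x => fderiv ℝ F x 1) x :=
    (h1.differentiableAt (ne_zero_of_eq_infty_or_omega hr)).clm_apply (differentiableAt_const _)
  exact h2

/-- The second derivative of `h ∘ σ` at a point mapped to a critical point of `h`. -/
theorem deriv_deriv_comp {h σ : ℝ → ℝ} (hh : ∀ᶠ z in 𝓝 (0 : ℝ), DifferentiableAt ℝ h z)
    (hh' : DifferentiableAt ℝ (deriv h) 0) (hσ : ∀ᶠ z in 𝓝 (0 : ℝ), DifferentiableAt ℝ σ z)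
    (hσ' : DifferentiableAt ℝ (deriv σ) 0) (hσ0 : σ 0 = 0) (h0 : deriv h 0 = 0) :
    deriv (deriv (h ∘ σ)) 0 = deriv (deriv h) 0 * deriv σ 0 ^ 2 := by
  have hc : Tendsto σ (𝓝 0) (𝓝 0) := by
    have := hσ.self_of_nhds.continuousAt.tendsto
    rwa [hσ0] at this
  have h1 : deriv (h ∘ σ) =ᶠ[𝓝 0] fun z => deriv h (σ z) * deriv σ z := by
    filter_upwards [hσ, hc.eventually hh] with z h1 h2
    exact deriv_comp z h2 h1
  rw [h1.deriv_eq]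
  have h2 : HasDerivAt (deriv h) (deriv (deriv h) 0) (σ 0) := by
    rw [hσ0]; exact hh'.hasDerivAt
  have h3 := (h2.comp 0 hσ.self_of_nhds.hasDerivAt).mul hσ'.hasDerivAt
  refine h3.deriv.trans ?_
  simp only [Function.comp_apply, hσ0, h0]
  ring

theorem deriv_deriv_clm_comp {X : Type*} [NormedAddCommGroup X] [NormedSpace ℝ X] {F : ℝ → X}
    (L : X →L[ℝ] ℝ) (hF : ∀ᶠ z in 𝓝 (0 : ℝ), DifferentiableAt ℝ F z)
    (hF' : DifferentiableAt ℝ (deriv F) 0) :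
    deriv (deriv fun z => L (F z)) 0 = L (deriv (deriv F) 0) := by
  have h1 : deriv (fun z => L (F z)) =ᶠ[𝓝 0] fun z => L (deriv F z) := by
    filter_upwards [hF] with z hz
    exact (L.hasFDerivAt.comp_hasDerivAt z hz.hasDerivAt).deriv
  rw [h1.deriv_eq]
  exact (L.hasFDerivAt.comp_hasDerivAt 0 hF'.hasDerivAt).deriv

theorem contDiff_spaceAxis {r : WithTop ℕ∞} : ContDiff ℝ r fun z : ℝ => (!₂[0, 0, z] : Space) := by
  rw [contDiff_euclidean]
  intro i; fin_cases i <;> simp <;> fun_prop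

theorem hasDerivAt_spaceAxis (z : ℝ) :
    HasDerivAt (fun z : ℝ => (!₂[0, 0, z] : Space)) !₂[0, 0, 1] z := by
  refine hasDerivAt_of_coord fun i => ?_
  fin_cases i
  · exact hasDerivAt_const _ _
  · exact hasDerivAt_const _ _
  · exact hasDerivAt_id _

theorem spaceAxis_zero : (!₂[0, 0, 0] : Space) = 0 := by ext i; fin_cases i <;> simp

theorem tendsto_spaceAxis : Tendsto (fun z : ℝ => (!₂[0, 0, z] : Space)) (𝓝 0) (𝓝 0) :=
  (contDiff_spaceAxis (r := 0)).continuous.tendsto' 0 0 spaceAxis_zero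

namespace NormalForm

variable {r : WithTop ℕ∞} {f : Plane → Space} {p : Plane} {g : Plane → Space}
    {φ φ' : Plane → Plane} {Φ Φ' : Space → Space} {GU E : Plane → Space} {lam : Plane → ℝ}
    {G : Space → ℝ} {mu : Plane → ℝ} {T : Space ≃ᵢ Space} {A : Space →ₗᵢ[ℝ] Space}
    {ψ : Plane → Plane}

/-- An isometry preserving the image of a cuspidal edge or a cuspidal cross cap with nonzero
limiting normal curvature fixes the unit normal. -/
theorem eq_one_of_limitingNormalCurvature_ne_zero (h : NormalForm r f p g φ φ' Φ Φ')
    (hr : r = ∞ ∨ r = ω) (hg : FrontalModel g GU E (fun q => q 1) G mu)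
    (hGU : GU 0 = !₂[0, 0, 1]) (hax : ∀ u, g !₂[u, 0] = !₂[0, 0, u])
    (hA : HasLinearPart T (f p) A) (hτ : LocalSymmetry r g (fun y => Φ (T (Φ' y))))
    (hψ : ∀ᶠ q in 𝓝 (0 : Plane), ContDiffAt ℝ r ψ q) (hψ0 : ψ 0 = 0)
    (hlift : ∀ᶠ q in 𝓝 (0 : Plane), g (ψ q) = Φ (T (Φ' (g q))))
    (hinv : ∀ᶠ q in 𝓝 (0 : Plane), ψ (ψ q) = q) {ν : Plane → Space}
    (hν : IsUnitNormalNear r f p ν) {t b : Space} {α β δ : ℝ}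
    (hs : SignFrame A t b (ν p) α β δ) {U : Set Plane} {γ : ℝ → Plane}
    (hγ : IsSingularCurve r f U p γ) (hne : limitingNormalCurvature f γ (ν p) ≠ 0) : δ = 1 := by
  have hr0 := ne_zero_of_eq_infty_or_omega hr
  obtain ⟨hγ0, ε, hε, hγs, hγ, -⟩ := hγ
  have hI : Ioo (-ε) ε ∈ 𝓝 (0 : ℝ) := Ioo_mem_nhds (by linarith) hε
  have hIev : ∀ᶠ z in 𝓝 (0 : ℝ), z ∈ Ioo (-ε) ε := hI
  have hγd : ∀ᶠ z in 𝓝 (0 : ℝ), ContDiffAt ℝ r γ z := by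
    filter_upwards [hIev] with z hz
    exact hγs.contDiffAt (isOpen_Ioo.mem_nhds hz)
  have hγt : Tendsto γ (𝓝 0) (𝓝 p) := by
    have := hγd.self_of_nhds.continuousAt.tendsto
    rwa [hγ0] at this
  -- the singular curve in the image
  set c : ℝ → Space := fun z => Φ' !₂[0, 0, z] with hc
  have hcd : ∀ᶠ z in 𝓝 (0 : ℝ), ContDiffAt ℝ r c z := by
    filter_upwards [tendsto_spaceAxis.eventually h.cod.contDiffAt_symm] with z hz
    exact hz.comp z contDiff_spaceAxis.contDiffAt
  have hc' : HasDerivAt c (fderiv ℝ Φ' 0 !₂[0, 0, 1]) 0 := by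
    have h1 : HasFDerivAt Φ' (fderiv ℝ Φ' 0) !₂[0, 0, (0 : ℝ)] := by
      rw [spaceAxis_zero]
      exact (h.cod.contDiffAt_symm.self_of_nhds.differentiableAt hr0).hasFDerivAt
    exact h1.comp_hasDerivAt 0 (hasDerivAt_spaceAxis 0)
  set L : Space →L[ℝ] ℝ := innerSL ℝ (ν p) with hL
  have hLe : ∀ x, L x = inner ℝ (ν p) x := fun x => rfl
  set k : ℝ → ℝ := fun z => L (c z) with hk
  have hkd : ∀ᶠ z in 𝓝 (0 : ℝ), ContDiffAt ℝ r k z := by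
    filter_upwards [hcd] with z hz
    exact L.contDiff.contDiffAt.comp z hz
  have hk0 : deriv k 0 = 0 := by
    have h1 := (L.hasFDerivAt.comp_hasDerivAt 0 hc').deriv
    refine h1.trans ?_
    rw [hLe, ← hGU]
    exact (h.inner_unitNormal hr hg hν).2.1
  have hkd' := hkd.mono fun z hz => hz.differentiableAt hr0
  have hkd'' := differentiableAt_deriv hr hkd.self_of_nhds
  -- the second derivative of `k` does not vanish
  set σ : ℝ → ℝ := fun z => φ (γ z) 0 with hσ
  have hφγ : ∀ᶠ z in 𝓝 (0 : ℝ), ContDiffAt ℝ r (fun z => φ (γ z)) z := by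
    filter_upwards [hγd, hγt.eventually h.dom.contDiffAt] with z h1 h2
    exact h2.comp z h1
  have hσd : ∀ᶠ z in 𝓝 (0 : ℝ), ContDiffAt ℝ r σ z := by
    filter_upwards [hφγ] with z hz
    exact contDiffAt_coord hz 0
  have hσ0 : σ 0 = 0 := by
    simp only [hσ, hγ0, h.dom.map_eq, PiLp.zero_apply]
  -- Singular points of `f` near `p` correspond to points of the axis, so `f ∘ γ` is a
  -- reparametrization of `c`.
  have hfγ : f ∘ γ =ᶠ[𝓝 0] fun z => c (σ z) := by
    filter_upwards [hIev, hγt.eventually h.eq_symm, hγt.eventually (h.lam_eq_zero hr0 hg)]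
      with z h1 h2 h3
    have h4 : φ (γ z) = !₂[σ z, 0] := by
      ext i; fin_cases i
      · rfl
      · exact h3 (hγ z h1).2.2
    simp only [Function.comp_apply, h2, hc]
    rw [h4, hax]
  have hσt : Tendsto σ (𝓝 0) (𝓝 0) := by
    have := hσd.self_of_nhds.continuousAt.tendsto
    rwa [hσ0] at this
  have hcσ : ∀ᶠ z in 𝓝 (0 : ℝ), ContDiffAt ℝ r (fun z => c (σ z)) z := by
    filter_upwards [hσd, hσt.eventually hcd] with z h1 h2
    exact h2.comp z h1
  -- As `k' (0) = 0`, the numerator of the curvature is `k''(0) σ'(0)²`.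
  have hk2 : deriv (deriv k) 0 ≠ 0 := by
    intro h0
    apply hne
    have h1 : L (deriv (deriv (f ∘ γ)) 0) = 0 := by
      rw [hfγ.deriv.deriv_eq, ← deriv_deriv_clm_comp L
        (hcσ.mono fun z hz => hz.differentiableAt hr0)
        (differentiableAt_deriv hr hcσ.self_of_nhds)]
      have h2 := deriv_deriv_comp hkd' hkd'' (hσd.mono fun z hz => hz.differentiableAt hr0)
        (differentiableAt_deriv hr hσd.self_of_nhds) hσ0 hk0
      rw [h0, zero_mul] at h2
      exact h2
    rw [limitingNormalCurvature, real_inner_comm, ← hLe, h1, zero_div]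
  -- the symmetry of the singular curve
  set s : ℝ → ℝ := fun z => ψ !₂[z, 0] 0 with hsdef
  have hsax : ∀ᶠ z in 𝓝 (0 : ℝ), ψ !₂[z, 0] = !₂[s z, 0] := by
    filter_upwards [tendsto_horizontal.eventually
      (hg.lam_lift_eq_zero hr0 hτ hψ hψ0 hlift hinv)] with z h1
    ext i; fin_cases i
    · rfl
    · exact h1 (by simp)
  have hsd : ∀ᶠ z in 𝓝 (0 : ℝ), ContDiffAt ℝ r s z := by
    filter_upwards [tendsto_horizontal.eventually hψ] with z hz
    refine contDiffAt_coord (hz.comp z ?_) 0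
    have : ContDiff ℝ r fun z : ℝ => (!₂[z, 0] : Plane) := by
      rw [contDiff_euclidean]
      intro i; fin_cases i <;> simp <;> fun_prop
    exact this.contDiffAt
  have hs0 : s 0 = 0 := by simp [hsdef, plane_zero, hψ0]
  have hsd' := hsd.mono fun z hz => hz.differentiableAt hr0
  have hss : ∀ᶠ z in 𝓝 (0 : ℝ), s (s z) = z := by
    filter_upwards [hsax, tendsto_horizontal.eventually hinv] with z h1 h2
    rw [h1] at h2
    show ψ !₂[s z, 0] 0 = z
    rw [h2]; simp
  have hs1 : deriv s 0 ^ 2 = 1 := by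
    have h1 : HasDerivAt s (deriv s 0) (s 0) := by rw [hs0]; exact hsd'.self_of_nhds.hasDerivAt
    have h2 := (h1.comp 0 hsd'.self_of_nhds.hasDerivAt).unique
      ((hasDerivAt_id 0).congr_of_eventuallyEq hss)
    rw [sq, h2]
  -- `T` maps `c z` to `c (s z)`, and its linear part multiplies the normal component by `δ`. With
  -- `s'(0)² = 1`, second derivatives at `0` give `k'' = δ k''`.
  have hks : k ∘ s =ᶠ[𝓝 0] fun z => δ * k z + (L (f p) - δ * L (f p)) := by
    filter_upwards [hsax, tendsto_horizontal.eventually hlift,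
      tendsto_spaceAxis.eventually ((h.tendsto_conj hA).eventually h.cod.left_inv)] with z h1 h2 h3
    rw [h1, hax, hax] at h2
    have h4 : c (s z) = A (c z - f p) + f p := by
      simp only [hc]
      rw [h2, h3, hA]
    have h5 : ∀ x, L (A x) = δ * L x := by
      intro x
      have h6 : (inner ℝ (A (ν p)) (A x) : ℝ) = inner ℝ (ν p) x := A.inner_map_map _ _
      rw [hs.map_n, inner_smul_left] at h6
      simp only [conj_trivial] at h6
      rw [hLe, hLe, ← h6]
      linear_combination (-(inner ℝ (ν p) (A x) : ℝ)) * hs.sq_δ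
    simp only [Function.comp_apply, hk, h4, map_add, map_sub, h5]
    ring
  have h7 := deriv_deriv_comp hkd' hkd'' hsd'
    (differentiableAt_deriv hr hsd.self_of_nhds) hs0 hk0
  rw [hs1, mul_one, hks.deriv.deriv_eq] at h7
  have h8 : deriv (deriv fun z => δ * k z + (L (f p) - δ * L (f p))) 0 =
      δ * deriv (deriv k) 0 := by
    simp
  rw [h8] at h7
  exact mul_right_cancel₀ hk2 (by rw [h7, one_mul])

/-! ### Invariant neighborhoods and self-intersections. -/

/-- Small connected invariant neighborhoods for the lift of an involutive isometry. -/
theorem exists_invariant_nhds (h : NormalForm r f p g φ φ' Φ Φ')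
    (hg : FrontalModel g GU E lam G mu)
    (hA : HasLinearPart T (f p) A)
    (hψ : ∀ᶠ q in 𝓝 (0 : Plane), ContDiffAt ℝ r ψ q) (hψ0 : ψ 0 = 0)
    (hlift : ∀ᶠ q in 𝓝 (0 : Plane), g (ψ q) = Φ (T (Φ' (g q))))
    (hinv : ∀ᶠ q in 𝓝 (0 : Plane), ψ (ψ q) = q) {V : Set Plane} (hV : V ∈ 𝓝 p)
    {P : Plane → Prop} (hP : ∀ᶠ q in 𝓝 p, P q) :
    ∃ W ⊆ V, IsOpen W ∧ IsConnected W ∧ p ∈ W ∧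
      ContDiffOn ℝ r (fun q => φ' (ψ (φ q))) W ∧ MapsTo (fun q => φ' (ψ (φ q))) W W ∧
      (∀ q ∈ W, φ' (ψ (φ (φ' (ψ (φ q))))) = q) ∧ (∀ q ∈ W, f (φ' (ψ (φ q))) = T (f q)) ∧
      ∀ q ∈ W, P q := by
  have hVe : ∀ᶠ q in 𝓝 p, q ∈ V := hV
  have h1 := h.contDiffAt_lift hψ0 hψ
  have h2 := h.involutive_lift hψ0 hψ hinv
  have h3 := h.lift hA hg hψ0 hψ hlift
  obtain ⟨W, hWo, hWc, hpW, hWm, hW⟩ := _root_.exists_invariant_nhds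
    (ψ := fun q => φ' (ψ (φ q))) (p := p)
    (P := fun q => q ∈ V ∧ ContDiffAt ℝ r (fun q => φ' (ψ (φ q))) q ∧
      φ' (ψ (φ (φ' (ψ (φ q))))) = q ∧ f (φ' (ψ (φ q))) = T (f q) ∧ P q)
    (by rw [h.dom.map_eq, hψ0, h.dom.map_symm]) (h1.mono fun q hq => hq.continuousAt) h2
    (by filter_upwards [hVe, h1, h2, h3, hP] with q a b c d e using ⟨a, b, c, d, e⟩)
  exact ⟨W, fun q hq => (hW q hq).1, hWo, hWc, hpW,
    fun q hq => (hW q hq).2.1.contDiffWithinAt, hWm, fun q hq => (hW q hq).2.2.1,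
    fun q hq => (hW q hq).2.2.2.1, fun q hq => (hW q hq).2.2.2.2⟩

/-- The self-intersections of swallowtails and cuspidal cross caps are fixed. -/
theorem exists_invariant_nhds_of_double (h : NormalForm r f p g φ φ' Φ Φ')
    (hr : r ≠ 0) (hg : FrontalModel g GU E lam G mu) {c : ℝ}
    (hdouble : ∀ q q', q' ≠ q → g q' = g q → q 0 = -c * q 1 ^ 2)
    (hsym : ∀ v : ℝ, g !₂[-c * v ^ 2, -v] = g !₂[-c * v ^ 2, v])
    (hsq : ∀ v w : ℝ, g !₂[-c * v ^ 2, v] = g !₂[-c * w ^ 2, w] → v ^ 2 = w ^ 2)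
    (hA : HasLinearPart T (f p) A)
    (hψ : ∀ᶠ q in 𝓝 (0 : Plane), ContDiffAt ℝ r ψ q) (hψ0 : ψ 0 = 0)
    (hlift : ∀ᶠ q in 𝓝 (0 : Plane), g (ψ q) = Φ (T (Φ' (g q))))
    (hinv : ∀ᶠ q in 𝓝 (0 : Plane), ψ (ψ q) = q) {ρ : ℝ} (hρ : ρ ≠ 0)
    (hd : fderiv ℝ ψ 0 !₂[0, 1] = ρ • !₂[0, 1]) {V : Set Plane} (hV : V ∈ 𝓝 p) :
    ∃ W ⊆ V, IsOpen W ∧ IsConnected W ∧ p ∈ W ∧ ∃ χ : Plane → Plane,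
      ContDiffOn ℝ r χ W ∧ MapsTo χ W W ∧
      (∀ q ∈ W, χ (χ q) = q) ∧ (∀ q ∈ W, f (χ q) = T (f q)) ∧
      (∀ q ∈ selfIntersectionSet f W, f (χ q) = f q) ∧
      (ρ < 0 → ∀ q ∈ selfIntersectionSet f W, χ q = q → q = p) ∧
      ∀ y ∈ f '' selfIntersectionSet f W, T y = y := by
  have hcurve := lift_double_curve (τ := fun y => Φ (T (Φ' y))) hdouble hsym hsq hr hψ.self_of_nhds hψ0 hlift hinv hρ hd
  have hψt : Tendsto ψ (𝓝 0) (𝓝 0) := by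
    have := hψ.self_of_nhds.continuousAt.tendsto
    rwa [hψ0] at this
  have hφ1 : Tendsto (fun q => φ q 1) (𝓝 p) (𝓝 0) := tendsto_coord h.dom.tendsto 1
  obtain ⟨W, hWV, hWo, hWc, hpW, hs, hm, hi, hl, hW⟩ := h.exists_invariant_nhds hg hA hψ hψ0 hlift
    hinv hV ((((h.dom.left_inv.and h.eq).and (hφ1.eventually hcurve)).and
      (h.dom.tendsto.eventually (hψt.eventually (h.dom.right_inv.and h.comp_symm)))).and h.eq_symm)
  have hdb : ∀ q ∈ selfIntersectionSet f W, φ q = !₂[-c * φ q 1 ^ 2, φ q 1] ∧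
      ψ (φ q) = !₂[-c * φ q 1 ^ 2, if 0 < ρ then φ q 1 else -φ q 1] := by
    rintro q ⟨hq, q', hq', hne, hfq⟩
    obtain ⟨⟨⟨⟨h1, h2⟩, h3⟩, -⟩, -⟩ := hW q hq
    obtain ⟨⟨⟨⟨h1', h2'⟩, -⟩, -⟩, -⟩ := hW q' hq'
    have h4 : φ q = !₂[-c * φ q 1 ^ 2, φ q 1] := by
      have := hdouble (φ q) (φ q') (fun h0 => hne (by rw [← h1', h0, h1]))
        (by rw [← h2, ← h2', hfq])
      ext i; fin_cases i
      · exact this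
      · rfl
    exact ⟨h4, by rw [← h3, ← h4]⟩
  have hfix : ∀ q ∈ selfIntersectionSet f W, f (φ' (ψ (φ q))) = f q := by
    intro q hq
    obtain ⟨h1, h2⟩ := hdb q hq
    obtain ⟨⟨-, -, h4⟩, h5⟩ := hW q hq.1
    rw [h4, h5, h2]
    congr 1
    split_ifs
    · rw [← h1]
    · rw [hsym, ← h1]
  refine ⟨W, hWV, hWo, hWc, hpW, _, hs, hm, hi, hl, hfix, ?_, ?_⟩
  · intro hρ' q hq hχ
    obtain ⟨h1, h2⟩ := hdb q hq
    obtain ⟨⟨⟨⟨h3, -⟩, -⟩, h4, -⟩, -⟩ := hW q hq.1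
    -- For `ρ < 0` the lift acts on the double curve by `v ↦ -v`, whose only fixed point is the
    -- origin.
    rw [if_neg (not_lt.2 hρ'.le)] at h2
    have h5 : φ q = ψ (φ q) := by rw [← h4]; exact (congrArg φ hχ).symm
    have h6 := congrArg (fun x : Plane => x 1) h5
    rw [h2] at h6
    have h7 : φ q 1 = 0 := by
      have h8 : φ q 1 = -φ q 1 := h6
      linarith
    rw [h7] at h1
    rw [← h3, h1]
    simp [plane_zero, h.dom.map_symm]
  · rintro _ ⟨q, hq, rfl⟩
    rw [← hl q hq.1, hfix q hq]

end NormalForm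

/-! ### The sign patterns for each singularity and the conclusion. -/

/-- `T` lifts to `C^r`-involutions with the property `C` on arbitrarily small connected
neighborhoods of `p`. -/
def HasInvolutiveLifts (r : WithTop ℕ∞) (f : Plane → Space) (p : Plane) (T : Space → Space)
    (C : Set Plane → (Plane → Plane) → Prop) : Prop :=
  ∀ V ∈ 𝓝 p, ∃ W ⊆ V, IsOpen W ∧ IsConnected W ∧ p ∈ W ∧ ∃ ψ : Plane → Plane,
    ContDiffOn ℝ r ψ W ∧ MapsTo ψ W W ∧
      (∀ q ∈ W, ψ (ψ q) = q) ∧ (∀ q ∈ W, f (ψ q) = T (f q)) ∧ C W ψ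

/-- The lift `ψ` fixes the image of the self-intersections, and it only fixes the point `p` among
them if `F` holds. -/
def FixesDoublePoints (f : Plane → Space) (p : Plane) (T : Space → Space) (F : Prop)
    (W : Set Plane) (ψ : Plane → Plane) : Prop :=
  (∀ q ∈ selfIntersectionSet f W, f (ψ q) = f q) ∧
  (F → ∀ q ∈ selfIntersectionSet f W, ψ q = q → q = p) ∧
  ∀ y ∈ f '' selfIntersectionSet f W, T y = y

section

variable {r : WithTop ℕ∞} {U : Set Plane} {f : Plane → Space} {p : Plane} {T : Space ≃ᵢ Space}
  {A : Space →ₗᵢ[ℝ] Space}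

theorem cuspidalEdge_symmetry (hr : r = ∞ ∨ r = ω) (hU : U ∈ 𝓝 p)
    (hf : ∀ᶠ x in 𝓝 p, ContDiffAt ℝ r f x) (hs : IsCuspidalEdge r f p)
    (hA : HasLinearPart T (f p) A)
    (hT : ∀ U' ⊆ U, IsOpen U' → p ∈ U' →
      ∃ V ⊆ U, IsOpen V ∧ p ∈ V ∧ T '' (f '' V) ⊆ f '' U') :
    Function.Involutive T ∧ (∃ ν, IsUnitNormalNear r f p ν) ∧
    HasInvolutiveLifts r f p T (fun _ _ => True) ∧
    ∃ α δ, ∀ ν, IsUnitNormalNear r f p ν → (∃ t b, SignFrame A t b (ν p) α 1 δ ∧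
      tangentDirection f p = ℝ ∙ t) ∧
      ∀ γ, IsSingularCurve r f U p γ → limitingNormalCurvature f γ (ν p) ≠ 0 → δ = 1 := by
  have hr0 := ne_zero_of_eq_infty_or_omega hr
  have hg := frontalModel_cuspidalEdge
  obtain ⟨φ, φ', Φ, Φ', h⟩ := hs.exists_normalForm hg.map_zero hf
  have hτ := h.localSymmetry hr0 hA hU hT
  obtain ⟨ψ, hψ, hψ0, hlift⟩ := exists_lift_cuspidalEdge hr hτ
  obtain ⟨α, β, δ, hM, hβ⟩ := cuspidalEdge_frame hr hτ hψ.self_of_nhds hψ0 hlift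
  have hframe : ∀ ν, IsUnitNormalNear r f p ν → ∃ t b, SignFrame A t b (ν p) α β δ ∧
      tangentDirection f p = ℝ ∙ t := fun ν hν =>
    h.exists_signFrame hr hg hA hν rfl
      ⟨2, two_ne_zero, by ext i; fin_cases i <;> simp⟩
      (fun w => ⟨w 2, w 0, w 1, by ext i; fin_cases i <;> simp⟩) hM
  have hν := h.exists_isUnitNormalNear hr hg
  obtain ⟨ν₀, hν₀⟩ := hν
  obtain ⟨t₀, b₀, hs₀, -⟩ := hframe ν₀ hν₀
  -- Orthogonality gives `β² = 1`, and `β ≥ 0` selects the sign.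
  have hβ1 : β = 1 := by nlinarith [hs₀.sq_β]
  subst hβ1
  have hTi := hA.involutive hs₀
  have hinv := hg.eventually_involutive (τ := fun y => Φ (T (Φ' y)))
    (hψ.mono fun q hq => hq.continuousAt) hψ0 hlift
    (h.conj_comp hA hTi)
  refine ⟨hTi, ⟨ν₀, hν₀⟩, fun V hV => ?_, α, δ, fun ν hν => ⟨hframe ν hν, fun γ hγ hne => ?_⟩⟩
  · obtain ⟨W, hWV, hWo, hWc, hpW, h1, h2, h3, h4, -⟩ := h.exists_invariant_nhds hg hA hψ hψ0 hlift
      hinv hV (P := fun _ => True) (Eventually.of_forall fun _ => trivial)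
    exact ⟨W, hWV, hWo, hWc, hpW, _, h1, h2, h3, h4, trivial⟩
  · obtain ⟨t, b, hs, -⟩ := hframe ν hν
    exact h.eq_one_of_limitingNormalCurvature_ne_zero hr hg rfl
      (fun u => by ext i; fin_cases i <;> simp [stdCuspidalEdge]) hA hτ hψ hψ0 hlift hinv hν hs
      hγ hne

theorem cuspidalCrossCap_symmetry (hr : r = ∞ ∨ r = ω) (hU : U ∈ 𝓝 p)
    (hf : ∀ᶠ x in 𝓝 p, ContDiffAt ℝ r f x) (hs : IsCuspidalCrossCap r f p)
    (hA : HasLinearPart T (f p) A)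
    (hT : ∀ U' ⊆ U, IsOpen U' → p ∈ U' →
      ∃ V ⊆ U, IsOpen V ∧ p ∈ V ∧ T '' (f '' V) ⊆ f '' U') :
    Function.Involutive T ∧ (∃ ν, IsUnitNormalNear r f p ν) ∧
    ∃ α ρ, (ρ = 1 ∨ ρ = -1) ∧
    HasInvolutiveLifts r f p T (FixesDoublePoints f p T (ρ < 0)) ∧
    ∀ ν, IsUnitNormalNear r f p ν → (∃ t b, SignFrame A t b (ν p) α 1 (α * ρ) ∧
      tangentDirection f p = ℝ ∙ t) ∧
      ∀ γ, IsSingularCurve r f U p γ → limitingNormalCurvature f γ (ν p) ≠ 0 → α * ρ = 1 := by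
  have hr0 := ne_zero_of_eq_infty_or_omega hr
  have hg := frontalModel_cuspidalCrossCap
  obtain ⟨φ, φ', Φ, Φ', h⟩ := hs.exists_normalForm hg.map_zero hf
  have hτ := h.localSymmetry hr0 hA hU hT
  obtain ⟨ψ, hψ, hψ0, hlift, hax⟩ := exists_lift_cuspidalCrossCap hr hτ
  obtain ⟨α, β, δ, ρ, hM, hβ, hδ, hd⟩ :=
    cuspidalCrossCap_frame hr hτ hψ.self_of_nhds hψ0 hlift hax
  have hframe : ∀ ν, IsUnitNormalNear r f p ν → ∃ t b, SignFrame A t b (ν p) α β δ ∧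
      tangentDirection f p = ℝ ∙ t := fun ν hν =>
    h.exists_signFrame hr hg hA hν (by ext i; fin_cases i <;> simp)
      ⟨2, two_ne_zero, by ext i; fin_cases i <;> simp⟩
      (fun w => ⟨w 2, w 0, w 1, by ext i; fin_cases i <;> simp⟩) hM
  have hν := h.exists_isUnitNormalNear hr hg
  obtain ⟨ν₀, hν₀⟩ := hν
  obtain ⟨t₀, b₀, hs₀, -⟩ := hframe ν₀ hν₀
  -- `β = ρ²` and `β² = 1`; hence `β = 1` and `δ = αρ³ = αρ`.
  have hρ2 : ρ ^ 2 = 1 := by nlinarith [hs₀.sq_β, sq_nonneg ρ]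
  have hβ1 : β = 1 := by rw [hβ, hρ2]
  have hδ1 : δ = α * ρ := by rw [hδ]; linear_combination α * ρ * hρ2
  subst hβ1 hδ1
  have hTi := hA.involutive hs₀
  have hinv := hg.eventually_involutive (τ := fun y => Φ (T (Φ' y)))
    (hψ.mono fun q hq => hq.continuousAt) hψ0 hlift
    (h.conj_comp hA hTi)
  refine ⟨hTi, ⟨ν₀, hν₀⟩, α, ρ, sq_eq_one_iff.1 hρ2, fun V hV => ?_,
    fun ν hν => ⟨hframe ν hν, fun γ hγ hne => ?_⟩⟩
  · exact h.exists_invariant_nhds_of_double hr0 hg (fun q q' => stdCuspidalCrossCap_double)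
      stdCuspidalCrossCap_symm (fun v w => stdCuspidalCrossCap_sq) hA hψ hψ0 hlift hinv
      (by rintro rfl; norm_num at hρ2) hd hV
  · obtain ⟨t, b, hs, -⟩ := hframe ν hν
    exact h.eq_one_of_limitingNormalCurvature_ne_zero hr hg
      (by ext i; fin_cases i <;> simp)
      (fun u => by ext i; fin_cases i <;> simp [stdCuspidalCrossCap]) hA hτ hψ hψ0 hlift hinv hν hs
      hγ hne

theorem swallowtail_symmetry (hr : r = ∞ ∨ r = ω) (hU : U ∈ 𝓝 p)
    (hf : ∀ᶠ x in 𝓝 p, ContDiffAt ℝ r f x) (hs : IsSwallowtail r f p)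
    (hA : HasLinearPart T (f p) A)
    (hT : ∀ U' ⊆ U, IsOpen U' → p ∈ U' →
      ∃ V ⊆ U, IsOpen V ∧ p ∈ V ∧ T '' (f '' V) ⊆ f '' U') :
    Function.Involutive T ∧ (∃ ν, IsUnitNormalNear r f p ν) ∧
    ∃ ρ, (ρ = 1 ∨ ρ = -1) ∧
    HasInvolutiveLifts r f p T (FixesDoublePoints f p T (ρ < 0)) ∧
    ∀ ν, IsUnitNormalNear r f p ν → ∃ t b, SignFrame A t b (ν p) 1 ρ 1 ∧
      tangentDirection f p = ℝ ∙ t := by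
  have hr0 := ne_zero_of_eq_infty_or_omega hr
  have hg := frontalModel_swallowtail
  obtain ⟨φ, φ', Φ, Φ', h⟩ := hs.exists_normalForm hg.map_zero hf
  have hτ := h.localSymmetry hr0 hA hU hT
  obtain ⟨ψ, hψ, hψ0, hlift, htan⟩ := exists_lift_swallowtail hr hτ
  obtain ⟨α, β, δ, ρ, hM, hβ, hδ, hα, hd⟩ :=
    swallowtail_frame hr hτ hψ.self_of_nhds hψ0 hlift htan
  have hframe : ∀ ν, IsUnitNormalNear r f p ν → ∃ t b, SignFrame A t b (ν p) α β δ ∧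
      tangentDirection f p = ℝ ∙ t := fun ν hν =>
    h.exists_signFrame hr hg hA hν (by ext i; fin_cases i <;> simp)
      ⟨1, one_ne_zero, by ext i; fin_cases i <;> simp⟩
      (fun w => ⟨w 2, w 1, w 0, by ext i; fin_cases i <;> simp⟩) hM
  have hν := h.exists_isUnitNormalNear hr hg
  obtain ⟨ν₀, hν₀⟩ := hν
  obtain ⟨t₀, b₀, hs₀, -⟩ := hframe ν₀ hν₀
  -- `β = ρ³` and `β² = 1` give `ρ⁶ = 1`. Then `β = ρ`, and the other two relations force `δ = α =
  -- 1`.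
  have hρ2 : ρ ^ 2 = 1 := by
    have h6 : (ρ ^ 2) ^ 3 = 1 := by
      rw [← hs₀.sq_β, hβ]; ring
    exact (pow_eq_one_iff_of_nonneg (sq_nonneg ρ) (by norm_num)).1 h6
  have hβ1 : β = ρ := by rw [hβ]; linear_combination ρ * hρ2
  have hδ1 : δ = 1 := by rw [hδ, hβ1, ← hρ2]; ring
  have hα1 : α = 1 := by rw [← hδ1, ← hα, hρ2, one_mul]
  rw [hα1, hβ1, hδ1] at hs₀ hframe
  have hTi := hA.involutive hs₀
  have hinv := hg.eventually_involutive (τ := fun y => Φ (T (Φ' y)))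
    (hψ.mono fun q hq => hq.continuousAt) hψ0 hlift
    (h.conj_comp hA hTi)
  refine ⟨hTi, ⟨ν₀, hν₀⟩, ρ, sq_eq_one_iff.1 hρ2, fun V hV => ?_, hframe⟩
  exact h.exists_invariant_nhds_of_double hr0 hg (fun q q' => stdSwallowtail_double)
    stdSwallowtail_symm (fun v w => stdSwallowtail_sq) hA hψ hψ0 hlift hinv
    (by rintro rfl; norm_num at hρ2) hd hV

/-- The sign patterns with positive middle entry. -/
theorem SignFrame.trichotomy {t b n : Space} {α δ : ℝ} (hs : SignFrame A t b n α 1 δ)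
    (hA : HasLinearPart T (f p) A) (hne : T ≠ IsometryEquiv.refl Space) :
    α = 1 ∧ δ = -1 ∨ α = -1 ∧ δ = 1 ∨ α = -1 ∧ δ = -1 := by
  rcases sq_eq_one_iff.1 hs.sq_α with rfl | rfl <;> rcases sq_eq_one_iff.1 hs.sq_δ with rfl | rfl
  · exact absurd (hA.eq_refl hs) hne
  · exact Or.inl ⟨rfl, rfl⟩
  · exact Or.inr (Or.inl ⟨rfl, rfl⟩)
  · exact Or.inr (Or.inr ⟨rfl, rfl⟩)

theorem SignFrame.isReflectionIn {t b n : Space} {α δ : ℝ} (hs : SignFrame A t b n α 1 δ)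
    (ht : tangentDirection f p = ℝ ∙ t)
    (hA : HasLinearPart T (f p) A) (hne : T ≠ IsometryEquiv.refl Space) :
    IsReflectionIn T (_root_.limitingTangentPlane f p n) ∨
        IsReflectionIn T (_root_.normalPlane f p) ∨
        IsReflectionIn T (_root_.conormalPlane f p n) ∨
        IsReflectionIn T (_root_.conormalLine f p n) := by
  rcases hs.trichotomy hA hne with ⟨rfl, rfl⟩ | ⟨rfl, rfl⟩ | ⟨rfl, rfl⟩
  · exact Or.inl (hs.limitingTangentPlane hA)
  · exact Or.inr (Or.inl (hs.normalPlane hA ht))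
  · exact Or.inr (Or.inr (Or.inr (hs.conormalLine hA ht)))

theorem SignFrame.eq_neg_one {t b n : Space} {β : ℝ} (hs : SignFrame A t b n 1 β 1)
    (hA : HasLinearPart T (f p) A) (hne : T ≠ IsometryEquiv.refl Space) : β = -1 := by
  rcases sq_eq_one_iff.1 hs.sq_β with rfl | rfl
  · exact absurd (hA.eq_refl hs) hne
  · rfl

/-- If the curvature condition forces the third sign to be positive, an isometry with positive
second sign is the reflection in the normal plane. -/
theorem SignFrame.not_conormalPlane_and {t b n : Space} {α δ : ℝ} (hs : SignFrame A t b n α 1 δ)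
    (ht : tangentDirection f p = ℝ ∙ t) (hA : HasLinearPart T (f p) A)
    (hne : T ≠ IsometryEquiv.refl Space)
    (hc : ∀ γ, IsSingularCurve r f U p γ → limitingNormalCurvature f γ n ≠ 0 → δ = 1) :
    ¬ IsReflectionIn T (_root_.conormalPlane f p n) ∧
        ∀ γ, IsSingularCurve r f U p γ → limitingNormalCurvature f γ n ≠ 0 →
          IsReflectionIn T (_root_.normalPlane f p) := by
  refine ⟨hs.not_conormalPlane hA ht, fun γ hγ hκ => ?_⟩
  have hδ := hc γ hγ hκ
  subst hδ
  rcases hs.trichotomy hA hne with ⟨-, h⟩ | ⟨rfl, -⟩ | ⟨-, h⟩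
  · norm_num at h
  · exact hs.normalPlane hA ht
  · norm_num at h

end

theorem theoremC (r : WithTop ℕ∞) (hr : r = ∞ ∨ r = ω)
    (U : Set Plane) (hU : IsOpen U) (f : Plane → Space) (hf : ContDiffOn ℝ r f U)
    (p : Plane) (hp : p ∈ U)
    (hsing : IsCuspidalEdge r f p ∨ IsSwallowtail r f p ∨ IsCuspidalCrossCap r f p)
    (T : Space ≃ᵢ Space) (hTp : T (f p) = f p)
    -- the inclusion of the germ at `p` of the image of `T ∘ f` in that of the image of `f`
    (hT : ∀ U' ⊆ U, IsOpen U' → p ∈ U' →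
      ∃ V ⊆ U, IsOpen V ∧ p ∈ V ∧ T '' (f '' V) ⊆ f '' U') :
    Function.Involutive T ∧
    (∃ ν, IsUnitNormalNear r f p ν) ∧
    ∀ ν, IsUnitNormalNear r f p ν →
      (T ≠ IsometryEquiv.refl Space →
        IsReflectionIn T (limitingTangentPlane f p (ν p)) ∨
        IsReflectionIn T (normalPlane f p) ∨
        IsReflectionIn T (conormalPlane f p (ν p)) ∨
        IsReflectionIn T (conormalLine f p (ν p))) ∧
      -- the involution `ψ`, and (c2)
      (∀ V ⊆ U, IsOpen V → p ∈ V →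
        ∃ W ⊆ V, IsOpen W ∧ IsConnected W ∧ p ∈ W ∧
          ∃ ψ : Plane → Plane, ContDiffOn ℝ r ψ W ∧ MapsTo ψ W W ∧
            (∀ q ∈ W, ψ (ψ q) = q) ∧ (∀ q ∈ W, f (ψ q) = T (f q)) ∧
            (T ≠ IsometryEquiv.refl Space → IsSwallowtail r f p ∨ IsCuspidalCrossCap r f p →
              (∀ q ∈ selfIntersectionSet f W, f (ψ q) = f q) ∧
              (¬ IsReflectionIn T (conormalLine f p (ν p)) →
                ∀ q ∈ selfIntersectionSet f W, ψ q = q → q = p) ∧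
              ∀ y ∈ f '' selfIntersectionSet f W, T y = y)) ∧
      -- (c1)
      (T ≠ IsometryEquiv.refl Space → IsCuspidalEdge r f p ∨ IsCuspidalCrossCap r f p →
        ¬ IsReflectionIn T (conormalPlane f p (ν p)) ∧
        ∀ γ, IsSingularCurve r f U p γ → limitingNormalCurvature f γ (ν p) ≠ 0 →
          IsReflectionIn T (normalPlane f p)) ∧
      -- (c3)
      (T ≠ IsometryEquiv.refl Space → IsSwallowtail r f p →
        IsReflectionIn T (conormalPlane f p (ν p))) := by
  have hUp : U ∈ 𝓝 p := hU.mem_nhds hp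
  have hfp : ∀ᶠ x in 𝓝 p, ContDiffAt ℝ r f x := by
    filter_upwards [hUp] with x hx
    exact hf.contDiffAt (hU.mem_nhds hx)
  obtain ⟨A, hA⟩ := exists_hasLinearPart T hTp
  -- The assertions for a given type of singularity are derived from that type alone, so the three
  -- types need not be shown to be mutually exclusive.
  have hc1 : ∀ ν, IsUnitNormalNear r f p ν → T ≠ IsometryEquiv.refl Space →
      IsCuspidalEdge r f p ∨ IsCuspidalCrossCap r f p →
        ¬ IsReflectionIn T (conormalPlane f p (ν p)) ∧
        ∀ γ, IsSingularCurve r f U p γ → limitingNormalCurvature f γ (ν p) ≠ 0 →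
          IsReflectionIn T (normalPlane f p) := by
    rintro ν hν hne (hC | hCW)
    · obtain ⟨-, -, -, α, δ, h⟩ := cuspidalEdge_symmetry hr hUp hfp hC hA hT
      obtain ⟨⟨t, b, hs, ht⟩, hκ⟩ := h ν hν
      exact hs.not_conormalPlane_and ht hA hne hκ
    · obtain ⟨-, -, α, ρ, -, -, h⟩ := cuspidalCrossCap_symmetry hr hUp hfp hCW hA hT
      obtain ⟨⟨t, b, hs, ht⟩, hκ⟩ := h ν hν
      exact hs.not_conormalPlane_and ht hA hne hκ
  have hc3 : ∀ ν, IsUnitNormalNear r f p ν → T ≠ IsometryEquiv.refl Space →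
      IsSwallowtail r f p → IsReflectionIn T (conormalPlane f p (ν p)) := by
    intro ν hν hne hS
    obtain ⟨-, -, ρ, -, -, h⟩ := swallowtail_symmetry hr hUp hfp hS hA hT
    obtain ⟨t, b, hs, ht⟩ := h ν hν
    obtain rfl := hs.eq_neg_one hA hne
    exact hs.conormalPlane hA ht
  by_cases hS : IsSwallowtail r f p
  · obtain ⟨hTi, hν, ρ, -, hW, h⟩ := swallowtail_symmetry hr hUp hfp hS hA hT
    refine ⟨hTi, hν, fun ν hν => ⟨fun hne => Or.inr (Or.inr (Or.inl (hc3 ν hν hne hS))),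
      fun V _ hVo hpV => ?_, hc1 ν hν, hc3 ν hν⟩⟩
    obtain ⟨W, hWV, hWo, hWc, hpW, ψ, h1, h2, h3, h4, h5, h6, h7⟩ := hW V (hVo.mem_nhds hpV)
    refine ⟨W, hWV, hWo, hWc, hpW, ψ, h1, h2, h3, h4, fun hne _ => ⟨h5, fun _ => h6 ?_, h7⟩⟩
    obtain ⟨t, b, hs, ht⟩ := h ν hν
    rw [hs.eq_neg_one hA hne]
    norm_num
  by_cases hCW : IsCuspidalCrossCap r f p
  · obtain ⟨hTi, hν, α, ρ, hρ, hW, h⟩ := cuspidalCrossCap_symmetry hr hUp hfp hCW hA hT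
    refine ⟨hTi, hν, fun ν hν => ?_⟩
    obtain ⟨⟨t, b, hs, ht⟩, -⟩ := h ν hν
    refine ⟨hs.isReflectionIn ht hA, fun V _ hVo hpV => ?_, hc1 ν hν, hc3 ν hν⟩
    obtain ⟨W, hWV, hWo, hWc, hpW, ψ, h1, h2, h3, h4, h5, h6, h7⟩ := hW V (hVo.mem_nhds hpV)
    refine ⟨W, hWV, hWo, hWc, hpW, ψ, h1, h2, h3, h4, fun hne _ => ⟨h5, fun hl => h6 ?_, h7⟩⟩
    rcases hρ with rfl | rfl
    -- With `ρ = 1` the signs `α` and `δ` agree, so a nontrivial `T` is the rotation about the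
    -- co-normal line, which is excluded here.
    · rw [mul_one] at hs
      rcases hs.trichotomy hA hne with ⟨ha, hb⟩ | ⟨ha, hb⟩ | ⟨ha, -⟩
      · rw [ha] at hb; norm_num at hb
      · rw [ha] at hb; norm_num at hb
      · subst ha
        exact absurd (hs.conormalLine hA ht) hl
    · norm_num
  have hC : IsCuspidalEdge r f p := by
    rcases hsing with h | h | h
    · exact h
    · exact absurd h hS
    · exact absurd h hCW
  obtain ⟨hTi, hν, hW, α, δ, h⟩ := cuspidalEdge_symmetry hr hUp hfp hC hA hT
  refine ⟨hTi, hν, fun ν hν => ?_⟩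
  obtain ⟨⟨t, b, hs, ht⟩, -⟩ := h ν hν
  refine ⟨hs.isReflectionIn ht hA, fun V _ hVo hpV => ?_, hc1 ν hν, hc3 ν hν⟩
  obtain ⟨W, hWV, hWo, hWc, hpW, ψ, h1, h2, h3, h4, -⟩ := hW V (hVo.mem_nhds hpV)
  exact ⟨W, hWV, hWo, hWc, hpW, ψ, h1, h2, h3, h4, fun _ h => absurd h (not_or.2 ⟨hS, hCW⟩)⟩
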